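/- **Conventions.** For a skew-symmetric real form $\theta$ on $\mathbb R^n\supset\mathbb Z^n$ let $\mathcal A_\theta$ denote the smooth noncommutative torus: the $*$-algebra of sums $\sum_{\nu\in\mathbb Z^n}a_\nu U_\nu$ with rapidly decreasing coefficients, with unitary $U_\nu$ and $U_\mu U_\nu=e^{\pi i\theta(\mu,\nu)}U_{\mu+\nu}$, derivations $\delta_\alpha U_\nu=2\pi i\langle\alpha,\nu\rangle U_\nu$ ($\alpha\in\mathbb R^n$) and trace $\tau(\sum a_\nu U_\nu)=a_0$. A connection on a left module satisfies $\nabla_\alpha(ae)=a\nabla_\alpha e+\delta_\alpha(a)e$; a Hermitian module carries a positive definite $\mathcal A_\theta$-valued inner product, linear in the first variable, and the connection is Hermitian if $\delta_\alpha\langle e,f\rangle=\langle\nabla_\alpha e,f\rangle+\langle e,\nabla_\alpha f\rangle$. On $\mathbb R^4\oplus(\mathbb R^4)'$ (with $(\mathbb R^4)'=\mathbb R^4$ by the standard basis) let $\Omega((x_1,y_1),(x_2,y_2))=\langle y_2,x_1\rangle-\langle y_1,x_2\rangle$. On $\mathcal S(\mathbb R^4)$ put $((x,y)f)(z)=e^{2\pi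 i\langle y,z\rangle}f(z+x)$ and $(Q_{(x,y)}f)(z)=2\pi i\langle y,z\rangle f(z)+\frac{d}{dt}f(z+tx)|_{t=0}$. Let $\theta,\hat\theta$ be real skew-symmetric forms on $\mathbb R^4$, let $\eta$ be a skew-symmetric form on $\mathbb R^8=\mathbb R^4\oplus\mathbb R^4$ that is integral on $\mathbb Z^8$, and put $\Theta=\theta\oplus(-\hat\theta)+\eta$. The mixed part of $\eta$ is the bilinear form $(x,y)\mapsto\eta((x,0),(0,y))$. 1. $[Q_v,w]=2\pi i\,\Omega(v,w)\,w$ and $[Q_v,Q_w]=2\pi i\,\Omega(v,w)\,\mathrm{Id}$ as operators on $\mathcal S(\mathbb R^4)$, for $v,w\in\mathbb R^4\oplus(\mathbb R^4)'$. 2. There is a linear map $T:\mathbb R^8\to\mathbb R^4\oplus(\mathbb R^4)'$ with $T^*\Omega=\Theta$. Such a $T$ is bijective if and only if $\Theta$ is nondegenerate, and in that case any two such maps differ by a symplectic map: $T'=S\circ T$ with $S^*\Omega=\Omega$. 3. Let $\Theta$ be nondegenerate and $T^*\Omega=\Theta$. There are unique linear maps $V_1,V_2$ with $\Omega(V_1(\alpha),T(\nu,\mu))=\langle\alpha,\nu\rangle$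 and $\Omega(V_2(\alpha),T(\nu,\mu))=\langle\alpha,\mu\rangle$. There is a unique left action of $\mathcal A_{\theta\oplus(-\hat\theta)}$ on $\mathcal S(\mathbb R^4)$ in which the generators $U_{e_k}$, $1\le k\le 8$, act as $T(e_k)$ and $(\sum a_\nu U_\nu)f=\sum a_\nu U_\nu f$ with convergence in $\mathcal S(\mathbb R^4)$. Each $U_\nu$ acts as $T(\nu)$ times a complex number of modulus 1, and the action amounts to commuting left and right actions of $\mathcal A_\theta$ and $\mathcal A_{\hat\theta}$. The module is finitely generated projective over $\mathcal A_{\theta\oplus(-\hat\theta)}$, and Hermitian for the inner product with coefficients $\langle f,g\rangle_\nu=\int f\,\overline{U_\nu g}$. $\nabla_\alpha=Q_{V_1(\alpha)}$ is an $\mathcal A_\theta$-connection commuting with $\mathcal A_{\hat\theta}$, and $\hat\nabla_\beta=Q_{V_2(\beta)}$ is an $\mathcal A_{\hat\theta}$-connection commuting with $\mathcal A_\theta$. Together they form a Hermitian connection on the $\mathcal A_{\theta\oplus(-\hat\theta)}$-module whose curvature is constant, the scalar two-form $2\pi i\,\Omega(V(\gamma),V(\gamma'))$ with $V=V_1\oplus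 V_2$; in particular $[\nabla_\alpha,\hat\nabla_\beta]=\sigma(\alpha,\beta)\,\mathrm{Id}$ with $\sigma(\alpha,\beta)=2\pi i\,\Omega(V_1(\alpha),V_2(\beta))$. The pairing $\sigma$ is nondegenerate if and only if the mixed part of $\eta$ is nondegenerate. 4. Genericity. (a) If the mixed part of $\eta$ is nondegenerate, then for all pairs $(\theta,\hat\theta)$ of skew-symmetric forms outside a proper algebraic subset, $\theta$, $\hat\theta$ and $\Theta$ are nondegenerate and $\sigma$ is nondegenerate for every $T$ with $T^*\Omega=\Theta$. (b) For every $(\theta,\hat\theta)$, and for all integral $\eta$ outside the zero set of a polynomial that does not vanish at all integral skew-symmetric $\eta$, $\Theta$ is nondegenerate and $\sigma$ is nondegenerate for every $T$ with $T^*\Omega=\Theta$. 5. The Poincaré module. Let $\mathcal P$ be the space of smooth functions $f(x,\hat x)$ on $\mathbb R^4\oplus(\mathbb R^4)'$ with $f(x+\lambda,\hat x+\hat\lambda)=e^{-2\pi i\langle\hat\lambda,x\rangle}f(x,\hat x)$ for $\lambda\in\mathbb Z^4$, $\hat\lambda\in(\mathbb Z^4)'$, on which periodic functions act by multiplication, with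 the connection $d+2\pi i\langle\hat x,dx\rangle$ and the inner product $f\overline{\tilde f}$. It is the module of part 3 for $\theta=\hat\theta=0$, $T_0(x,y)=(-x,y)$ and the integral form $\eta_0((x_1,y_1),(x_2,y_2))=\langle y_1,x_2\rangle-\langle y_2,x_1\rangle$, which satisfies $T_0^*\Omega=\eta_0$; here $\sigma$ is nondegenerate. That is, $\phi\mapsto f(x,\hat x)=\sum_{\mu}e^{2\pi i\langle\mu,x\rangle}\phi(\hat x+\mu)$ is a linear bijection $\mathcal S((\mathbb R^4)')\to\mathcal P$, with inverse $\phi(\hat x)=\int_{[0,1]^4}f(x,\hat x)\,dx$, which carries the action, the connection and the torus-valued inner product of part 3 to those of $\mathcal P$. On $\phi$ one has $U_\mu\phi(\hat x)=\phi(\hat x-\mu)$, $\hat U_\nu\phi(\hat x)=e^{2\pi i\langle\nu,\hat x\rangle}\phi(\hat x)$, $\nabla_y\phi(\hat x)=2\pi i\langle y,\hat x\rangle\phi(\hat x)$, $\hat\nabla_{\hat y}\phi(\hat x)=\frac{d}{dt}\phi(\hat x+t\hat y)|_{t=0}$, and $\int_{[0,1]^8}f\overline{\tilde f}=\int\phi\,\overline{\tilde\phi}$.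 6. Deformation. For real $4\times4$ matrices $A,B,C,D$ and an integral $4\times 4$ matrix $E$, the map $T(\mu,\nu)=(-D\mu-A\nu,\;B\mu+C\nu)$ satisfies $T^*\Omega=\theta\oplus(-\hat\theta)+\eta_E$, with $\eta_E$ the form whose mixed part is $E$ and whose other parts are zero, if and only if $B^tD-D^tB=\theta$, $C^tA-A^tC=-\hat\theta$ and $B^tA-D^tC=E$. There are $\varepsilon>0$ and matrices $A,B,C,D$ depending continuously on skew-symmetric $\theta,\hat\theta$ with all entries less than $\varepsilon$ in absolute value, equal to $0,0,1,1$ at $\theta=\hat\theta=0$ (so that $T=T_0$ there), such that for all such $\theta,\hat\theta$ the resulting $T$ satisfies $T^*\Omega=\theta\oplus(-\hat\theta)+\eta_0$, this form is nondegenerate, and the resulting module over $\mathcal A_{\theta\oplus(-\hat\theta)}$ is, as in part 3, a finitely generated projective Hermitian module with a Hermitian connection of constant curvature, with $\sigma$ nondegenerate. -/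

import Mathlib

open scoped SchwartzMap ContDiff Matrix Topology

noncomputable section

/-! ### Smooth noncommutative tori -/

section Torus

variable {ι : Type} [Fintype ι]

/-- The bilinear form `⟨v, θ w⟩` on `ℝ^ι` with matrix `θ`. -/
def formOf (θ : Matrix ι ι ℝ) (v w : ι → ℝ) : ℝ := v ⬝ᵥ (θ *ᵥ w)

/-- The inclusion of the lattice `ℤ^ι` in `ℝ^ι`. -/
def latticeVec {κ : Type} (ν : κ → ℤ) : κ → ℝ := fun i => (ν i : ℝ)

/-- The cocycle `exp (π i θ(μ, ν))` on the lattice `ℤ^ι`. -/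
def torusCocycle (θ : Matrix ι ι ℝ) (μ ν : ι → ℤ) : ℂ :=
  Complex.exp (Real.pi * Complex.I * (formOf θ (latticeVec μ) (latticeVec ν) : ℝ))

/-- The smooth noncommutative torus: formal sums `∑ a_ν U_ν`, `ν ∈ ℤ^ι`, with rapidly decreasing
coefficients (`∑ (1 + |ν|)^k |a_ν| < ∞` for all `k`, equivalently all `(1 + |ν|)^k |a_ν|` are
bounded), where `U_μ U_ν = exp (π i θ(μ, ν)) U_{μ + ν}`. -/
@[ext] structure SmoothTorus (θ : Matrix ι ι ℝ) where
  coeff : (ι → ℤ) → ℂ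
  rapid : ∀ k : ℕ, Summable fun ν => (1 + ‖ν‖) ^ k * ‖coeff ν‖

namespace SmoothTorus

variable {θ : Matrix ι ι ℝ}

theorem summable_norm (a : SmoothTorus θ) : Summable fun ν => ‖a.coeff ν‖ := by
  simpa using a.rapid 0

theorem norm_torusCocycle (θ : Matrix ι ι ℝ) (μ ν : ι → ℤ) : ‖torusCocycle θ μ ν‖ = 1 := by
  unfold torusCocycle
  rw [mul_right_comm, ← Complex.ofReal_mul, Complex.norm_exp_ofReal_mul_I]

theorem torusCocycle_zero_left (ν : ι → ℤ) : torusCocycle θ 0 ν = 1 := by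
  have : latticeVec (0 : ι → ℤ) = 0 := by ext; simp [latticeVec]
  simp [torusCocycle, formOf, this]

theorem torusCocycle_zero_right (ν : ι → ℤ) : torusCocycle θ ν 0 = 1 := by
  have : latticeVec (0 : ι → ℤ) = 0 := by ext; simp [latticeVec]
  simp [torusCocycle, formOf, this]

theorem torusCocycle_assoc (l m n : ι → ℤ) :
    torusCocycle θ l (m - l) * torusCocycle θ m (n - m)
      = torusCocycle θ (m - l) (n - m) * torusCocycle θ l (n - l) := by
  have h : ∀ u v : ι → ℤ, latticeVec (u - v) = latticeVec u - latticeVec v := by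
    intro u v; ext; simp [latticeVec]
  simp only [torusCocycle, ← Complex.exp_add, h, formOf, Matrix.mulVec_sub, dotProduct_sub,
    sub_dotProduct]
  congr 1
  push_cast
  ring

theorem one_add_norm_le (m n : ι → ℤ) : 1 + ‖n‖ ≤ (1 + ‖m‖) * (1 + ‖n - m‖) := by
  have h1 : ‖n‖ ≤ ‖m‖ + ‖n - m‖ := by
    calc ‖n‖ = ‖m + (n - m)‖ := by congr 1; abel
      _ ≤ _ := norm_add_le _ _
  nlinarith [norm_nonneg m, norm_nonneg (n - m), mul_nonneg (norm_nonneg m) (norm_nonneg (n - m))]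

/-- The change of variables `(n, m) ↦ (m, n - m)`. -/
def shear (κ : Type) : (κ → ℤ) × (κ → ℤ) ≃ (κ → ℤ) × (κ → ℤ) where
  toFun p := (p.2, p.1 - p.2)
  invFun q := (q.1 + q.2, q.1)
  left_inv p := by ext <;> simp
  right_inv q := by ext <;> simp

theorem summable_conv {κ : Type} {f g : (κ → ℤ) → ℝ} (hf : Summable f) (hg : Summable g)
    (hf0 : 0 ≤ f) (hg0 : 0 ≤ g) :
    Summable fun p : (κ → ℤ) × (κ → ℤ) => f p.2 * g (p.1 - p.2) :=
  (shear κ).summable_iff.mpr (hf.mul_of_nonneg hg hf0 hg0)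

instance : Zero (SmoothTorus θ) := ⟨⟨0, fun k => by simp⟩⟩

instance : Add (SmoothTorus θ) := ⟨fun a b => ⟨fun ν => a.coeff ν + b.coeff ν, fun k => by
  refine Summable.of_nonneg_of_le (fun ν => by positivity) (fun ν => ?_)
    ((a.rapid k).add (b.rapid k))
  rw [← mul_add]
  exact mul_le_mul_of_nonneg_left (norm_add_le _ _) (by positivity)⟩⟩

instance : Neg (SmoothTorus θ) := ⟨fun a => ⟨fun ν => -a.coeff ν, fun k => by
  simpa using a.rapid k⟩⟩

instance : SMul ℂ (SmoothTorus θ) := ⟨fun c a => ⟨fun ν => c * a.coeff ν, fun k => by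
  refine ((a.rapid k).mul_left ‖c‖).congr fun ν => ?_
  rw [norm_mul]; ring⟩⟩

@[simp] theorem zero_coeff (ν : ι → ℤ) : (0 : SmoothTorus θ).coeff ν = 0 := rfl
@[simp] theorem add_coeff (a b : SmoothTorus θ) (ν : ι → ℤ) :
    (a + b).coeff ν = a.coeff ν + b.coeff ν := rfl
@[simp] theorem neg_coeff (a : SmoothTorus θ) (ν : ι → ℤ) : (-a).coeff ν = -a.coeff ν := rfl
@[simp] theorem smul_coeff (c : ℂ) (a : SmoothTorus θ) (ν : ι → ℤ) :
    (c • a).coeff ν = c * a.coeff ν := rfl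

instance : AddCommGroup (SmoothTorus θ) where
  add_assoc a b c := by ext; simp [add_assoc]
  zero_add a := by ext; simp
  add_zero a := by ext; simp
  add_comm a b := by ext; simp [add_comm]
  neg_add_cancel a := by ext; simp
  nsmul := nsmulRec
  zsmul := zsmulRec

instance : Module ℂ (SmoothTorus θ) where
  one_smul a := by ext; simp
  mul_smul c d a := by ext; simp [mul_assoc]
  smul_zero c := by ext; simp
  smul_add c a b := by ext; simp [mul_add]
  add_smul c d a := by ext; simp [add_mul]
  zero_smul a := by ext; simp

theorem summable_mul_coeff (a b : SmoothTorus θ) (ν : ι → ℤ) :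
    Summable fun m => a.coeff m * b.coeff (ν - m) * torusCocycle θ m (ν - m) := by
  refine Summable.of_norm ?_
  refine ((summable_conv a.summable_norm b.summable_norm (fun _ => norm_nonneg _)
    (fun _ => norm_nonneg _)).prod_factor ν).congr fun m => ?_
  simp [norm_torusCocycle]

/-- The twisted convolution product. -/
instance : Mul (SmoothTorus θ) := ⟨fun a b =>
  ⟨fun ν => ∑' m, a.coeff m * b.coeff (ν - m) * torusCocycle θ m (ν - m), fun k => by
    have hs := summable_conv (a.rapid k) (b.rapid k) (fun _ => by positivity)
      (fun _ => by positivity)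
    refine Summable.of_nonneg_of_le (fun ν => by positivity) (fun ν => ?_) hs.prod
    have h2 := (summable_mul_coeff a b ν).norm
    calc (1 + ‖ν‖) ^ k * ‖∑' m, a.coeff m * b.coeff (ν - m) * torusCocycle θ m (ν - m)‖
        ≤ (1 + ‖ν‖) ^ k * ∑' m, ‖a.coeff m * b.coeff (ν - m) * torusCocycle θ m (ν - m)‖ := by
          gcongr; exact norm_tsum_le_tsum_norm h2
      _ = ∑' m, (1 + ‖ν‖) ^ k * ‖a.coeff m * b.coeff (ν - m) * torusCocycle θ m (ν - m)‖ :=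
          tsum_mul_left.symm
      _ ≤ _ := by
          refine (h2.mul_left _).tsum_le_tsum (fun m => ?_) (hs.prod_factor ν)
          rw [norm_mul, norm_mul, norm_torusCocycle, mul_one]
          calc (1 + ‖ν‖) ^ k * (‖a.coeff m‖ * ‖b.coeff (ν - m)‖)
              ≤ ((1 + ‖m‖) * (1 + ‖ν - m‖)) ^ k * (‖a.coeff m‖ * ‖b.coeff (ν - m)‖) := by
                gcongr; exact one_add_norm_le m ν
            _ = _ := by rw [mul_pow]; ring⟩⟩

theorem mul_coeff (a b : SmoothTorus θ) (ν : ι → ℤ) :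
    (a * b).coeff ν = ∑' m, a.coeff m * b.coeff (ν - m) * torusCocycle θ m (ν - m) := rfl

open Classical in
/-- The unitary generator `U_ν`. -/
def U (θ : Matrix ι ι ℝ) (ν : ι → ℤ) : SmoothTorus θ where
  coeff := Pi.single ν 1
  rapid k := by
    refine summable_of_ne_finset_zero (s := {ν}) fun μ hμ => ?_
    simp [Pi.single_eq_of_ne (by simpa using hμ : μ ≠ ν)]

instance : One (SmoothTorus θ) := ⟨U θ 0⟩

theorem one_coeff_of_ne {ν : ι → ℤ} (h : ν ≠ 0) : (1 : SmoothTorus θ).coeff ν = 0 :=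
  Pi.single_eq_of_ne h _

theorem one_coeff_zero : (1 : SmoothTorus θ).coeff 0 = 1 := Pi.single_eq_same _ _

theorem summable_triple (a b c : SmoothTorus θ) (n : ι → ℤ) :
    Summable (Function.uncurry fun m l : ι → ℤ =>
      a.coeff l * b.coeff (m - l) * torusCocycle θ l (m - l) * c.coeff (n - m) *
        torusCocycle θ m (n - m)) := by
  have hC : ∀ ν, ‖c.coeff ν‖ ≤ ∑' μ, ‖c.coeff μ‖ := fun ν =>
    c.summable_norm.le_tsum ν fun _ _ => norm_nonneg _
  refine Summable.of_norm_bounded ((summable_conv a.summable_norm b.summable_norm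
    (fun _ => norm_nonneg _) (fun _ => norm_nonneg _)).mul_right (∑' μ, ‖c.coeff μ‖)) ?_
  rintro ⟨m, l⟩
  simp only [Function.uncurry_apply_pair, norm_mul, norm_torusCocycle, mul_one]
  exact mul_le_mul_of_nonneg_left (hC _) (by positivity)

theorem mul_mul_coeff_left (a b c : SmoothTorus θ) (n : ι → ℤ) :
    (a * b * c).coeff n = ∑' m, ∑' l, a.coeff l * b.coeff (m - l) * torusCocycle θ l (m - l) *
      c.coeff (n - m) * torusCocycle θ m (n - m) := by
  rw [mul_coeff]
  refine tsum_congr fun m => ?_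
  rw [mul_coeff, ← tsum_mul_right, ← tsum_mul_right]

theorem mul_mul_coeff_right (a b c : SmoothTorus θ) (n : ι → ℤ) :
    (a * (b * c)).coeff n = ∑' l, ∑' m, a.coeff l * b.coeff (m - l) * torusCocycle θ l (m - l) *
      c.coeff (n - m) * torusCocycle θ m (n - m) := by
  rw [mul_coeff]
  refine tsum_congr fun l => ?_
  rw [mul_coeff, ← tsum_mul_left, ← tsum_mul_right]
  rw [← (Equiv.subRight l).tsum_eq]
  refine tsum_congr fun m => ?_
  have h : n - l - (m - l) = n - m := by abel
  have h2 := torusCocycle_assoc (θ := θ) l m n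
  rw [Equiv.subRight_apply, h]
  calc _ = a.coeff l * b.coeff (m - l) * c.coeff (n - m) *
        (torusCocycle θ (m - l) (n - m) * torusCocycle θ l (n - l)) := by ring
    _ = _ := by rw [← h2]; ring

protected theorem mul_assoc (a b c : SmoothTorus θ) : a * b * c = a * (b * c) := by
  ext n
  rw [mul_mul_coeff_left, mul_mul_coeff_right]
  exact (summable_triple a b c n).tsum_comm.symm

instance : Ring (SmoothTorus θ) where
  __ := (inferInstance : AddCommGroup (SmoothTorus θ))
  mul_assoc := SmoothTorus.mul_assoc
  one_mul a := by
    ext n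
    rw [mul_coeff, tsum_eq_single 0 fun m hm => by rw [one_coeff_of_ne hm]; ring]
    simp [one_coeff_zero, torusCocycle_zero_left]
  mul_one a := by
    ext n
    rw [mul_coeff, tsum_eq_single n fun m hm => by
      rw [one_coeff_of_ne (sub_ne_zero.mpr hm.symm)]; ring]
    simp [one_coeff_zero, torusCocycle_zero_right]
  left_distrib a b c := by
    ext n
    rw [add_coeff, mul_coeff, mul_coeff, mul_coeff,
      ← (summable_mul_coeff a b n).tsum_add (summable_mul_coeff a c n)]
    exact tsum_congr fun m => by rw [add_coeff]; ring
  right_distrib a b c := by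
    ext n
    rw [add_coeff, mul_coeff, mul_coeff, mul_coeff,
      ← (summable_mul_coeff a c n).tsum_add (summable_mul_coeff b c n)]
    exact tsum_congr fun m => by rw [add_coeff]; ring
  zero_mul a := by ext n; simp [mul_coeff]
  mul_zero a := by ext n; simp [mul_coeff]

instance : Algebra ℂ (SmoothTorus θ) := Algebra.ofModule
  (fun r a b => by
    ext n
    rw [smul_coeff, mul_coeff, mul_coeff, ← tsum_mul_left]
    exact tsum_congr fun m => by rw [smul_coeff]; ring)
  (fun r a b => by
    ext n
    rw [smul_coeff, mul_coeff, mul_coeff, ← tsum_mul_left]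
    exact tsum_congr fun m => by rw [smul_coeff]; ring)

/-- The involution, `U_ν ↦ U_ν* = U_{-ν}` (for skew-symmetric `θ`). -/
def adj (a : SmoothTorus θ) : SmoothTorus θ where
  coeff ν := starRingEnd ℂ (a.coeff (-ν))
  rapid k := by
    refine ((Equiv.neg (ι → ℤ)).summable_iff.mpr (a.rapid k)).congr fun ν => ?_
    simp

/-- The canonical trace `τ(∑ a_ν U_ν) = a_0`. -/
def tau (a : SmoothTorus θ) : ℂ := a.coeff 0

/-- `b` is a positive element: `τ(a* b a) ≥ 0` for all `a`, that is, `b` acts as a positive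
operator in the (faithful) representation given by the trace. -/
def IsPos (b : SmoothTorus θ) : Prop :=
  ∀ a : SmoothTorus θ, 0 ≤ (tau (adj a * b * a)).re ∧ (tau (adj a * b * a)).im = 0

/-- The infinitesimal automorphism `δ_α U_ν = 2 π i ⟨α, ν⟩ U_ν`. -/
def delta (α : ι → ℝ) (a : SmoothTorus θ) : SmoothTorus θ where
  coeff ν := 2 * Real.pi * Complex.I * (α ⬝ᵥ latticeVec ν : ℝ) * a.coeff ν
  rapid k := by
    refine Summable.of_nonneg_of_le (fun ν => by positivity) (fun ν => ?_)
      ((a.rapid (k + 1)).mul_left (2 * Real.pi * ∑ i, |α i|))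
    have h : |α ⬝ᵥ latticeVec ν| ≤ (∑ i, |α i|) * (1 + ‖ν‖) := by
      rw [dotProduct, Finset.sum_mul]
      refine (Finset.abs_sum_le_sum_abs _ _).trans (Finset.sum_le_sum fun i _ => ?_)
      rw [abs_mul]
      have : |latticeVec ν i| ≤ 1 + ‖ν‖ := by
        have h1 : ‖ν i‖ ≤ ‖ν‖ := norm_le_pi_norm ν i
        rw [Int.norm_eq_abs] at h1
        simp only [latticeVec]
        linarith
      gcongr
    simp only [norm_mul, Complex.norm_I, Complex.norm_real, Real.norm_eq_abs, mul_one,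
      abs_of_pos Real.pi_pos, Complex.norm_ofNat]
    calc (1 + ‖ν‖) ^ k * (2 * Real.pi * |α ⬝ᵥ latticeVec ν| * ‖a.coeff ν‖)
        ≤ (1 + ‖ν‖) ^ k * (2 * Real.pi * ((∑ i, |α i|) * (1 + ‖ν‖)) * ‖a.coeff ν‖) := by
          gcongr
      _ = _ := by rw [pow_succ]; ring

end SmoothTorus

open SmoothTorus

/-- `E` with the left action `ρ` of the smooth torus, the torus-valued form `ip` and the operators
`nabla α` is a finitely generated projective Hermitian module with a Hermitian connection, and the
curvature of the connection is the scalar-valued two-form `F`. -/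
structure IsConstantCurvatureModule {E : Type} [AddCommGroup E] [Module ℂ E]
    (θ : Matrix ι ι ℝ) (ρ : SmoothTorus θ →ₐ[ℂ] Module.End ℂ E)
    (ip : E → E → SmoothTorus θ) (nabla : (ι → ℝ) → Module.End ℂ E)
    (F : (ι → ℝ) → (ι → ℝ) → ℂ) : Prop where
  finite : @Module.Finite (SmoothTorus θ) E _ _ (Module.compHom E ρ.toRingHom)
  projective : @Module.Projective (SmoothTorus θ) _ E _ (Module.compHom E ρ.toRingHom)
  ip_add_left : ∀ e e' f, ip (e + e') f = ip e f + ip e' f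
  ip_smul_left : ∀ a e f, ip (ρ a e) f = a * ip e f
  ip_adj : ∀ e f, adj (ip e f) = ip f e
  ip_pos : ∀ e, IsPos (ip e e)
  ip_definite : ∀ e, ip e e = 0 → e = 0
  nabla_add : ∀ α β, nabla (α + β) = nabla α + nabla β
  nabla_smul : ∀ (r : ℝ) α, nabla (r • α) = (r : ℂ) • nabla α
  leibniz : ∀ α a e, nabla α (ρ a e) = ρ a (nabla α e) + ρ (delta α a) e
  hermitian : ∀ α e f, delta α (ip e f) = ip (nabla α e) f + ip e (nabla α f)
  curvature : ∀ α β, nabla α * nabla β - nabla β * nabla α = F α β • (1 : Module.End ℂ E)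

end Torus

/-! ### Schwartz functions on `ℝ⁴` and the Heisenberg operators -/

/-- `ℝ⁴`, identified with its dual by the standard basis. -/
abbrev V4 : Type := Fin 4 → ℝ

/-- `ℝ⁴ ⊕ (ℝ⁴)'`. -/
abbrev Phase : Type := V4 × V4

/-- `ℝ⁸ = ℝ⁴ ⊕ ℝ⁴`, which contains the lattice `ℤ⁸ = ℤ⁴ ⊕ ℤ⁴`. -/
abbrev V8 : Type := Fin 4 ⊕ Fin 4 → ℝ

/-- The canonical form `Ω((x₁, y₁), (x₂, y₂)) = ⟨y₂, x₁⟩ - ⟨y₁, x₂⟩`. -/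
def Omega (v w : Phase) : ℝ := w.2 ⬝ᵥ v.1 - v.2 ⬝ᵥ w.1

/-- The function `z ↦ 2 π i ⟨y, z⟩`. -/
def linPhase (y z : V4) : ℂ := 2 * Real.pi * Complex.I * (y ⬝ᵥ z : ℝ)

theorem linPhase_hasTemperateGrowth (y : V4) : (linPhase y).HasTemperateGrowth := by
  let L : V4 →ₗ[ℝ] ℂ :=
    { toFun := linPhase y
      map_add' := fun u v => by simp [linPhase, dotProduct_add]; ring
      map_smul' := fun r u => by simp [linPhase, dotProduct_smul]; ring }
  exact (LinearMap.toContinuousLinearMap L).hasTemperateGrowth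

theorem linPhase_exp_hasTemperateGrowth (y : V4) :
    (fun z => Complex.exp (linPhase y z)).HasTemperateGrowth := by
  have hg : (fun t : ℝ => Complex.exp (2 * Real.pi * Complex.I * t)).HasTemperateGrowth := by
    have hd : ∀ n : ℕ, iteratedDeriv n (fun t : ℝ => Complex.exp (2 * Real.pi * Complex.I * t))
        = fun t : ℝ => (2 * Real.pi * Complex.I) ^ n * Complex.exp (2 * Real.pi * Complex.I * t) := by
      intro n
      induction n with
      | zero => simp
      | succ n ih =>
        rw [iteratedDeriv_succ, ih]
        funext t
        have h1 : HasDerivAt (fun t : ℝ => 2 * Real.pi * Complex.I * (t : ℂ))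
            (2 * Real.pi * Complex.I) t := by
          simpa using (Complex.ofRealCLM.hasDerivAt (x := t)).const_mul (2 * Real.pi * Complex.I)
        rw [(h1.cexp.const_mul ((2 * Real.pi * Complex.I) ^ n)).deriv]
        ring
    refine ⟨(contDiff_const.mul Complex.ofRealCLM.contDiff).cexp, fun n => ⟨0, (2 * Real.pi) ^ n, fun t => ?_⟩⟩
    rw [norm_iteratedFDeriv_eq_norm_iteratedDeriv, hd]
    have h2 : ‖Complex.exp (2 * Real.pi * Complex.I * t)‖ = 1 := by
      have : 2 * Real.pi * Complex.I * (t : ℂ) = ((2 * Real.pi * t : ℝ) : ℂ) * Complex.I := by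
        push_cast; ring
      rw [this, Complex.norm_exp_ofReal_mul_I]
    simp [h2, abs_of_pos Real.pi_pos]
  let L : V4 →ₗ[ℝ] ℝ :=
    { toFun := fun z => y ⬝ᵥ z
      map_add' := fun u v => dotProduct_add y u v
      map_smul' := fun r u => by simp [dotProduct_smul] }
  exact hg.comp (LinearMap.toContinuousLinearMap L).hasTemperateGrowth

/-- The operator `((x, y) f)(z) = exp (2 π i ⟨y, z⟩) f(z + x)`. -/
def heis (v : Phase) : 𝓢(V4, ℂ) →L[ℂ] 𝓢(V4, ℂ) :=
  SchwartzMap.smulLeftCLM ℂ (fun z => Complex.exp (linPhase v.2 z)) ∘L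
    SchwartzMap.compSubConstCLM ℂ (-v.1)

theorem heis_apply (v : Phase) (f : 𝓢(V4, ℂ)) (z : V4) :
    heis v f z = Complex.exp (linPhase v.2 z) * f (z + v.1) := by
  simp [heis, SchwartzMap.smulLeftCLM_apply_apply (linPhase_exp_hasTemperateGrowth v.2)]

/-- The operator `(Q_{(x, y)} f)(z) = 2 π i ⟨y, z⟩ f(z) + d/dt f(z + t x)` at `t = 0`. -/
def Qop (v : Phase) : 𝓢(V4, ℂ) →L[ℂ] 𝓢(V4, ℂ) :=
  SchwartzMap.smulLeftCLM ℂ (linPhase v.2) + LineDeriv.lineDerivOpCLM ℂ 𝓢(V4, ℂ) v.1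

theorem Qop_apply (v : Phase) (f : 𝓢(V4, ℂ)) (z : V4) :
    Qop v f z = linPhase v.2 z * f z + deriv (fun t : ℝ => f (z + t • v.1)) 0 := by
  have h0 : HasFDerivAt f (fderiv ℝ f z) (z + (0 : ℝ) • v.1) := by
    simpa using f.hasFDerivAt z
  have h1 : HasDerivAt (fun t : ℝ => z + t • v.1) v.1 0 := by
    simpa using ((hasDerivAt_id (0 : ℝ)).smul_const v.1).const_add z
  have h2 : deriv (fun t : ℝ => f (z + t • v.1)) 0 = fderiv ℝ f z v.1 :=
    (h0.comp_hasDerivAt (0 : ℝ) h1).deriv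
  rw [h2]
  simp [Qop, SchwartzMap.smulLeftCLM_apply_apply (linPhase_hasTemperateGrowth v.2),
    SchwartzMap.lineDerivOp_apply_eq_fderiv]

/-! ### Elementary modules -/

/-- The form `θ ⊕ (-θ')` on `ℝ⁸`. -/
def twoForm (θ θ' : Matrix (Fin 4) (Fin 4) ℝ) : Matrix (Fin 4 ⊕ Fin 4) (Fin 4 ⊕ Fin 4) ℝ :=
  Matrix.fromBlocks θ 0 0 (-θ')

/-- The form `θ ⊕ (-θ') + η` on `ℝ⁸`, with `η` integral. -/
def fullForm (θ θ' : Matrix (Fin 4) (Fin 4) ℝ) (η : Matrix (Fin 4 ⊕ Fin 4) (Fin 4 ⊕ Fin 4) ℤ) :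
    Matrix (Fin 4 ⊕ Fin 4) (Fin 4 ⊕ Fin 4) ℝ :=
  twoForm θ θ' + η.map fun k : ℤ => (k : ℝ)

/-- `θ ⊕ (-θ') + η = T^* Ω`. -/
def IsPullback (θ θ' : Matrix (Fin 4) (Fin 4) ℝ) (η : Matrix (Fin 4 ⊕ Fin 4) (Fin 4 ⊕ Fin 4) ℤ)
    (T : V8 →ₗ[ℝ] Phase) : Prop :=
  ∀ v w : V8, Omega (T v) (T w) = formOf (fullForm θ θ' η) v w

/-- The defining property `Ω(V₁(α), T(ν, μ)) = ⟨α, ν⟩` of `V₁`. -/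
def IsV₁ (T : V8 →ₗ[ℝ] Phase) (V₁ : V4 →ₗ[ℝ] Phase) : Prop :=
  ∀ α ν μ : V4, Omega (V₁ α) (T (Sum.elim ν μ)) = α ⬝ᵥ ν

/-- The defining property `Ω(V₂(α), T(ν, μ)) = ⟨α, μ⟩` of `V₂`. -/
def IsV₂ (T : V8 →ₗ[ℝ] Phase) (V₂ : V4 →ₗ[ℝ] Phase) : Prop :=
  ∀ α ν μ : V4, Omega (V₂ α) (T (Sum.elim ν μ)) = α ⬝ᵥ μ

/-- The connection `∇_α = Q_{V(α)}` as an operator on Schwartz functions. -/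
def nablaOf (V : V4 →ₗ[ℝ] Phase) (α : V4) : Module.End ℂ 𝓢(V4, ℂ) := (Qop (V α)).toLinearMap

/-- The connection `∇ ⊕ ∇̂` over `θ ⊕ (-θ')`. -/
def nablaSum (V₁ V₂ : V4 →ₗ[ℝ] Phase) (γ : V8) : Module.End ℂ 𝓢(V4, ℂ) :=
  nablaOf V₁ (γ ∘ Sum.inl) + nablaOf V₂ (γ ∘ Sum.inr)

/-- The vector `V₁(γ₁) + V₂(γ₂)`. -/
def sumVec (V₁ V₂ : V4 →ₗ[ℝ] Phase) (γ : V8) : Phase := V₁ (γ ∘ Sum.inl) + V₂ (γ ∘ Sum.inr)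

/-- The pairing `σ(α, β) = 2 π i Ω(V₁(α), V₂(β))`. -/
def sigma (V₁ V₂ : V4 →ₗ[ℝ] Phase) (α β : V4) : ℂ :=
  2 * Real.pi * Complex.I * (Omega (V₁ α) (V₂ β) : ℝ)

/-- The pairing `σ` is nondegenerate. -/
def SigmaNondegenerate (V₁ V₂ : V4 →ₗ[ℝ] Phase) : Prop :=
  (∀ α, (∀ β, sigma V₁ V₂ α β = 0) → α = 0) ∧ (∀ β, (∀ α, sigma V₁ V₂ α β = 0) → β = 0)

open SmoothTorus

/-- `ρ` is the action on Schwartz functions for which the generators `U_{e_k}`, `k = 1, …, 8`, act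
as `T(e_k)`, extended to infinite sums with rapidly decreasing coefficients (convergence in the
Schwartz space). -/
structure IsElementaryAction (θ θ' : Matrix (Fin 4) (Fin 4) ℝ) (T : V8 →ₗ[ℝ] Phase)
    (ρ : SmoothTorus (twoForm θ θ') →ₐ[ℂ] Module.End ℂ 𝓢(V4, ℂ)) : Prop where
  generator : ∀ k f, ρ (U _ (Pi.single k 1)) f = heis (T (Pi.single k 1)) f
  hasSum : ∀ a f, HasSum (fun ν => a.coeff ν • ρ (U _ ν) f) (ρ a f)

/-- The Schwartz functions on `ℝ⁴` as the elementary module given by `T`: a module `ρ` over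
`θ ⊕ (-θ')`, that is, a left module `ρ₁` over `θ` and a right module `ρ₂` over `θ'` with commuting
actions, finitely generated projective and Hermitian, with the Hermitian connections
`∇ = Q_{V₁(·)}` over `θ` and `∇̂ = Q_{V₂(·)}` over `θ'`, whose sum has constant curvature. -/
structure IsElementaryModule (θ θ' : Matrix (Fin 4) (Fin 4) ℝ) (T : V8 →ₗ[ℝ] Phase)
    (V₁ V₂ : V4 →ₗ[ℝ] Phase)
    (ρ : SmoothTorus (twoForm θ θ') →ₐ[ℂ] Module.End ℂ 𝓢(V4, ℂ))
    (ρ₁ : SmoothTorus θ →ₐ[ℂ] Module.End ℂ 𝓢(V4, ℂ))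
    (ρ₂ : (SmoothTorus θ')ᵐᵒᵖ →ₐ[ℂ] Module.End ℂ 𝓢(V4, ℂ))
    (ip : 𝓢(V4, ℂ) → 𝓢(V4, ℂ) → SmoothTorus (twoForm θ θ')) : Prop where
  isV₁ : IsV₁ T V₁
  isV₂ : IsV₂ T V₂
  action : IsElementaryAction θ θ' T ρ
  phase : ∀ ν, ∃ c : ℂ, ‖c‖ = 1 ∧ ∀ f, ρ (U _ ν) f = c • heis (T (latticeVec ν)) f
  left_hasSum : ∀ a f, HasSum (fun ν => a.coeff ν • ρ (U _ (Sum.elim ν 0)) f) (ρ₁ a f)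
  right_hasSum : ∀ b f,
    HasSum (fun ν => b.coeff ν • ρ (U _ (Sum.elim 0 ν)) f) (ρ₂ (MulOpposite.op b) f)
  bimodule : ∀ a b f, ρ₁ a (ρ₂ b f) = ρ₂ b (ρ₁ a f)
  nabla_left : ∀ α a f, nablaOf V₁ α (ρ₁ a f) = ρ₁ a (nablaOf V₁ α f) + ρ₁ (delta α a) f
  nabla_right : ∀ α b f, nablaOf V₁ α (ρ₂ b f) = ρ₂ b (nablaOf V₁ α f)
  nablaHat_right : ∀ β b f, nablaOf V₂ β (ρ₂ (MulOpposite.op b) f) =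
    ρ₂ (MulOpposite.op b) (nablaOf V₂ β f) + ρ₂ (MulOpposite.op (delta β b)) f
  nablaHat_left : ∀ β a f, nablaOf V₂ β (ρ₁ a f) = ρ₁ a (nablaOf V₂ β f)
  ip_coeff : ∀ f g ν, (ip f g).coeff ν = ∫ z, f z * starRingEnd ℂ (ρ (U _ ν) g z)
  constantCurvature : IsConstantCurvatureModule (twoForm θ θ') ρ ip (nablaSum V₁ V₂)
    fun γ γ' => 2 * Real.pi * Complex.I * (Omega (sumVec V₁ V₂ γ) (sumVec V₁ V₂ γ') : ℝ)
  mixed : ∀ α β, nablaOf V₁ α * nablaOf V₂ β - nablaOf V₂ β * nablaOf V₁ α =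
    sigma V₁ V₂ α β • (1 : Module.End ℂ 𝓢(V4, ℂ))

/-! ### Genericity -/

/-- `P` holds for all pairs of skew-symmetric forms on `ℝ⁴` outside a proper algebraic subset. -/
def GenericPair (P : Matrix (Fin 4) (Fin 4) ℝ → Matrix (Fin 4) (Fin 4) ℝ → Prop) : Prop :=
  ∃ p : MvPolynomial ((Fin 4 × Fin 4) ⊕ (Fin 4 × Fin 4)) ℝ,
    (∃ θ θ' : Matrix (Fin 4) (Fin 4) ℝ, θᵀ = -θ ∧ θ'ᵀ = -θ' ∧
      p.eval (Sum.elim (fun k => θ k.1 k.2) (fun k => θ' k.1 k.2)) ≠ 0) ∧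
    ∀ θ θ' : Matrix (Fin 4) (Fin 4) ℝ, θᵀ = -θ → θ'ᵀ = -θ' →
      p.eval (Sum.elim (fun k => θ k.1 k.2) (fun k => θ' k.1 k.2)) ≠ 0 → P θ θ'

/-- `P` holds for all integral skew-symmetric forms on `ℝ⁸` outside the zero set of a polynomial
that does not vanish at all of them. -/
def GenericIntegral (P : Matrix (Fin 4 ⊕ Fin 4) (Fin 4 ⊕ Fin 4) ℤ → Prop) : Prop :=
  ∃ p : MvPolynomial ((Fin 4 ⊕ Fin 4) × (Fin 4 ⊕ Fin 4)) ℝ,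
    (∃ η : Matrix (Fin 4 ⊕ Fin 4) (Fin 4 ⊕ Fin 4) ℤ, ηᵀ = -η ∧
      p.eval (fun k => (η k.1 k.2 : ℝ)) ≠ 0) ∧
    ∀ η : Matrix (Fin 4 ⊕ Fin 4) (Fin 4 ⊕ Fin 4) ℤ, ηᵀ = -η →
      p.eval (fun k => (η k.1 k.2 : ℝ)) ≠ 0 → P η

/-! ### The Poincaré module -/

/-- The Poincaré module: smooth functions `f(x, x̂)` on `ℝ⁴ ⊕ (ℝ⁴)'` with
`f(x + l, x̂ + m) = exp (-2 π i ⟨m, x⟩) f(x, x̂)` for integral `l`, `m`. -/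
def PoincareModule : Submodule ℂ (Phase → ℂ) where
  carrier := {f | ContDiff ℝ ∞ f ∧ ∀ (x y : V4) (l m : Fin 4 → ℤ),
    f (x + latticeVec l, y + latticeVec m) = Complex.exp (-linPhase (latticeVec m) x) * f (x, y)}
  add_mem' := by
    rintro f g ⟨hf, hf'⟩ ⟨hg, hg'⟩
    refine ⟨hf.add hg, fun x y l m => ?_⟩
    simp only [Pi.add_apply, hf', hg']; ring
  zero_mem' := ⟨contDiff_const, by simp⟩
  smul_mem' := by
    rintro c f ⟨hf, hf'⟩
    refine ⟨contDiff_const.mul hf, fun x y l m => ?_⟩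
    simp only [Pi.smul_apply, hf', smul_eq_mul]; ring

/-- The periodic function `∑ a_{(μ, ν)} exp (2 π i (⟨μ, x⟩ + ⟨ν, x̂⟩))` with Fourier coefficients
`a`. -/
def torusFun {θ : Matrix (Fin 4 ⊕ Fin 4) (Fin 4 ⊕ Fin 4) ℝ} (a : SmoothTorus θ) (p : Phase) : ℂ :=
  ∑' ν, a.coeff ν * Complex.exp (linPhase (latticeVec (ν ∘ Sum.inl)) p.1 +
    linPhase (latticeVec (ν ∘ Sum.inr)) p.2)

/-- The connection `d + 2 π i ⟨x̂, dx⟩`, in the direction `γ`. -/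
def poincareNabla (γ : V8) (f : Phase → ℂ) (p : Phase) : ℂ :=
  fderiv ℝ f p (γ ∘ Sum.inl, γ ∘ Sum.inr) + linPhase p.2 (γ ∘ Sum.inl) * f p

/-- The map `T(μ, ν) = (-D μ - A ν, B μ + C ν)`, for which `U_μ` acts (up to a phase) as
`φ ↦ exp (2 π i ⟨B μ, x̂⟩) φ(x̂ - D μ)` and `Û_ν` as `φ ↦ exp (2 π i ⟨C ν, x̂⟩) φ(x̂ - A ν)`. -/
def blockMap (A B C D : Matrix (Fin 4) (Fin 4) ℝ) : V8 →ₗ[ℝ] Phase where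
  toFun w := (-(D *ᵥ (w ∘ Sum.inl)) - A *ᵥ (w ∘ Sum.inr),
    B *ᵥ (w ∘ Sum.inl) + C *ᵥ (w ∘ Sum.inr))
  map_add' u v := by
    have h (e : Fin 4 → Fin 4 ⊕ Fin 4) : (u + v) ∘ e = u ∘ e + v ∘ e := rfl
    simp only [h, Matrix.mulVec_add, Prod.mk_add_mk]
    congr 1 <;> abel
  map_smul' r u := by
    have h (e : Fin 4 → Fin 4 ⊕ Fin 4) : (r • u) ∘ e = r • (u ∘ e) := rfl
    simp [h, Matrix.mulVec_smul, smul_sub]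

/-- The integral form on `ℝ⁸` with mixed part `E`: `⟨x₁, E y₂⟩ - ⟨x₂, E y₁⟩`. -/
def mixedForm (E : Matrix (Fin 4) (Fin 4) ℤ) : Matrix (Fin 4 ⊕ Fin 4) (Fin 4 ⊕ Fin 4) ℤ :=
  Matrix.fromBlocks 0 E (-Eᵀ) 0

/-- The map `T(x, y) = (-x, y)` of the commutative Poincaré module. -/
def poincareT : V8 →ₗ[ℝ] Phase := blockMap 0 0 1 1

/-- The integral form `⟨y₁, x₂⟩ - ⟨y₂, x₁⟩` of the Poincaré module. -/
def poincareEta : Matrix (Fin 4 ⊕ Fin 4) (Fin 4 ⊕ Fin 4) ℤ := mixedForm (-1)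

/-- Pairs of skew-symmetric forms on `ℝ⁴` with all entries of absolute value less than `ε`. -/
def smallPairs (ε : ℝ) : Set (Matrix (Fin 4) (Fin 4) ℝ × Matrix (Fin 4) (Fin 4) ℝ) :=
  {q | q.1ᵀ = -q.1 ∧ q.2ᵀ = -q.2 ∧ ∀ i j, |q.1 i j| < ε ∧ |q.2 i j| < ε}

end

/-! Everything on the analytic side comes from the canonical commutation relations. The operators
`heis v` commute up to the phase exp(2πiΩ), and the commutator of `Qop v` with `heis w` is Ω(v, w)
times `heis w`, up to 2πi. With symmetrized phases the `heis (T ν)` represent the torus of the form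
T^*Ω; a sign, namely a quadratic refinement of η modulo 2, removes the integral part η, and a
character of the lattice normalizes the generators to act exactly as T(e_k) (`exists_isWeylSystem`).
The Schwartz seminorms of `heis v f` grow polynomially in v, so sums with rapidly decreasing
coefficients converge. If V is the Ω-dual of T, then Q_{V(γ)} obeys the Leibniz rule and has scalar
curvature; since Q is skew-adjoint, the connection is Hermitian and the matrix coefficients ⟨f, heis
v g⟩ decay rapidly in v.

The hard point is finite projectivity, obtained from a Gabor frame. Poisson summation on ℝ⁸ and the
symplectic Fourier transform of matrix coefficients turn ⟨f, g⟩h, a sum over T(ℤ⁸), into a sum over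
the dual lattice V(ℤ⁸) in which f and h trade places (`exists_hasSum_dual_lattice`). Take as windows
the translates of one g along T of the points of (1/N)ℤ⁸ in the unit cube. Adding their
contributions is a sum of characters, which kills every dual point outside N V(ℤ⁸). For large N the
surviving coefficients away from 0 have ℓ¹ norm less than ‖g‖². The frame operator is then a nonzero
multiple of 1 - x, where x lies in another smooth torus, acting through N V(ℤ⁸), and has ℓ¹ norm
below 1. The Neumann series stays in the smooth algebra, so the frame operator is bijective
(`exists_bijective_frameOp`). As it factors through a finite free module, the module is a direct
summand of it.

The rest of the general theory is linear algebra. Splitting off hyperbolic planes gives T for every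
skew form, the kernels of σ are governed by those of the mixed block (`sigmaNondegenerate_iff`), and
genericity holds because determinants are polynomials.

For the Poincaré module the isomorphism is the Zak transform. Its inverse reads off Fourier
coefficients in x; their decay follows because the connection preserves the module and becomes
multiplication or differentiation after integration over x. The inner products are compared by
Poisson summation in x̂. For the deformation, D = 1, B = -θ/2 and C = 1 + θA/2 satisfy two of the
three matrix equations; the third becomes A - Aᵗ - AᵗθA = -θ', which has a strictly upper triangular
solution with rational entries. -/

noncomputable section

open SmoothTorus

/-! ### Algebra of the smooth torus: adjoint, weighted ℓ¹ norms, inversion near 1 -/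

section TorusAlgebra

variable {ι : Type} [Fintype ι]

theorem formOf_add_left (θ : Matrix ι ι ℝ) (u v w : ι → ℝ) :
    formOf θ (u + v) w = formOf θ u w + formOf θ v w := add_dotProduct _ _ _

theorem formOf_add_right (θ : Matrix ι ι ℝ) (u v w : ι → ℝ) :
    formOf θ u (v + w) = formOf θ u v + formOf θ u w := by
  simp [formOf, Matrix.mulVec_add, dotProduct_add]

theorem formOf_neg_left (θ : Matrix ι ι ℝ) (v w : ι → ℝ) : formOf θ (-v) w = -formOf θ v w :=
  neg_dotProduct _ _

theorem formOf_neg_right (θ : Matrix ι ι ℝ) (v w : ι → ℝ) : formOf θ v (-w) = -formOf θ v w := by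
  simp [formOf, Matrix.mulVec_neg]

theorem formOf_transpose (θ : Matrix ι ι ℝ) (v w : ι → ℝ) : formOf θᵀ v w = formOf θ w v := by
  rw [formOf, formOf, Matrix.mulVec_transpose, dotProduct_comm, Matrix.dotProduct_mulVec]

theorem formOf_swap {θ : Matrix ι ι ℝ} (hθ : θᵀ = -θ) (v w : ι → ℝ) :
    formOf θ v w = -formOf θ w v := by
  rw [← formOf_transpose, hθ, formOf, formOf, Matrix.neg_mulVec, dotProduct_neg]

theorem formOf_self {θ : Matrix ι ι ℝ} (hθ : θᵀ = -θ) (v : ι → ℝ) : formOf θ v v = 0 := by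
  linarith [formOf_swap hθ v v]

theorem latticeVec_zero {κ : Type} : latticeVec (0 : κ → ℤ) = 0 := by ext; simp [latticeVec]

theorem latticeVec_add {κ : Type} (u v : κ → ℤ) :
    latticeVec (u + v) = latticeVec u + latticeVec v := by ext; simp [latticeVec]

theorem latticeVec_neg {κ : Type} (u : κ → ℤ) : latticeVec (-u) = -latticeVec u := by
  ext; simp [latticeVec]

theorem latticeVec_sub {κ : Type} (u v : κ → ℤ) :
    latticeVec (u - v) = latticeVec u - latticeVec v := by ext; simp [latticeVec]

theorem norm_latticeVec (ν : ι → ℤ) : ‖latticeVec ν‖ = ‖ν‖ := by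
  simp only [Pi.norm_def]
  congr 1

namespace SmoothTorus

variable {θ : Matrix ι ι ℝ}

@[simp] theorem adj_coeff (a : SmoothTorus θ) (ν : ι → ℤ) :
    (adj a).coeff ν = starRingEnd ℂ (a.coeff (-ν)) := rfl

theorem delta_coeff (α : ι → ℝ) (a : SmoothTorus θ) (ν : ι → ℤ) :
    (delta α a).coeff ν = 2 * Real.pi * Complex.I * (α ⬝ᵥ latticeVec ν : ℝ) * a.coeff ν := rfl

@[simp] theorem sub_coeff (a b : SmoothTorus θ) (ν : ι → ℤ) :
    (a - b).coeff ν = a.coeff ν - b.coeff ν := by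
  rw [sub_eq_add_neg, sub_eq_add_neg, add_coeff, neg_coeff]

@[simp] theorem adj_adj (a : SmoothTorus θ) : adj (adj a) = a := by
  ext; simp

theorem adj_sub (a b : SmoothTorus θ) : adj (a - b) = adj a - adj b := by
  ext; simp

theorem adj_one : adj (1 : SmoothTorus θ) = 1 := by
  ext ν
  by_cases h : ν = 0
  · subst h; simp [one_coeff_zero]
  · rw [adj_coeff, one_coeff_of_ne h, one_coeff_of_ne (neg_ne_zero.mpr h), map_zero]

theorem conj_torusCocycle (μ ν : ι → ℤ) :
    starRingEnd ℂ (torusCocycle θ μ ν) =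
      Complex.exp (Real.pi * Complex.I * (-formOf θ (latticeVec μ) (latticeVec ν) : ℝ)) := by
  rw [torusCocycle, ← Complex.exp_conj]
  congr 1
  simp

/-- Conjugation inverts the cocycle; after the shift `m ↦ m + ν` of the summation index,
skew-symmetry identifies the inverse with the cocycle of the reversed factors. -/
theorem adj_mul (hθ : θᵀ = -θ) (a b : SmoothTorus θ) : adj (a * b) = adj b * adj a := by
  ext ν
  rw [adj_coeff, mul_coeff, mul_coeff, Complex.conj_tsum]
  refine Eq.trans (tsum_congr fun m => ?_) ((Equiv.addRight ν).tsum_eq _)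
  have h1 : -(m + ν) = -ν - m := by abel
  have h2 : ν - (m + ν) = -m := by abel
  simp only [Equiv.coe_addRight, adj_coeff, map_mul, conj_torusCocycle, h1, h2, neg_neg]
  have h3 : -formOf θ (latticeVec m) (latticeVec (-ν - m)) =
      formOf θ (latticeVec (m + ν)) (latticeVec (-m)) := by
    simp only [latticeVec_add, latticeVec_neg, sub_eq_add_neg, formOf_add_left,
      formOf_add_right, formOf_neg_right, formOf_self hθ]
    linarith [formOf_swap hθ (latticeVec m) (latticeVec ν)]
  rw [h3, torusCocycle]
  ring

/-! #### Weighted norms and the Neumann series -/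

/-- The cocycle has modulus 1, so twisted convolution is dominated by ordinary convolution, for
which a submultiplicative weight gives a Banach algebra norm. -/
theorem weighted_mul {w : (ι → ℤ) → ℝ} (hw : ∀ ν, 0 ≤ w ν) (hw' : ∀ m n, w n ≤ w m * w (n - m))
    (a b : SmoothTorus θ) (ha : Summable fun ν => w ν * ‖a.coeff ν‖)
    (hb : Summable fun ν => w ν * ‖b.coeff ν‖) :
    (Summable fun ν => w ν * ‖(a * b).coeff ν‖) ∧
      ∑' ν, w ν * ‖(a * b).coeff ν‖ ≤
        (∑' ν, w ν * ‖a.coeff ν‖) * ∑' ν, w ν * ‖b.coeff ν‖ := by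
  have ha0 : 0 ≤ fun ν => w ν * ‖a.coeff ν‖ := fun ν => mul_nonneg (hw ν) (norm_nonneg _)
  have hb0 : 0 ≤ fun ν => w ν * ‖b.coeff ν‖ := fun ν => mul_nonneg (hw ν) (norm_nonneg _)
  have hs := summable_conv ha hb ha0 hb0
  have hle : ∀ ν, w ν * ‖(a * b).coeff ν‖ ≤
      ∑' m, w m * ‖a.coeff m‖ * (w (ν - m) * ‖b.coeff (ν - m)‖) := fun ν => by
    have h2 := (summable_mul_coeff a b ν).norm
    calc w ν * ‖∑' m, a.coeff m * b.coeff (ν - m) * torusCocycle θ m (ν - m)‖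
        ≤ w ν * ∑' m, ‖a.coeff m * b.coeff (ν - m) * torusCocycle θ m (ν - m)‖ :=
          mul_le_mul_of_nonneg_left (norm_tsum_le_tsum_norm h2) (hw ν)
      _ = ∑' m, w ν * ‖a.coeff m * b.coeff (ν - m) * torusCocycle θ m (ν - m)‖ :=
          tsum_mul_left.symm
      _ ≤ _ := by
          refine (h2.mul_left _).tsum_le_tsum (fun m => ?_) (hs.prod_factor ν)
          rw [norm_mul, norm_mul, norm_torusCocycle, mul_one]
          calc w ν * (‖a.coeff m‖ * ‖b.coeff (ν - m)‖)
              ≤ (w m * w (ν - m)) * (‖a.coeff m‖ * ‖b.coeff (ν - m)‖) := by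
                gcongr; exact hw' m ν
            _ = _ := by ring
  have hsum := Summable.of_nonneg_of_le (fun ν => mul_nonneg (hw ν) (norm_nonneg _)) hle hs.prod
  refine ⟨hsum, (hsum.tsum_le_tsum hle hs.prod).trans_eq ?_⟩
  rw [ha.tsum_mul_tsum hb (ha.mul_of_nonneg hb ha0 hb0), ← (shear ι).tsum_eq]
  exact (hs.tsum_prod' fun ν => hs.prod_factor ν).symm

theorem weighted_pow {w : (ι → ℤ) → ℝ} (hw : ∀ ν, 0 ≤ w ν) (hw' : ∀ m n, w n ≤ w m * w (n - m))
    (hw0 : w 0 = 1) (a : SmoothTorus θ) (ha : Summable fun ν => w ν * ‖a.coeff ν‖) (n : ℕ) :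
    (Summable fun ν => w ν * ‖(a ^ n).coeff ν‖) ∧
      ∑' ν, w ν * ‖(a ^ n).coeff ν‖ ≤ (∑' ν, w ν * ‖a.coeff ν‖) ^ n := by
  induction n with
  | zero =>
    have h : ∀ ν ≠ 0, w ν * ‖(1 : SmoothTorus θ).coeff ν‖ = 0 := fun ν hν => by
      rw [one_coeff_of_ne hν, norm_zero, mul_zero]
    simp only [pow_zero]
    refine ⟨summable_of_ne_finset_zero (s := {0}) fun ν hν => h ν (by simpa using hν), ?_⟩
    rw [tsum_eq_single 0 h, one_coeff_zero, hw0]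
    simp
  | succ n ih =>
    obtain ⟨h1, h2⟩ := weighted_mul hw hw' (a ^ n) a ih.1 ha
    rw [pow_succ a n]
    refine ⟨h1, h2.trans ?_⟩
    rw [pow_succ]
    exact mul_le_mul_of_nonneg_right ih.2
      (tsum_nonneg fun ν => mul_nonneg (hw ν) (norm_nonneg _))

theorem rescaled_weight_mul (s : ℝ) (hs : 0 ≤ s) (k : ℕ) (m n : ι → ℤ) :
    (1 + s * ‖n‖) ^ k ≤ (1 + s * ‖m‖) ^ k * (1 + s * ‖n - m‖) ^ k := by
  rw [← mul_pow]
  have h1 : ‖n‖ ≤ ‖m‖ + ‖n - m‖ := by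
    calc ‖n‖ = ‖m + (n - m)‖ := by congr 1; abel
      _ ≤ _ := norm_add_le _ _
  refine pow_le_pow_left₀ (by positivity) ?_ k
  nlinarith [mul_le_mul_of_nonneg_left h1 hs,
    mul_nonneg (mul_nonneg hs (norm_nonneg m)) (mul_nonneg hs (norm_nonneg (n - m)))]

theorem rescaled_weight_le {s : ℝ} (hs : 0 ≤ s) (hs1 : s ≤ 1) (k : ℕ) (ν : ι → ℤ) :
    (1 + s * ‖ν‖) ^ k ≤ (1 + ‖ν‖) ^ k := by
  have := norm_nonneg ν
  gcongr
  nlinarith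

/-- The weights `(1 + s‖ν‖)^k` are submultiplicative, are equivalent to `(1 + ‖ν‖)^k` for fixed `s`,
and tend to 1 as `s → 0`. By dominated convergence, ℓ¹ norm below 1 thus forces weighted norm below
1 for small `s`. This is why smallness in ℓ¹ alone yields an inverse with rapidly decreasing
coefficients. -/
theorem exists_rescaled_weight (x : SmoothTorus θ) (hx : ∑' ν, ‖x.coeff ν‖ < 1) (k : ℕ) :
    ∃ s : ℝ, 0 < s ∧ s ≤ 1 ∧ ∑' ν, (1 + s * ‖ν‖) ^ k * ‖x.coeff ν‖ < 1 := by
  have ht : Filter.Tendsto (fun s : ℝ => ∑' ν, (1 + s * ‖ν‖) ^ k * ‖x.coeff ν‖)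
      (𝓝[>] 0) (𝓝 (∑' ν, ‖x.coeff ν‖)) := by
    refine tendsto_tsum_of_dominated_convergence (x.rapid k) (fun ν => ?_) ?_
    · have : Continuous fun s : ℝ => (1 + s * ‖ν‖) ^ k * ‖x.coeff ν‖ := by fun_prop
      simpa using (this.tendsto 0).mono_left nhdsWithin_le_nhds
    · filter_upwards [Ioc_mem_nhdsGT (zero_lt_one (α := ℝ))] with s hs ν
      have h0 : 0 ≤ s * ‖ν‖ := mul_nonneg hs.1.le (norm_nonneg _)
      rw [norm_mul, norm_norm, Real.norm_of_nonneg (by positivity)]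
      exact mul_le_mul_of_nonneg_right (rescaled_weight_le hs.1.le hs.2 k ν) (norm_nonneg _)
  obtain ⟨s, h1, h2⟩ := ((ht.eventually (gt_mem_nhds hx)).and
    (Ioc_mem_nhdsGT (zero_lt_one (α := ℝ)))).exists
  exact ⟨s, h2.1, h2.2, h1⟩

theorem summable_rescaled (x : SmoothTorus θ) {s : ℝ} (hs : 0 ≤ s) (hs1 : s ≤ 1) (k : ℕ) :
    Summable fun ν => (1 + s * ‖ν‖) ^ k * ‖x.coeff ν‖ :=
  Summable.of_nonneg_of_le (fun ν => by positivity)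
    (fun ν => mul_le_mul_of_nonneg_right (rescaled_weight_le hs hs1 k ν) (norm_nonneg _))
    (x.rapid k)

theorem summable_rescaled_pow (x : SmoothTorus θ) {s : ℝ} (hs : 0 ≤ s) (hs1 : s ≤ 1) (k : ℕ)
    (hx : ∑' ν, (1 + s * ‖ν‖) ^ k * ‖x.coeff ν‖ < 1) :
    Summable fun p : (ι → ℤ) × ℕ => (1 + s * ‖p.1‖) ^ k * ‖(x ^ p.2).coeff p.1‖ := by
  have hp := fun n => weighted_pow (w := fun ν => (1 + s * ‖ν‖) ^ k) (fun ν => by positivity)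
    (rescaled_weight_mul s hs k) (by simp) x (summable_rescaled x hs hs1 k) n
  have h : Summable fun p : ℕ × (ι → ℤ) => (1 + s * ‖p.2‖) ^ k * ‖(x ^ p.1).coeff p.2‖ := by
    refine (summable_prod_of_nonneg (fun p => by positivity)).mpr ⟨fun n => (hp n).1, ?_⟩
    exact Summable.of_nonneg_of_le (fun n => tsum_nonneg fun ν => by positivity)
      (fun n => (hp n).2) (summable_geometric_of_lt_one
        (tsum_nonneg fun ν => by positivity) hx)
  exact h.prod_symm

theorem summable_pow_coeff (x : SmoothTorus θ) (hx : ∑' ν, ‖x.coeff ν‖ < 1) :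
    Summable fun p : (ι → ℤ) × ℕ => ‖(x ^ p.2).coeff p.1‖ := by
  simpa using summable_rescaled_pow x zero_le_one le_rfl 0 (by simpa using hx)

/-- The Neumann series `∑ xⁿ`. -/
def neumann (x : SmoothTorus θ) (hx : ∑' ν, ‖x.coeff ν‖ < 1) : SmoothTorus θ where
  coeff ν := ∑' n, (x ^ n).coeff ν
  rapid k := by
    obtain ⟨s, hs0, hs1, hs⟩ := exists_rescaled_weight x hx k
    have h := summable_rescaled_pow x hs0.le hs1 k hs
    refine Summable.of_nonneg_of_le (fun ν => by positivity) (fun ν => ?_)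
      (h.prod.mul_left ((s⁻¹) ^ k))
    -- Returning to the original weight costs only the factor `s⁻ᵏ`, because `1 ≤ s⁻¹`.
    have h1 : (1 + ‖ν‖) ^ k ≤ (s⁻¹) ^ k * (1 + s * ‖ν‖) ^ k := by
      rw [← mul_pow]
      refine pow_le_pow_left₀ (by positivity) ?_ k
      have : s⁻¹ * (1 + s * ‖ν‖) = s⁻¹ + ‖ν‖ := by field_simp
      rw [this]
      have := (one_le_inv₀ hs0).mpr hs1
      linarith
    have h2 := (summable_pow_coeff x hx).prod_factor ν
    calc _ ≤ (s⁻¹) ^ k * (1 + s * ‖ν‖) ^ k * ∑' n, ‖(x ^ n).coeff ν‖ := by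
            gcongr
            exact norm_tsum_le_tsum_norm h2
      _ = _ := by rw [mul_assoc, ← tsum_mul_left]

/-- Multiplication by `x` shifts the series by one index; absolute convergence permits exchanging
the convolution sum with the sum over powers. -/
theorem one_sub_mul_neumann (x : SmoothTorus θ) (hx : ∑' ν, ‖x.coeff ν‖ < 1) :
    (1 - x) * neumann x hx = 1 := by
  have hs := summable_pow_coeff x hx
  have hmul : x * neumann x hx = neumann x hx - 1 := by
    ext ν
    rw [mul_coeff, sub_coeff]
    have h1 : Summable fun n => (x ^ n).coeff ν := (hs.prod_factor ν).of_norm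
    have h2 : (neumann x hx).coeff ν = (1 : SmoothTorus θ).coeff ν + ∑' n, (x ^ (n + 1)).coeff ν :=
      h1.tsum_eq_zero_add.trans (by rw [pow_zero])
    rw [h2, add_sub_cancel_left]
    have h3 : Summable (Function.uncurry fun (m : ι → ℤ) (n : ℕ) =>
        x.coeff m * (x ^ n).coeff (ν - m) * torusCocycle θ m (ν - m)) := by
      refine Summable.of_norm ?_
      have hC : ∀ m, ‖x.coeff m‖ ≤ ∑' μ, ‖x.coeff μ‖ := fun m =>
        x.summable_norm.le_tsum m fun _ _ => norm_nonneg _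
      have h4 := ((Equiv.prodCongr (Equiv.subLeft ν) (Equiv.refl ℕ)).summable_iff.mpr hs).mul_left
        (∑' μ, ‖x.coeff μ‖)
      refine Summable.of_nonneg_of_le (fun _ => norm_nonneg _) ?_ h4
      rintro ⟨m, n⟩
      simp only [Function.uncurry_apply_pair, norm_mul, norm_torusCocycle, mul_one]
      exact mul_le_mul_of_nonneg_right (hC m) (norm_nonneg _)
    calc _ = ∑' m, ∑' n, x.coeff m * (x ^ n).coeff (ν - m) * torusCocycle θ m (ν - m) := by
            refine tsum_congr fun m => ?_
            rw [tsum_mul_right, tsum_mul_left]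
            rfl
      _ = _ := by
            rw [← h3.tsum_comm]
            exact tsum_congr fun n => by rw [pow_succ', mul_coeff]
  rw [sub_mul, one_mul, hmul, sub_sub_cancel]

/-- The left inverse is the adjoint of the right inverse of `1 - adj x`, so only one side of the
Neumann identity has to be computed. -/
theorem isUnit_one_sub (hθ : θᵀ = -θ) (x : SmoothTorus θ) (hx : ∑' ν, ‖x.coeff ν‖ < 1) :
    IsUnit (1 - x) := by
  have hx' : ∑' ν, ‖(adj x).coeff ν‖ < 1 := by
    have : ∑' ν, ‖(adj x).coeff ν‖ = ∑' ν, ‖x.coeff ν‖ := by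
      rw [← (Equiv.neg (ι → ℤ)).tsum_eq fun ν => ‖x.coeff ν‖]
      exact tsum_congr fun ν => by simp
    rwa [this]
  have h2 : adj (neumann (adj x) hx') * (1 - x) = 1 := by
    have := congrArg adj (one_sub_mul_neumann (adj x) hx')
    rwa [adj_mul hθ, adj_sub, adj_one, adj_adj] at this
  have h1 := one_sub_mul_neumann x hx
  exact ⟨⟨1 - x, neumann x hx, h1, by rw [← left_inv_eq_right_inv h2 h1]; exact h2⟩, rfl⟩

end SmoothTorus
end TorusAlgebra

/-! ### Heisenberg operators, their infinitesimal generators and matrix coefficients -/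

section Heisenberg

theorem linPhase_add_left (y y' z : V4) : linPhase (y + y') z = linPhase y z + linPhase y' z := by
  simp [linPhase, add_dotProduct]; ring

theorem linPhase_add_right (y z z' : V4) : linPhase y (z + z') = linPhase y z + linPhase y z' := by
  simp [linPhase, dotProduct_add]; ring

theorem linPhase_neg_left (y z : V4) : linPhase (-y) z = -linPhase y z := by
  simp [linPhase]

theorem linPhase_neg_right (y z : V4) : linPhase y (-z) = -linPhase y z := by
  simp [linPhase]

theorem linPhase_zero_left (z : V4) : linPhase 0 z = 0 := by simp [linPhase]

theorem linPhase_zero_right (z : V4) : linPhase z 0 = 0 := by simp [linPhase]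

theorem linPhase_smul_left (r : ℝ) (y z : V4) : linPhase (r • y) z = r * linPhase y z := by
  simp [linPhase]; ring

theorem linPhase_smul_right (r : ℝ) (y z : V4) : linPhase y (r • z) = r * linPhase y z := by
  simp [linPhase]; ring

theorem linPhase_comm (y z : V4) : linPhase y z = linPhase z y := by
  rw [linPhase, linPhase, dotProduct_comm]

theorem norm_exp_real_mul (t : ℝ) : ‖Complex.exp (2 * Real.pi * Complex.I * t)‖ = 1 := by
  have : 2 * Real.pi * Complex.I * (t : ℂ) = ((2 * Real.pi * t : ℝ) : ℂ) * Complex.I := by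
    push_cast; ring
  rw [this, Complex.norm_exp_ofReal_mul_I]

theorem norm_exp_linPhase (y z : V4) : ‖Complex.exp (linPhase y z)‖ = 1 := norm_exp_real_mul _

theorem conj_two : starRingEnd ℂ 2 = 2 := Complex.conj_ofReal 2

theorem conj_exp_linPhase (y z : V4) :
    starRingEnd ℂ (Complex.exp (linPhase y z)) = Complex.exp (-linPhase y z) := by
  rw [← Complex.exp_conj]
  simp [linPhase, conj_two]

theorem conj_exp_real_mul (t : ℝ) :
    starRingEnd ℂ (Complex.exp (2 * Real.pi * Complex.I * t)) =
      Complex.exp (-(2 * Real.pi * Complex.I * t)) := by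
  rw [← Complex.exp_conj]
  simp [conj_two]

theorem Omega_add_left (u v w : Phase) : Omega (u + v) w = Omega u w + Omega v w := by
  simp [Omega, add_dotProduct, dotProduct_add]; ring

theorem Omega_add_right (u v w : Phase) : Omega u (v + w) = Omega u v + Omega u w := by
  simp [Omega, add_dotProduct, dotProduct_add]; ring

theorem Omega_smul_left (r : ℝ) (v w : Phase) : Omega (r • v) w = r * Omega v w := by
  simp [Omega]; ring

theorem Omega_smul_right (r : ℝ) (v w : Phase) : Omega v (r • w) = r * Omega v w := by
  simp [Omega]; ring

theorem Omega_swap (v w : Phase) : Omega v w = -Omega w v := by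
  simp [Omega]

theorem Omega_neg_left (v w : Phase) : Omega (-v) w = -Omega v w := by
  simp [Omega]; ring

theorem Omega_nondegenerate {v : Phase} (h : ∀ w, Omega v w = 0) : v = 0 := by
  -- These two test vectors produce the squared lengths of the components of `v`.
  have h1 := h (0, v.1)
  have h2 := h (-v.2, 0)
  simp only [Omega, dotProduct_zero, zero_dotProduct, sub_zero, zero_sub, dotProduct_neg, neg_neg,
    dotProduct_self_eq_zero] at h1 h2
  exact Prod.ext h1 h2

theorem heis_zero (f : 𝓢(V4, ℂ)) : heis 0 f = f := by
  ext z; simp [heis_apply, linPhase_zero_left]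

theorem heis_heis (v w : Phase) (f : 𝓢(V4, ℂ)) :
    heis v (heis w f) = Complex.exp (linPhase w.2 v.1) • heis (v + w) f := by
  ext z
  simp only [heis_apply, smul_apply, smul_eq_mul, Prod.fst_add, Prod.snd_add,
    linPhase_add_left, linPhase_add_right, Complex.exp_add, add_assoc]
  ring

theorem heis_comm (v w : Phase) (f : 𝓢(V4, ℂ)) :
    heis v (heis w f) =
      Complex.exp (2 * Real.pi * Complex.I * (Omega v w : ℝ)) • heis w (heis v f) := by
  rw [heis_heis, heis_heis, smul_smul, add_comm w v, ← Complex.exp_add]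
  congr 2
  simp [linPhase, Omega]
  ring

theorem Qop_apply' (v : Phase) (f : 𝓢(V4, ℂ)) (z : V4) :
    Qop v f z = linPhase v.2 z * f z + fderiv ℝ f z v.1 := by
  simp [Qop, SchwartzMap.smulLeftCLM_apply_apply (linPhase_hasTemperateGrowth v.2),
    SchwartzMap.lineDerivOp_apply_eq_fderiv]

theorem linPhase_hasFDerivAt (y z : V4) :
    ∃ L : V4 →L[ℝ] ℂ, (∀ w, L w = linPhase y w) ∧ HasFDerivAt (linPhase y) L z := by
  let L : V4 →ₗ[ℝ] ℂ :=
    { toFun := linPhase y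
      map_add' := linPhase_add_right y
      map_smul' := fun r u => by simp [linPhase_smul_right] }
  exact ⟨LinearMap.toContinuousLinearMap L, fun _ => rfl,
    (LinearMap.toContinuousLinearMap L).hasFDerivAt⟩

theorem Qop_add (v w : Phase) : Qop (v + w) = Qop v + Qop w := by
  ext f z
  simp [Qop_apply', linPhase_add_left]
  ring

theorem Qop_smul (r : ℝ) (v : Phase) (f : 𝓢(V4, ℂ)) : Qop (r • v) f = (r : ℂ) • Qop v f := by
  ext z
  simp [Qop_apply', linPhase_smul_left]
  ring

/-- The two terms of Ω have different origins: the derivative in `Q_v` hits the exponential of `heis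
w`, and the multiplier in `Q_v` is evaluated at a point translated by `w.1`. -/
theorem Qop_heis (v w : Phase) (f : 𝓢(V4, ℂ)) :
    Qop v (heis w f) - heis w (Qop v f) =
      (2 * Real.pi * Complex.I * (Omega v w : ℝ)) • heis w f := by
  ext z
  obtain ⟨L, hL, hd⟩ := linPhase_hasFDerivAt w.2 z
  have h1 : HasFDerivAt (fun z => f (z + w.1)) (fderiv ℝ f (z + w.1)) z :=
    (f.hasFDerivAt (z + w.1)).comp z ((hasFDerivAt_id z).add_const w.1)
  have h2 : HasFDerivAt (heis w f) _ z :=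
    ((hd.cexp).mul h1).congr_of_eventuallyEq (Filter.Eventually.of_forall fun z => heis_apply w f z)
  simp only [sub_apply, smul_apply, Qop_apply', heis_apply, h2.fderiv,
    add_apply, smul_apply, hL, smul_eq_mul,
    linPhase_add_right]
  have h3 : 2 * Real.pi * Complex.I * (Omega v w : ℝ) = linPhase w.2 v.1 - linPhase v.2 w.1 := by
    simp [linPhase, Omega]; ring
  rw [h3]
  ring

theorem Qop_Qop (v w : Phase) (f : 𝓢(V4, ℂ)) :
    Qop v (Qop w f) - Qop w (Qop v f) =
      (2 * Real.pi * Complex.I * (Omega v w : ℝ)) • f := by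
  ext z
  have key : ∀ u v : Phase, fderiv ℝ (Qop u f) z v.1 = linPhase u.2 v.1 * f z
      + linPhase u.2 z * fderiv ℝ f z v.1 + fderiv ℝ (fderiv ℝ f) z v.1 u.1 := by
    intro u v
    obtain ⟨L, hL, hd⟩ := linPhase_hasFDerivAt u.2 z
    have h0 : HasFDerivAt (fderiv ℝ f) (fderiv ℝ (fderiv ℝ f) z) z := by
      have := (f.smooth 2).fderiv_right (m := 1) (by norm_num)
      exact ((this.differentiable (by norm_num)) z).hasFDerivAt
    have h1 := h0.clm_apply (hasFDerivAt_const u.1 z)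
    have h2 : HasFDerivAt (Qop u f) _ z :=
      ((hd.mul (f.hasFDerivAt z)).add h1).congr_of_eventuallyEq
        (Filter.Eventually.of_forall fun z => Qop_apply' u f z)
    rw [h2.fderiv]
    simp [hL]
    ring
  -- All second-order terms of the commutator cancel by symmetry of the second derivative.
  have hsymm : fderiv ℝ (fderiv ℝ f) z v.1 w.1 = fderiv ℝ (fderiv ℝ f) z w.1 v.1 := by
    have := ((f.smooth 2).contDiffAt (x := z)).isSymmSndFDerivAt (by simp)
    exact this v.1 w.1
  simp only [sub_apply, smul_apply, Qop_apply' _ (Qop _ f), key, hsymm,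
    Qop_apply', smul_eq_mul]
  have h3 : 2 * Real.pi * Complex.I * (Omega v w : ℝ) = linPhase w.2 v.1 - linPhase v.2 w.1 := by
    simp [linPhase, Omega]; ring
  rw [h3]
  ring

/-! ### The inner product of Schwartz functions -/

/-- Complex conjugation of Schwartz functions. -/
def conjSchwartz (f : 𝓢(V4, ℂ)) : 𝓢(V4, ℂ) :=
  SchwartzMap.postcompCLM (𝕜 := ℝ) (Complex.conjCLE : ℂ →L[ℝ] ℂ) f

theorem conjSchwartz_apply (f : 𝓢(V4, ℂ)) (z : V4) :
    conjSchwartz f z = starRingEnd ℂ (f z) := rfl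

/-- The product of Schwartz functions. -/
def mulSchwartz (f g : 𝓢(V4, ℂ)) : 𝓢(V4, ℂ) :=
  SchwartzMap.pairing (ContinuousLinearMap.mul ℂ ℂ) f g

theorem mulSchwartz_apply (f g : 𝓢(V4, ℂ)) (z : V4) : mulSchwartz f g z = f z * g z := rfl

/-- The sesquilinear form `∫ f conj g`. -/
def innerS (f g : 𝓢(V4, ℂ)) : ℂ := ∫ z, f z * starRingEnd ℂ (g z)

theorem innerS_integrable (f g : 𝓢(V4, ℂ)) :
    MeasureTheory.Integrable fun z => f z * starRingEnd ℂ (g z) :=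
  (mulSchwartz f (conjSchwartz g)).integrable

theorem innerS_add_left (f f' g : 𝓢(V4, ℂ)) : innerS (f + f') g = innerS f g + innerS f' g := by
  simp only [innerS, add_apply, add_mul]
  exact MeasureTheory.integral_add (innerS_integrable f g) (innerS_integrable f' g)

theorem innerS_add_right (f g g' : 𝓢(V4, ℂ)) : innerS f (g + g') = innerS f g + innerS f g' := by
  simp only [innerS, add_apply, map_add, mul_add]
  exact MeasureTheory.integral_add (innerS_integrable f g) (innerS_integrable f g')

theorem innerS_smul_left (c : ℂ) (f g : 𝓢(V4, ℂ)) : innerS (c • f) g = c * innerS f g := by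
  simp only [innerS, smul_apply, smul_eq_mul, mul_assoc]
  exact MeasureTheory.integral_const_mul _ _

theorem innerS_smul_right (c : ℂ) (f g : 𝓢(V4, ℂ)) :
    innerS f (c • g) = starRingEnd ℂ c * innerS f g := by
  simp only [innerS, smul_apply, smul_eq_mul, map_mul]
  rw [← MeasureTheory.integral_const_mul]
  congr 1; ext z; ring

theorem innerS_conj (f g : 𝓢(V4, ℂ)) : starRingEnd ℂ (innerS f g) = innerS g f := by
  rw [innerS, innerS, ← integral_conj]
  congr 1; ext z; simp [mul_comm]

theorem norm_innerS_le (f g : 𝓢(V4, ℂ)) {C : ℝ} (hg : ∀ z, ‖g z‖ ≤ C) :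
    ‖innerS f g‖ ≤ (∫ z, ‖f z‖) * C := by
  rw [← MeasureTheory.integral_mul_const]
  refine MeasureTheory.norm_integral_le_of_norm_le (f.integrable.norm.mul_const C)
    (Filter.Eventually.of_forall fun z => ?_)
  rw [norm_mul, RCLike.norm_conj]
  exact mul_le_mul_of_nonneg_left (hg z) (norm_nonneg _)

theorem innerS_self (f : 𝓢(V4, ℂ)) : innerS f f = ((∫ z, ‖f z‖ ^ 2 : ℝ) : ℂ) := by
  rw [innerS, ← integral_complex_ofReal]
  congr 1; ext z; rw [Complex.mul_conj, Complex.normSq_eq_norm_sq]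

theorem innerS_self_eq_zero {f : 𝓢(V4, ℂ)} (h : innerS f f = 0) : f = 0 := by
  have hi : MeasureTheory.Integrable fun z => ‖f z‖ ^ 2 := by
    refine (innerS_integrable f f).norm.congr (Filter.Eventually.of_forall fun z => ?_)
    simp [sq]
  rw [innerS_self, Complex.ofReal_eq_zero,
    MeasureTheory.integral_eq_zero_iff_of_nonneg (fun z => by positivity) hi] at h
  have h2 : (fun z => ‖f z‖ ^ 2) = fun _ => 0 :=
    (Continuous.ae_eq_iff_eq MeasureTheory.volume (by fun_prop) (by fun_prop)).mp h
  ext z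
  simpa using congrFun h2 z

theorem innerS_heis_heis (v : Phase) (f g : 𝓢(V4, ℂ)) :
    innerS (heis v f) (heis v g) = innerS f g := by
  simp only [innerS, heis_apply, map_mul]
  rw [← MeasureTheory.integral_add_right_eq_self (fun z => f z * starRingEnd ℂ (g z)) v.1]
  congr 1; ext z
  rw [conj_exp_linPhase, Complex.exp_neg]
  have := Complex.exp_ne_zero (linPhase v.2 z)
  field_simp

/-- The multiplier is purely imaginary and the directional derivative is skew by integration by
parts. -/
theorem innerS_Qop (v : Phase) (f g : 𝓢(V4, ℂ)) : innerS (Qop v f) g = -innerS f (Qop v g) := by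
  have h1 := SchwartzMap.integral_mul_lineDerivOp_right_eq_neg_left f (conjSchwartz g) v.1
    (μ := MeasureTheory.volume)
  have hconj : ∀ z, fderiv ℝ (conjSchwartz g) z v.1 = starRingEnd ℂ (fderiv ℝ g z v.1) := by
    intro z
    have : HasFDerivAt (conjSchwartz g) _ z :=
      (Complex.conjCLE : ℂ →L[ℝ] ℂ).hasFDerivAt.comp z (g.hasFDerivAt z)
    rw [this.fderiv]
    simp
  have e1 : ∀ z, f z * starRingEnd ℂ (Qop v g z) = -(linPhase v.2 z * f z * starRingEnd ℂ (g z))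
      + f z * LineDeriv.lineDerivOp v.1 (conjSchwartz g) z := by
    intro z
    rw [SchwartzMap.lineDerivOp_apply_eq_fderiv, hconj, Qop_apply', map_add, map_mul]
    simp [linPhase, conj_two]
    ring
  have e2 : ∀ z, Qop v f z * starRingEnd ℂ (g z) = linPhase v.2 z * f z * starRingEnd ℂ (g z)
      + LineDeriv.lineDerivOp v.1 f z * conjSchwartz g z := by
    intro z
    rw [SchwartzMap.lineDerivOp_apply_eq_fderiv, conjSchwartz_apply, Qop_apply']
    ring
  have i1 : MeasureTheory.Integrable fun z => linPhase v.2 z * f z * starRingEnd ℂ (g z) := by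
    refine (innerS_integrable (SchwartzMap.smulLeftCLM ℂ (linPhase v.2) f) g).congr
      (Filter.Eventually.of_forall fun z => ?_)
    simp [SchwartzMap.smulLeftCLM_apply_apply (linPhase_hasTemperateGrowth v.2)]
  simp only [innerS, e1, e2]
  have i2 := (mulSchwartz (LineDeriv.lineDerivOp v.1 f) (conjSchwartz g)).integrable
    (μ := MeasureTheory.volume)
  have i3 := (mulSchwartz f (LineDeriv.lineDerivOp v.1 (conjSchwartz g))).integrable
    (μ := MeasureTheory.volume)
  refine (MeasureTheory.integral_add i1 i2).trans ?_
  refine Eq.trans ?_ (congrArg Neg.neg (MeasureTheory.integral_add i1.neg i3)).symm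
  simp only [mulSchwartz_apply, Pi.neg_apply, MeasureTheory.integral_neg, h1]
  ring

/-! ### Decay of matrix coefficients -/

theorem norm_heis_apply (v : Phase) (f : 𝓢(V4, ℂ)) (z : V4) : ‖heis v f z‖ = ‖f (z + v.1)‖ := by
  rw [heis_apply, norm_mul, norm_exp_linPhase, one_mul]

theorem norm_innerS_heis_le (f g : 𝓢(V4, ℂ)) :
    ∃ C, 0 ≤ C ∧ ∀ v, ‖innerS f (heis v g)‖ ≤ C := by
  refine ⟨(∫ z, ‖f z‖) * SchwartzMap.seminorm ℝ 0 0 g, by positivity, fun v => ?_⟩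
  exact norm_innerS_le _ _ fun z => by
    rw [norm_heis_apply]; exact SchwartzMap.norm_le_seminorm ℝ g _

/-- The source of rapid decay: taking the matrix coefficient of the commutator of `Q_w` with `heis
v`, and moving `Q_w` to the other side, trades a factor Ω(w, v) for new Schwartz functions that do
not depend on `v`. -/
theorem Omega_mul_innerS_heis (w v : Phase) (f g : 𝓢(V4, ℂ)) :
    2 * Real.pi * Complex.I * (Omega w v : ℝ) * innerS f (heis v g) =
      innerS (Qop w f) (heis v g) + innerS f (heis v (Qop w g)) := by
  have h := congrArg (innerS f) (Qop_heis w v g)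
  rw [sub_eq_add_neg, innerS_add_right, ← neg_one_smul ℂ (heis v (Qop w g)), innerS_smul_right,
    innerS_smul_right] at h
  rw [innerS_Qop]
  simp only [map_mul, map_neg, map_one, conj_two, Complex.conj_ofReal, Complex.conj_I] at h
  linear_combination h

theorem Omega_pow_mul_innerS_heis_le (w : Phase) (k : ℕ) (f g : 𝓢(V4, ℂ)) :
    ∃ C, 0 ≤ C ∧ ∀ v, |Omega w v| ^ k * ‖innerS f (heis v g)‖ ≤ C := by
  induction k generalizing f g with
  | zero => simpa using norm_innerS_heis_le f g
  | succ k ih =>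
    obtain ⟨C, hC0, hC⟩ := ih (Qop w f) g
    obtain ⟨D, hD0, hD⟩ := ih f (Qop w g)
    refine ⟨C + D, by positivity, fun v => ?_⟩
    have h1 := congrArg norm (Omega_mul_innerS_heis w v f g)
    rw [norm_mul, norm_mul, norm_mul, norm_mul, Complex.norm_I, Complex.norm_real,
      Complex.norm_real, Complex.norm_ofNat, Real.norm_of_nonneg Real.pi_pos.le,
      Real.norm_eq_abs] at h1
    -- The factor 2π is at least 1, so it may be dropped from the left-hand side.
    have hpi : 1 ≤ 2 * Real.pi * 1 := by linarith [Real.pi_gt_three]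
    have h2 : |Omega w v| * ‖innerS f (heis v g)‖ ≤
        ‖innerS (Qop w f) (heis v g)‖ + ‖innerS f (heis v (Qop w g))‖ := by
      refine le_trans ?_ (h1.le.trans (norm_add_le _ _))
      have : 0 ≤ |Omega w v| * ‖innerS f (heis v g)‖ := by positivity
      nlinarith
    calc |Omega w v| ^ (k + 1) * ‖innerS f (heis v g)‖
        = |Omega w v| ^ k * (|Omega w v| * ‖innerS f (heis v g)‖) := by ring
      _ ≤ |Omega w v| ^ k *
          (‖innerS (Qop w f) (heis v g)‖ + ‖innerS f (heis v (Qop w g))‖) := by gcongr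
      _ ≤ C + D := by rw [mul_add]; exact add_le_add (hC v) (hD v)

theorem norm_pow_le_sum {ι : Type} [Fintype ι] (x : ι → ℝ) {k : ℕ} (hk : k ≠ 0) :
    ‖x‖ ^ k ≤ ∑ i, |x i| ^ k := by
  rcases isEmpty_or_nonempty ι with h | h
  · have : x = 0 := Subsingleton.elim _ _
    simp [this, hk]
  · obtain ⟨i, -, hi⟩ := Finset.exists_mem_eq_sup Finset.univ Finset.univ_nonempty
      (fun i => ‖x i‖₊)
    rw [Pi.norm_def, hi, coe_nnnorm, Real.norm_eq_abs]
    exact Finset.single_le_sum (f := fun i => |x i| ^ k) (fun i _ => by positivity)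
      (Finset.mem_univ i)

/-- Rapid decay of matrix coefficients along a linear map `L` with a left `Ω`-dual. -/
theorem innerS_heis_decay {ι : Type} [Fintype ι] [DecidableEq ι] (L : (ι → ℝ) →ₗ[ℝ] Phase)
    (M : ι → Phase) (hM : ∀ i x, Omega (M i) (L x) = x i) (k : ℕ) (f g : 𝓢(V4, ℂ)) :
    ∃ C, 0 ≤ C ∧ ∀ x, (1 + ‖x‖) ^ k * ‖innerS f (heis (L x) g)‖ ≤ C := by
  rcases eq_or_ne k 0 with rfl | hk
  · obtain ⟨C, h0, hC⟩ := norm_innerS_heis_le f g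
    exact ⟨C, h0, fun x => by simpa using hC (L x)⟩
  obtain ⟨C, h0, hC⟩ := norm_innerS_heis_le f g
  -- Each coordinate of `x` is the pairing of `L x` with `M i`, so powers of `‖x‖` reduce to powers
  -- of single pairings.
  choose D hD0 hD using fun i => Omega_pow_mul_innerS_heis_le (M i) k f g
  have hD1 : 0 ≤ ∑ i, D i := Finset.sum_nonneg fun i _ => hD0 i
  refine ⟨2 ^ (k - 1) * (C + ∑ i, D i), by positivity, fun x => ?_⟩
  have h1 := add_pow_le zero_le_one (norm_nonneg x) k
  calc _ ≤ 2 ^ (k - 1) * (1 ^ k + ‖x‖ ^ k) * ‖innerS f (heis (L x) g)‖ := by gcongr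
    _ ≤ 2 ^ (k - 1) * (1 ^ k + ∑ i, |x i| ^ k) * ‖innerS f (heis (L x) g)‖ := by
      gcongr; exact norm_pow_le_sum x hk
    _ = 2 ^ (k - 1) * (‖innerS f (heis (L x) g)‖
          + ∑ i, |x i| ^ k * ‖innerS f (heis (L x) g)‖) := by
      rw [one_pow, mul_assoc, add_mul, one_mul, Finset.sum_mul]
    _ ≤ _ := by
      gcongr with i
      · exact hC _
      · rw [← hM i x]; exact hD i _

end Heisenberg

/-! ### Absolutely convergent series of Schwartz functions -/

section SchwartzSums

/-- Completeness in concrete form: the pointwise sum may be differentiated term by term. The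
seminorm estimate is kept because it controls the tails in `summable_schwartz`. -/
theorem exists_schwartz_tsum {β : Type*} (g : β → 𝓢(V4, ℂ))
    (hg : ∀ k n, Summable fun b => SchwartzMap.seminorm ℝ k n (g b)) :
    ∃ G : 𝓢(V4, ℂ), (∀ z, HasSum (fun b => g b z) (G z)) ∧
      ∀ k n, SchwartzMap.seminorm ℝ k n G ≤ ∑' b, SchwartzMap.seminorm ℝ k n (g b) := by
  have hb : ∀ (n : ℕ) (b : β) (x : V4), (n : ℕ∞) ≤ ⊤ → ‖iteratedFDeriv ℝ n (g b) x‖ ≤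
      SchwartzMap.seminorm ℝ 0 n (g b) :=
    fun n b x _ => SchwartzMap.norm_iteratedFDeriv_le_seminorm ℝ (g b) n x
  have hsm : ∀ b, ContDiff ℝ ((⊤ : ℕ∞) : WithTop ℕ∞) (g b) := fun b => (g b).smooth ⊤
  have hdecay : ∀ k n x, ‖x‖ ^ k * ‖iteratedFDeriv ℝ n (fun y => ∑' b, g b y) x‖ ≤
      ∑' b, SchwartzMap.seminorm ℝ k n (g b) := by
    intro k n x
    have hs : Summable fun b => ‖iteratedFDeriv ℝ n (g b) x‖ :=
      Summable.of_nonneg_of_le (fun _ => norm_nonneg _) (fun b => hb n b x le_top) (hg 0 n)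
    rw [iteratedFDeriv_tsum_apply hsm (fun n _ => hg 0 n) hb le_top]
    calc _ ≤ ‖x‖ ^ k * ∑' b, ‖iteratedFDeriv ℝ n (g b) x‖ := by
          gcongr; exact norm_tsum_le_tsum_norm hs
      _ = ∑' b, ‖x‖ ^ k * ‖iteratedFDeriv ℝ n (g b) x‖ := tsum_mul_left.symm
      _ ≤ _ := (hs.mul_left _).tsum_le_tsum (fun b => SchwartzMap.le_seminorm ℝ k n (g b) x)
          (hg k n)
  refine ⟨⟨fun x => ∑' b, g b x, contDiff_tsum hsm (fun n _ => hg 0 n) hb, fun k n =>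
    ⟨_, hdecay k n⟩⟩, fun z => ?_, fun k n => ?_⟩
  · exact (Summable.of_norm (Summable.of_nonneg_of_le (fun _ => norm_nonneg _)
      (fun b => SchwartzMap.norm_le_seminorm ℝ (g b) z) (hg 0 0))).hasSum
  · exact SchwartzMap.seminorm_le_bound ℝ k n _
      (tsum_nonneg fun b => apply_nonneg _ _) (hdecay k n)

theorem summable_schwartz {β : Type*} (g : β → 𝓢(V4, ℂ))
    (hg : ∀ k n, Summable fun b => SchwartzMap.seminorm ℝ k n (g b)) : Summable g := by
  obtain ⟨G, hG, -⟩ := exists_schwartz_tsum g hg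
  refine ⟨G, ?_⟩
  rw [HasSum, (schwartz_withSeminorms ℝ V4 ℂ).tendsto_nhds]
  rintro ⟨k, n⟩ ε hε
  have ht := tendsto_tsum_compl_atTop_zero fun b => SchwartzMap.seminorm ℝ k n (g b)
  filter_upwards [ht.eventually (gt_mem_nhds hε)] with s hs
  refine lt_of_le_of_lt ?_ hs
  -- The error of a partial sum is itself a Schwartz sum over the complement, so each of its
  -- seminorms is bounded by the tail of a convergent numerical series.
  obtain ⟨H, hH, hH'⟩ := exists_schwartz_tsum (fun b : {b // b ∉ s} => g b)
    fun k n => (hg k n).subtype _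
  have : ∑ b ∈ s, g b - G = -H := by
    ext z
    have h1 : HasSum (fun b : {b // b ∉ s} => g b z) (G z - ∑ b ∈ s, g b z) :=
      (s.hasSum_compl_iff (f := fun b => g b z)).mpr (by simpa using hG z)
    simp only [sub_apply, neg_apply, sum_apply, (hH z).unique h1, neg_sub]
  rw [this, map_neg_eq_map]
  exact hH' k n

theorem continuous_schwartz_apply (z : V4) : Continuous fun f : 𝓢(V4, ℂ) => f z :=
  ((BoundedContinuousFunction.evalCLM ℝ z).comp
    (SchwartzMap.toBoundedContinuousFunctionCLM ℝ V4 ℂ)).continuous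

theorem HasSum.schwartz_apply {β : Type*} {g : β → 𝓢(V4, ℂ)} {G : 𝓢(V4, ℂ)} (h : HasSum g G)
    (z : V4) : HasSum (fun b => g b z) (G z) :=
  h.map ({ toFun := fun f => f z, map_zero' := rfl, map_add' := fun _ _ => rfl } :
    𝓢(V4, ℂ) →+ ℂ) (continuous_schwartz_apply z)

end SchwartzSums

/-! ### Polynomial growth of Schwartz seminorms under Heisenberg operators -/

section SeminormBounds

theorem fderiv_eq_sum_coord (g : V4 → ℂ) (y : V4) :
    fderiv ℝ g y = ∑ j : Fin 4, (ContinuousLinearMap.proj (R := ℝ) j : V4 →L[ℝ] ℝ).smulRight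
      (fderiv ℝ g y (Pi.single j 1)) := by
  ext w
  conv_lhs => rw [← Finset.univ_sum_single w]
  simp only [map_sum, sum_apply, ContinuousLinearMap.smulRight_apply,
    ContinuousLinearMap.proj_apply]
  refine Finset.sum_congr rfl fun j _ => ?_
  rw [← map_smul]
  congr 1
  ext i
  by_cases h : i = j
  · subst h; simp
  · simp [h]

/-- The derivatives of order `n + 1` are controlled by those of order `n` of the partial
derivatives. -/
theorem norm_iteratedFDeriv_succ_le {g : V4 → ℂ} (hg : ContDiff ℝ ∞ g) (n : ℕ) (z : V4) :
    ‖iteratedFDeriv ℝ (n + 1) g z‖ ≤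
      ∑ j : Fin 4, ‖iteratedFDeriv ℝ n (fun y => fderiv ℝ g y (Pi.single j 1)) z‖ := by
  rw [← norm_iteratedFDeriv_fderiv]
  let S : Fin 4 → ℂ →L[ℝ] (V4 →L[ℝ] ℂ) := fun j =>
    ContinuousLinearMap.smulRightL ℝ V4 ℂ (ContinuousLinearMap.proj (R := ℝ) j : V4 →L[ℝ] ℝ)
  have hS : ∀ j, ‖S j‖ ≤ 1 := fun j => by
    refine ContinuousLinearMap.opNorm_le_bound _ zero_le_one fun c => ?_
    refine ContinuousLinearMap.opNorm_le_bound _ (by positivity) fun w => ?_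
    rw [one_mul]
    change ‖w j • c‖ ≤ _
    rw [norm_smul, mul_comm]
    exact mul_le_mul_of_nonneg_left (norm_le_pi_norm w j) (norm_nonneg _)
  have hd : ∀ j : Fin 4, ContDiff ℝ ∞ fun y => fderiv ℝ g y (Pi.single j 1) := fun j =>
    (hg.fderiv_right (m := ∞) (by simp)).clm_apply contDiff_const
  have h1 : fderiv ℝ g = fun y => ∑ j, (S j ∘ fun y => fderiv ℝ g y (Pi.single j 1)) y := by
    funext y
    exact fderiv_eq_sum_coord g y
  have hn : (n : WithTop ℕ∞) ≤ ∞ := by exact_mod_cast le_top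
  conv_lhs => rw [h1]
  rw [iteratedFDeriv_fun_sum_apply fun j _ => (((S j).contDiff.comp (hd j)).of_le hn).contDiffAt]
  refine (norm_sum_le _ _).trans (Finset.sum_le_sum fun j _ => ?_)
  refine ((S j).norm_iteratedFDeriv_comp_left (hd j).contDiffAt hn).trans ?_
  exact mul_le_of_le_one_left (norm_nonneg _) (hS j)

/-- Expresses one more derivative by the operators `Q_{(e_j, 0)}`, which have scalar commutators
with the Heisenberg operators; this makes an induction on the order possible. -/
theorem seminorm_succ_le (k n : ℕ) (g : 𝓢(V4, ℂ)) :
    SchwartzMap.seminorm ℝ k (n + 1) g ≤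
      ∑ j : Fin 4, SchwartzMap.seminorm ℝ k n (Qop (Pi.single j 1, 0) g) := by
  refine SchwartzMap.seminorm_le_bound ℝ k (n + 1) g
    (Finset.sum_nonneg fun j _ => apply_nonneg _ _) fun z => ?_
  refine (mul_le_mul_of_nonneg_left (norm_iteratedFDeriv_succ_le (g.smooth ⊤) n z)
    (by positivity)).trans ?_
  rw [Finset.mul_sum]
  refine Finset.sum_le_sum fun j _ => ?_
  have : (fun y => fderiv ℝ g y (Pi.single j 1)) = Qop (Pi.single j 1, 0) g := by
    funext y; simp [Qop_apply', linPhase_zero_left]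
  rw [this]
  exact SchwartzMap.le_seminorm ℝ k n _ z

theorem seminorm_smul_complex (k n : ℕ) (c : ℂ) (f : 𝓢(V4, ℂ)) :
    SchwartzMap.seminorm ℝ k n (c • f) = ‖c‖ * SchwartzMap.seminorm ℝ k n f :=
  map_smul_eq_mul (SchwartzMap.seminorm ℂ k n) c f

theorem dotProduct_abs_le (x y : V4) : |x ⬝ᵥ y| ≤ 4 * (‖x‖ * ‖y‖) := by
  refine (Finset.abs_sum_le_sum_abs _ _).trans ?_
  refine (Finset.sum_le_card_nsmul _ _ (‖x‖ * ‖y‖) fun i _ => ?_).trans (by simp)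
  rw [abs_mul]
  exact mul_le_mul (norm_le_pi_norm x i) (norm_le_pi_norm y i) (abs_nonneg _) (norm_nonneg _)

/-- Modulation does not change absolute values, and translation by `v.1` costs at most k powers of
`1 + ‖v‖` by the triangle inequality. -/
theorem seminorm_zero_heis_le (k : ℕ) (f : 𝓢(V4, ℂ)) :
    ∃ C, 0 ≤ C ∧ ∀ v, SchwartzMap.seminorm ℝ k 0 (heis v f) ≤ C * (1 + ‖v‖) ^ k := by
  refine ⟨2 ^ (k - 1) * (SchwartzMap.seminorm ℝ k 0 f + SchwartzMap.seminorm ℝ 0 0 f),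
    by positivity, fun v => SchwartzMap.seminorm_le_bound ℝ k 0 _ (by positivity) fun z => ?_⟩
  rw [norm_iteratedFDeriv_zero, norm_heis_apply]
  have h1 : ‖z‖ ≤ ‖z + v.1‖ + ‖v.1‖ := by
    simpa using norm_sub_le (z + v.1) v.1
  have h2 : ‖v.1‖ ≤ ‖v‖ := norm_fst_le v
  have h3 := SchwartzMap.norm_pow_mul_le_seminorm ℝ f k (z + v.1)
  have h4 := SchwartzMap.norm_le_seminorm ℝ f (z + v.1)
  have h5 : (1 : ℝ) ≤ (1 + ‖v‖) ^ k := one_le_pow₀ (by linarith [norm_nonneg v])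
  calc ‖z‖ ^ k * ‖f (z + v.1)‖ ≤ (‖z + v.1‖ + ‖v.1‖) ^ k * ‖f (z + v.1)‖ := by gcongr
    _ ≤ 2 ^ (k - 1) * (‖z + v.1‖ ^ k + ‖v.1‖ ^ k) * ‖f (z + v.1)‖ := by
      gcongr; exact add_pow_le (norm_nonneg _) (norm_nonneg _) k
    _ = 2 ^ (k - 1) * (‖z + v.1‖ ^ k * ‖f (z + v.1)‖ + ‖v.1‖ ^ k * ‖f (z + v.1)‖) := by ring
    _ ≤ 2 ^ (k - 1) * (SchwartzMap.seminorm ℝ k 0 f * (1 + ‖v‖) ^ k +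
          (1 + ‖v‖) ^ k * SchwartzMap.seminorm ℝ 0 0 f) := by
      refine mul_le_mul_of_nonneg_left (add_le_add
        (h3.trans (le_mul_of_one_le_right (apply_nonneg _ _) h5)) ?_) (by positivity)
      gcongr
      linarith
    _ = _ := by ring

/-- The seminorms of `heis v f` grow polynomially in `v`. -/
theorem seminorm_heis_le (k n : ℕ) (f : 𝓢(V4, ℂ)) :
    ∃ C, 0 ≤ C ∧ ∀ v, SchwartzMap.seminorm ℝ k n (heis v f) ≤ C * (1 + ‖v‖) ^ (k + n) := by
  induction n generalizing f with
  | zero => exact seminorm_zero_heis_le k f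
  | succ n ih =>
    obtain ⟨C, hC0, hC⟩ := ih f
    choose D hD0 hD using fun j : Fin 4 => ih (Qop (Pi.single j 1, 0) f)
    refine ⟨∑ j, (D j + 8 * Real.pi * C), by
      have := Real.pi_pos
      exact Finset.sum_nonneg fun j _ => by have := hD0 j; positivity, fun v => ?_⟩
    refine (seminorm_succ_le k n _).trans ?_
    rw [Finset.sum_mul]
    refine Finset.sum_le_sum fun j _ => ?_
    -- Commuting a partial derivative past `heis v` leaves a scalar of size O(1 + ‖v‖), so each
    -- derivative costs one extra power.
    have h1 := eq_add_of_sub_eq (Qop_heis (Pi.single j 1, 0) v f)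
    rw [h1]
    have h2 : ‖(2 * Real.pi * Complex.I * (Omega (Pi.single j 1, 0) v : ℝ) : ℂ)‖ ≤
        8 * Real.pi * (1 + ‖v‖) := by
      simp only [norm_mul, Complex.norm_I, Complex.norm_real, Complex.norm_ofNat,
        Real.norm_of_nonneg Real.pi_pos.le, Real.norm_eq_abs]
      have h3 : |Omega (Pi.single j 1, 0) v| ≤ 4 * (1 + ‖v‖) := by
        have := dotProduct_abs_le v.2 (Pi.single j 1)
        rw [Pi.norm_single, norm_one, mul_one] at this
        simp only [Omega, zero_dotProduct, sub_zero]
        linarith [norm_snd_le v]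
      have := Real.pi_pos
      nlinarith
    have hv : 0 ≤ ‖v‖ := norm_nonneg v
    refine (map_add_le_add _ _ _).trans ?_
    rw [seminorm_smul_complex]
    have h4 := hD j v
    have h5 := hC v
    calc _ ≤ 8 * Real.pi * (1 + ‖v‖) * (C * (1 + ‖v‖) ^ (k + n)) + D j * (1 + ‖v‖) ^ (k + n) := by
          gcongr
      _ ≤ 8 * Real.pi * (1 + ‖v‖) * (C * (1 + ‖v‖) ^ (k + n)) +
            D j * ((1 + ‖v‖) ^ (k + n) * (1 + ‖v‖)) := by
          have := hD0 j
          gcongr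
          exact le_mul_of_one_le_right (by positivity) (by linarith)
      _ = _ := by rw [← add_assoc k n 1, pow_succ]; ring

end SeminormBounds

/-! ### Convergence of lattice sums -/

section LatticeSums

variable {ι : Type} [Fintype ι]

theorem summable_lattice : Summable fun ν : ι → ℤ => ((1 + ‖ν‖) ^ (Fintype.card ι + 1))⁻¹ := by
  classical
  let L : Submodule ℤ (ι → ℝ) := Submodule.span ℤ (Set.range (Pi.basisFun ℝ ι))
  let b := (Pi.basisFun ℝ ι).restrictScalars ℤ
  have hfr : Module.finrank ℤ L = Fintype.card ι := Module.finrank_eq_card_basis b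
  have h := ZLattice.summable_norm_pow_inv (L := L) (Fintype.card ι + 1) (by omega)
  have h2 := b.equivFun.symm.toEquiv.summable_iff.mpr h
  have hn : ∀ ν : ι → ℤ, ‖b.equivFun.symm ν‖ = ‖ν‖ := fun ν => by
    rw [← norm_latticeVec]
    change ‖(b.equivFun.symm ν : ι → ℝ)‖ = _
    congr 1
    rw [Module.Basis.equivFun_symm_apply]
    ext i
    simp [b, latticeVec, Finset.sum_apply, Pi.basisFun_apply, Pi.single_apply]
  -- The comparison series takes the value 0 at `ν = 0`, where the bound fails; hence a comparison
  -- outside a finite set.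
  refine Summable.of_norm_bounded_eventually h2 ?_
  have : ({0}ᶜ : Set (ι → ℤ)) ∈ Filter.cofinite := by simp
  filter_upwards [this] with ν hν
  have h0 : 0 < ‖ν‖ := norm_pos_iff.mpr (by simpa using hν)
  simp only [Function.comp_apply, LinearEquiv.coe_toEquiv, hn]
  rw [Real.norm_of_nonneg (by positivity)]
  rw [inv_pow]
  gcongr
  linarith

theorem rapid_of_decay {a : (ι → ℤ) → ℂ}
    (h : ∀ k : ℕ, ∃ C, ∀ ν, (1 + ‖ν‖) ^ k * ‖a ν‖ ≤ C) (k : ℕ) :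
    Summable fun ν => (1 + ‖ν‖) ^ k * ‖a ν‖ := by
  obtain ⟨C, hC⟩ := h (k + (Fintype.card ι + 1))
  refine Summable.of_nonneg_of_le (fun ν => by positivity) (fun ν => ?_)
    (summable_lattice.mul_left C)
  rw [← div_eq_mul_inv, le_div_iff₀ (by positivity)]
  calc _ = (1 + ‖ν‖) ^ (k + (Fintype.card ι + 1)) * ‖a ν‖ := by rw [pow_add]; ring
    _ ≤ C := hC ν

end LatticeSums

/-! ### From Weyl relations to actions of smooth tori -/

section WeylAction

variable {ι : Type}

/-- Phases `c ν` for which `c ν • heis (T ν)` satisfy the relations of the generators of the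
smooth torus. -/
structure IsWeylSystem [Fintype ι] (θ : Matrix ι ι ℝ) (T : (ι → ℝ) →ₗ[ℝ] Phase) (c : (ι → ℤ) → ℂ) : Prop where
  norm_eq_one : ∀ ν, ‖c ν‖ = 1
  map_zero : c 0 = 1
  mul : ∀ m n, c m * c n * Complex.exp (linPhase (T (latticeVec n)).2 (T (latticeVec m)).1) =
    torusCocycle θ m n * c (m + n)

/-- The operator `c ν • heis (T ν)`. -/
def weylOp (T : (ι → ℝ) →ₗ[ℝ] Phase) (c : (ι → ℤ) → ℂ) (ν : ι → ℤ) : 𝓢(V4, ℂ) →L[ℂ] 𝓢(V4, ℂ) :=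
  c ν • heis (T (latticeVec ν))

theorem weylOp_apply (T : (ι → ℝ) →ₗ[ℝ] Phase) (c : (ι → ℤ) → ℂ) (ν : ι → ℤ) (f : 𝓢(V4, ℂ)) :
    weylOp T c ν f = c ν • heis (T (latticeVec ν)) f := rfl

/-- The symmetrized phases `exp (π i ⟨x, y⟩)`, `(x, y) = T ν`. -/
def weylPhase (T : (ι → ℝ) →ₗ[ℝ] Phase) (ν : ι → ℤ) : ℂ :=
  Complex.exp (linPhase (T (latticeVec ν)).2 (T (latticeVec ν)).1 / 2)

theorem norm_weylPhase (T : (ι → ℝ) →ₗ[ℝ] Phase) (ν : ι → ℤ) : ‖weylPhase T ν‖ = 1 := by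
  have : weylPhase T ν = Complex.exp (2 * Real.pi * Complex.I *
      (((T (latticeVec ν)).2 ⬝ᵥ (T (latticeVec ν)).1 / 2 : ℝ) : ℂ)) := by
    rw [weylPhase, linPhase]; congr 1; push_cast; ring
  rw [this, norm_exp_real_mul]

/-- Halving the diagonal phase symmetrizes the composition law: only the antisymmetric part,
exp(πiΩ), remains as a cocycle. -/
theorem weylPhase_mul (T : (ι → ℝ) →ₗ[ℝ] Phase) (m n : ι → ℤ) :
    weylPhase T m * weylPhase T n *
        Complex.exp (linPhase (T (latticeVec n)).2 (T (latticeVec m)).1) =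
      Complex.exp (Real.pi * Complex.I * (Omega (T (latticeVec m)) (T (latticeVec n)) : ℝ)) *
        weylPhase T (m + n) := by
  simp only [weylPhase, ← Complex.exp_add, latticeVec_add, map_add, Prod.fst_add, Prod.snd_add,
    linPhase_add_left, linPhase_add_right]
  congr 1
  simp [linPhase, Omega]
  ring

theorem norm_map_lattice_le [Fintype ι] (T : (ι → ℝ) →ₗ[ℝ] Phase) :
    ∃ K, 0 ≤ K ∧ ∀ ν : ι → ℤ, 1 + ‖T (latticeVec ν)‖ ≤ (1 + K) * (1 + ‖ν‖) := by
  refine ⟨‖LinearMap.toContinuousLinearMap T‖, norm_nonneg _, fun ν => ?_⟩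
  have h := (LinearMap.toContinuousLinearMap T).le_opNorm (latticeVec ν)
  rw [norm_latticeVec] at h
  have h1 := norm_nonneg (LinearMap.toContinuousLinearMap T)
  have h2 := norm_nonneg ν
  change ‖T (latticeVec ν)‖ ≤ _ at h
  nlinarith

variable [Fintype ι] {θ : Matrix ι ι ℝ} {T : (ι → ℝ) →ₗ[ℝ] Phase} {c : (ι → ℤ) → ℂ}

namespace IsWeylSystem

theorem weylOp_zero (hW : IsWeylSystem θ T c) (f : 𝓢(V4, ℂ)) : weylOp T c 0 f = f := by
  rw [weylOp_apply, hW.map_zero, latticeVec_zero, _root_.map_zero, heis_zero, one_smul]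

theorem weylOp_weylOp (hW : IsWeylSystem θ T c) (m n : ι → ℤ) (f : 𝓢(V4, ℂ)) :
    weylOp T c m (weylOp T c n f) = torusCocycle θ m n • weylOp T c (m + n) f := by
  simp only [weylOp_apply, map_smul, heis_heis, smul_smul, latticeVec_add, map_add]
  rw [← hW.mul]
  congr 1
  ring

theorem norm_weylOp_apply (hW : IsWeylSystem θ T c) (ν : ι → ℤ) (f : 𝓢(V4, ℂ)) (z : V4) :
    ‖weylOp T c ν f z‖ = ‖f (z + (T (latticeVec ν)).1)‖ := by
  rw [weylOp_apply, smul_apply, norm_smul, hW.norm_eq_one, one_mul, norm_heis_apply]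

/-- Rapid decrease of the coefficients beats the polynomial growth of the seminorms of `heis (T ν)
f`. -/
theorem summable_schwartz (hW : IsWeylSystem θ T c) (a : SmoothTorus θ) (f : 𝓢(V4, ℂ)) :
    Summable fun ν => a.coeff ν • weylOp T c ν f := by
  refine _root_.summable_schwartz _ fun k n => ?_
  obtain ⟨C, hC0, hC⟩ := seminorm_heis_le k n f
  obtain ⟨K, hK0, hK⟩ := norm_map_lattice_le T
  refine Summable.of_nonneg_of_le (fun ν => apply_nonneg _ _) (fun ν => ?_)
    ((a.rapid (k + n)).mul_left (C * (1 + K) ^ (k + n)))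
  rw [weylOp_apply, seminorm_smul_complex, seminorm_smul_complex, hW.norm_eq_one, one_mul]
  calc _ ≤ ‖a.coeff ν‖ * (C * ((1 + K) * (1 + ‖ν‖)) ^ (k + n)) := by
        gcongr
        refine (hC _).trans ?_
        gcongr
        exact hK ν
    _ = _ := by rw [mul_pow]; ring

/-- The operator `∑ a_ν c ν heis (T ν)`. -/
def sumOp (hW : IsWeylSystem θ T c) (a : SmoothTorus θ) : Module.End ℂ 𝓢(V4, ℂ) where
  toFun f := ∑' ν, a.coeff ν • weylOp T c ν f
  map_add' f g := by
    rw [← (hW.summable_schwartz a f).tsum_add (hW.summable_schwartz a g)]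
    exact tsum_congr fun ν => by rw [map_add, smul_add]
  map_smul' r f := by
    rw [RingHom.id_apply, ← (hW.summable_schwartz a f).tsum_const_smul r]
    exact tsum_congr fun ν => by rw [map_smul, smul_comm]

theorem sumOp_hasSum (hW : IsWeylSystem θ T c) (a : SmoothTorus θ) (f : 𝓢(V4, ℂ)) :
    HasSum (fun ν => a.coeff ν • weylOp T c ν f) (hW.sumOp a f) :=
  (hW.summable_schwartz a f).hasSum

/-- The action of the smooth torus on Schwartz functions given by a Weyl system. -/
def action (hW : IsWeylSystem θ T c) : SmoothTorus θ →ₐ[ℂ] Module.End ℂ 𝓢(V4, ℂ) :=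
  AlgHom.ofLinearMap
    { toFun := hW.sumOp
      map_add' := fun a b => LinearMap.ext fun f => (hW.sumOp_hasSum (a + b) f).unique
        (((hW.sumOp_hasSum a f).add (hW.sumOp_hasSum b f)).congr_fun fun _ => by simp [add_smul])
      map_smul' := fun r a => LinearMap.ext fun f => (hW.sumOp_hasSum (r • a) f).unique
        (((hW.sumOp_hasSum a f).const_smul r).congr_fun fun _ => by simp [mul_smul]) }
    (by
      refine LinearMap.ext fun f => ?_
      change ∑' ν, _ = f
      rw [tsum_eq_single 0 fun ν hν => by rw [one_coeff_of_ne hν, zero_smul], one_coeff_zero,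
        one_smul, hW.weylOp_zero])
    (fun a b => by
      refine LinearMap.ext fun f => SchwartzMap.ext fun z => ?_
      change (∑' ν, (a * b).coeff ν • weylOp T c ν f : 𝓢(V4, ℂ)) z =
        (∑' m, a.coeff m • weylOp T c m (∑' n, b.coeff n • weylOp T c n f) : 𝓢(V4, ℂ)) z
      have h1 := ((hW.summable_schwartz (a * b) f).hasSum.schwartz_apply z).tsum_eq
      have h2 := ((hW.summable_schwartz a
        (∑' n, b.coeff n • weylOp T c n f)).hasSum.schwartz_apply z).tsum_eq
      rw [← h1, ← h2]
      -- Multiplicativity is tested at a point, where it becomes an exchange of two absolutely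
      -- convergent sums; `n` is the total lattice index and `m` the index of the left factor.
      have hs : Summable (Function.uncurry fun n m : ι → ℤ =>
          a.coeff m * b.coeff (n - m) * torusCocycle θ m (n - m) * weylOp T c n f z) := by
        refine Summable.of_norm_bounded ((summable_conv a.summable_norm b.summable_norm
          (fun _ => norm_nonneg _) (fun _ => norm_nonneg _)).mul_right
            (SchwartzMap.seminorm ℝ 0 0 f)) ?_
        rintro ⟨n, m⟩
        simp only [Function.uncurry_apply_pair, norm_mul, norm_torusCocycle, mul_one,
          hW.norm_weylOp_apply]
        gcongr
        exact SchwartzMap.norm_le_seminorm ℝ f _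
      have e1 : ∀ n, ((a * b).coeff n • weylOp T c n f) z = ∑' m, a.coeff m * b.coeff (n - m) *
          torusCocycle θ m (n - m) * weylOp T c n f z := fun n => by
        rw [tsum_mul_right]; rfl
      have e2 : ∀ m, (a.coeff m • weylOp T c m (∑' n, b.coeff n • weylOp T c n f)) z =
          ∑' n, a.coeff m * b.coeff (n - m) * torusCocycle θ m (n - m) * weylOp T c n f z :=
        fun m => by
          have h3 := (((hW.summable_schwartz b f).hasSum.mapL
            (weylOp T c m)).schwartz_apply z).tsum_eq
          rw [smul_apply, ← h3, smul_eq_mul, ← tsum_mul_left, ← (Equiv.subRight m).tsum_eq]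
          refine tsum_congr fun n => ?_
          simp only [Equiv.subRight_apply, map_smul, hW.weylOp_weylOp, smul_apply, smul_eq_mul,
            add_sub_cancel]
          ring
      simp only [e1, e2]
      exact hs.tsum_comm.symm)

theorem action_hasSum (hW : IsWeylSystem θ T c) (a : SmoothTorus θ) (f : 𝓢(V4, ℂ)) :
    HasSum (fun ν => a.coeff ν • weylOp T c ν f) (hW.action a f) :=
  hW.sumOp_hasSum a f

theorem action_U (hW : IsWeylSystem θ T c) (ν : ι → ℤ) (f : 𝓢(V4, ℂ)) :
    hW.action (U θ ν) f = weylOp T c ν f := by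
  refine (hW.action_hasSum (U θ ν) f).unique ?_
  have h : ∀ μ ≠ ν, (U θ ν).coeff μ • weylOp T c μ f = 0 := fun μ hμ => by
    have : (U θ ν).coeff μ = 0 := Pi.single_eq_of_ne hμ _
    rw [this, zero_smul]
  have h1 : (U θ ν).coeff ν = 1 := Pi.single_eq_same _ _
  simpa [h1] using hasSum_single ν h

end IsWeylSystem

/-- The untwisted case, with no integral correction. It is applied to the lattice dual to T(ℤ⁸),
where any torus will do. -/
theorem isWeylSystem_weylPhase (T : (ι → ℝ) →ₗ[ℝ] Phase)
    (h : ∀ v w, Omega (T v) (T w) = formOf θ v w) : IsWeylSystem θ T (weylPhase T) where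
  norm_eq_one := norm_weylPhase T
  map_zero := by simp [weylPhase, latticeVec_zero, linPhase_zero_left]
  mul m n := by rw [weylPhase_mul, h]; rfl

end WeylAction

/-! ### Fourier series of periodic functions and Poisson summation -/

section Fourier

open MeasureTheory

theorem isOpenQuotientMap_torus {κ : Type} :
    IsOpenQuotientMap fun (x : κ → ℝ) (i : κ) => (x i : UnitAddCircle) :=
  IsOpenQuotientMap.piMap fun _ => QuotientAddGroup.isOpenQuotientMap_mk

theorem exists_lattice_of_torus_eq {κ : Type} {x y : κ → ℝ}
    (h : (fun i => (x i : UnitAddCircle)) = fun i => (y i : UnitAddCircle)) :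
    ∃ l : κ → ℤ, y = x + latticeVec l := by
  have h1 : ∀ i, ∃ n : ℤ, (n : ℝ) = y i - x i := fun i => by
    have := congrFun h i
    have h2 : ((y i - x i : ℝ) : UnitAddCircle) = 0 := by
      rw [AddCircle.coe_sub, sub_eq_zero]; exact this.symm
    simpa using (AddCircle.coe_eq_zero_iff 1).mp h2
  choose l hl using h1
  exact ⟨l, by ext i; simp [latticeVec, hl]⟩

variable {ι : Type} [Fintype ι]

/-- The character `exp (2 π i ⟨k, x⟩)`. -/
def latticeChar (k : ι → ℤ) (x : ι → ℝ) : ℂ :=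
  Complex.exp (2 * Real.pi * Complex.I * (latticeVec k ⬝ᵥ x : ℝ))

theorem norm_latticeChar (k : ι → ℤ) (x : ι → ℝ) : ‖latticeChar k x‖ = 1 := norm_exp_real_mul _

theorem continuous_latticeChar (k : ι → ℤ) : Continuous (latticeChar k) := by
  unfold latticeChar dotProduct
  fun_prop

theorem latticeChar_add (k : ι → ℤ) (x y : ι → ℝ) :
    latticeChar k (x + y) = latticeChar k x * latticeChar k y := by
  rw [latticeChar, latticeChar, latticeChar, ← Complex.exp_add, dotProduct_add]
  congr 1
  push_cast
  ring

theorem latticeChar_lattice (k l : ι → ℤ) : latticeChar k (latticeVec l) = 1 := by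
  rw [latticeChar, Complex.exp_eq_one_iff]
  refine ⟨k ⬝ᵥ l, ?_⟩
  simp [latticeVec, dotProduct]
  ring

theorem latticeChar_neg (k : ι → ℤ) (x : ι → ℝ) :
    latticeChar (-k) x = starRingEnd ℂ (latticeChar k x) := by
  rw [latticeChar, latticeChar, conj_exp_real_mul, latticeVec_neg, neg_dotProduct]
  push_cast
  ring_nf

theorem mFourier_coe (k : ι → ℤ) (x : ι → ℝ) :
    UnitAddTorus.mFourier k (fun i => (x i : UnitAddCircle)) = latticeChar k x := by
  simp only [UnitAddTorus.mFourier, ContinuousMap.coe_mk, fourier_coe_apply, latticeChar,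
    dotProduct, latticeVec]
  rw [← Complex.exp_sum]
  congr 1
  push_cast
  rw [Finset.mul_sum]
  exact Finset.sum_congr rfl fun i _ => by ring

theorem setIntegral_Ioc_eq_Icc {E : Type*} [NormedAddCommGroup E] [NormedSpace ℝ E]
    (F : (ι → ℝ) → E) :
    ∫ x in {x : ι → ℝ | ∀ i, x i ∈ Set.Ioc (0 : ℝ) (0 + 1)}, F x = ∫ x in Set.Icc (0 : ι → ℝ) 1, F x := by
  have h : {x : ι → ℝ | ∀ i, x i ∈ Set.Ioc (0 : ℝ) (0 + 1)} =
      Set.pi Set.univ fun i => Set.Ioc ((0 : ι → ℝ) i) ((1 : ι → ℝ) i) := by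
    ext x; simp [Set.mem_pi]
  rw [h]
  exact setIntegral_congr_set Measure.univ_pi_Ioc_ae_eq_Icc

/-- A continuous `ℤ^ι`-periodic function with summable Fourier coefficients is the sum of its
Fourier series. -/
theorem hasSum_fourier_of_periodic {F : (ι → ℝ) → ℂ} (hF : Continuous F)
    (hp : ∀ x (l : ι → ℤ), F (x + latticeVec l) = F x)
    (hs : Summable fun k : ι → ℤ => ∫ x in Set.Icc (0 : ι → ℝ) 1, latticeChar (-k) x * F x)
    (x : ι → ℝ) :
    HasSum (fun k : ι → ℤ => (∫ y in Set.Icc (0 : ι → ℝ) 1, latticeChar (-k) y * F y) *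
      latticeChar k x) (F x) := by
  have hq := isOpenQuotientMap_torus (κ := ι)
  -- Composing with an arbitrary section is harmless because `F` is periodic; continuity on the
  -- torus then follows from the quotient topology.
  let G₀ : UnitAddTorus ι → ℂ := F ∘ Function.surjInv hq.surjective
  have hG : ∀ x : ι → ℝ, G₀ (fun i => (x i : UnitAddCircle)) = F x := fun x => by
    obtain ⟨l, hl⟩ := exists_lattice_of_torus_eq
      (Function.surjInv_eq hq.surjective (fun i => (x i : UnitAddCircle)))
    exact ((congrArg F hl).trans (hp _ l)).symm
  have hc : Continuous G₀ := by
    rw [hq.isQuotientMap.continuous_iff]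
    exact hF.congr fun x => (hG x).symm
  let G : C(UnitAddTorus ι, ℂ) := ⟨G₀, hc⟩
  have hcoeff : ∀ k, UnitAddTorus.mFourierCoeff G k =
      ∫ x in Set.Icc (0 : ι → ℝ) 1, latticeChar (-k) x * F x := fun k => by
    rw [UnitAddTorus.mFourierCoeff_eq_integral _ _ 0, ← setIntegral_Ioc_eq_Icc]
    simp only [mFourier_coe, smul_eq_mul, Pi.zero_apply]
    congr 1
    ext y
    rw [← hG y]
    rfl
  have := UnitAddTorus.hasSum_mFourier_series_apply_of_summable (f := G)
    (hs.congr fun k => (hcoeff k).symm) (fun i => (x i : UnitAddCircle))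
  simp only [hcoeff, mFourier_coe, smul_eq_mul] at this
  rwa [show G (fun i => (x i : UnitAddCircle)) = F x from hG x] at this

/-- Unfolding an integral over `ℝ^ι` to the unit cube. -/
theorem hasSum_integral_cube {E : Type*} [NormedAddCommGroup E] [NormedSpace ℝ E]
    {F : (ι → ℝ) → E} (hF : Integrable F) :
    HasSum (fun ν : ι → ℤ => ∫ x in Set.Icc (0 : ι → ℝ) 1, F (x + latticeVec ν)) (∫ x, F x) := by
  -- The fibres of `x ↦ ⌈x⌉ - 1` are the lattice translates of the half-open cube `(0, 1]`, which
  -- differs from the closed cube by a null set.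
  let p : (ι → ℝ) → ι → ℤ := fun x i => ⌈x i⌉ - 1
  have hp : Measurable p := measurable_pi_lambda _ fun i =>
    (Int.measurable_ceil.comp (measurable_pi_apply i)).sub_const 1
  have hu : (⋃ ν, p ⁻¹' {ν}) = Set.univ := by
    ext x; simp
  have h := hasSum_integral_iUnion (μ := volume) (f := F) (s := fun ν => p ⁻¹' {ν})
    (fun ν => hp (measurableSet_singleton ν))
    (fun ν μ h => Disjoint.preimage _ (by simpa using h)) (by rw [hu]; exact hF.integrableOn)
  rw [hu, setIntegral_univ] at h
  refine h.congr_fun fun ν => ?_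
  rw [← setIntegral_Ioc_eq_Icc]
  have := (measurePreserving_add_right (volume : Measure (ι → ℝ))
    (latticeVec ν)).setIntegral_preimage_emb (measurableEmbedding_addRight _) F (p ⁻¹' {ν})
  rw [← this]
  congr 2
  ext x
  simp only [Set.mem_ofPred_eq, Set.mem_preimage, Set.mem_singleton_iff, funext_iff, p,
    Pi.add_apply, latticeVec, Set.mem_Ioc, zero_add]
  refine forall_congr' fun i => ?_
  rw [Int.ceil_add_intCast]
  constructor
  · rintro ⟨h1, h2⟩
    have : ⌈x i⌉ = 1 := by rw [Int.ceil_eq_iff]; constructor <;> norm_num <;> assumption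
    omega
  · intro h
    have : ⌈x i⌉ = 1 := by omega
    rw [Int.ceil_eq_iff] at this
    norm_num at this
    exact this

theorem integrable_of_decay {F : (ι → ℝ) → ℂ} (hF : Continuous F) {C : ℝ}
    (hC : ∀ x, (1 + ‖x‖) ^ (Fintype.card ι + 1) * ‖F x‖ ≤ C) : Integrable F := by
  have h := integrable_one_add_norm (E := ι → ℝ) (μ := volume) (r := (Fintype.card ι + 1 : ℕ))
    (by simp)
  refine (h.const_mul C).mono' hF.aestronglyMeasurable (Filter.Eventually.of_forall fun x => ?_)
  have h0 : 0 < 1 + ‖x‖ := by positivity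
  rw [Real.rpow_neg h0.le, Real.rpow_natCast, ← div_eq_mul_inv, le_div_iff₀ (by positivity),
    mul_comm]
  exact hC x

/-- Peetre's inequality `1 + ‖ν‖ ≤ (1 + ‖x‖)(1 + ‖x + ν‖)`, uniform for `x` in a ball; this gives
locally uniform convergence of periodizations. -/
theorem norm_translate_le {F : (ι → ℝ) → ℂ} {C : ℝ} {n : ℕ}
    (hC : ∀ x, (1 + ‖x‖) ^ n * ‖F x‖ ≤ C) {R : ℝ} {x : ι → ℝ} (hx : ‖x‖ ≤ R) (ν : ι → ℤ) :
    ‖F (x + latticeVec ν)‖ ≤ (1 + R) ^ n * C * ((1 + ‖ν‖) ^ n)⁻¹ := by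
  have h1 : 1 + ‖ν‖ ≤ (1 + R) * (1 + ‖x + latticeVec ν‖) := by
    rw [← norm_latticeVec]
    have : ‖latticeVec ν‖ ≤ ‖x + latticeVec ν‖ + ‖x‖ := by
      simpa using norm_sub_le (x + latticeVec ν) x
    nlinarith [norm_nonneg x, norm_nonneg (x + latticeVec ν)]
  have hR : 0 ≤ 1 + R := by linarith [norm_nonneg x]
  rw [← div_eq_mul_inv, le_div_iff₀ (by positivity)]
  calc ‖F (x + latticeVec ν)‖ * (1 + ‖ν‖) ^ n
      ≤ ‖F (x + latticeVec ν)‖ * ((1 + R) * (1 + ‖x + latticeVec ν‖)) ^ n := by gcongr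
    _ = (1 + R) ^ n * ((1 + ‖x + latticeVec ν‖) ^ n * ‖F (x + latticeVec ν)‖) := by
      rw [mul_pow]; ring
    _ ≤ _ := by gcongr; exact hC _

theorem summable_translates {F : (ι → ℝ) → ℂ} {C : ℝ}
    (hC : ∀ x, (1 + ‖x‖) ^ (Fintype.card ι + 1) * ‖F x‖ ≤ C) (x : ι → ℝ) :
    Summable fun ν : ι → ℤ => F (x + latticeVec ν) :=
  Summable.of_norm_bounded (summable_lattice.mul_left _) fun ν => norm_translate_le hC le_rfl ν

theorem continuous_periodization {F : (ι → ℝ) → ℂ} (hF : Continuous F) {C : ℝ}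
    (hC : ∀ x, (1 + ‖x‖) ^ (Fintype.card ι + 1) * ‖F x‖ ≤ C) :
    Continuous fun x => ∑' ν : ι → ℤ, F (x + latticeVec ν) := by
  rw [continuous_iff_continuousAt]
  intro x
  have h : ContinuousOn (fun x => ∑' ν : ι → ℤ, F (x + latticeVec ν))
      (Metric.ball 0 (‖x‖ + 1)) :=
    continuousOn_tsum (fun ν => (by fun_prop : Continuous fun x => F (x + latticeVec ν)).continuousOn)
      (summable_lattice.mul_left _) fun ν y hy =>
        norm_translate_le hC (by simpa using (mem_ball_zero_iff.mp hy).le) ν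
  exact h.continuousAt (Metric.isOpen_ball.mem_nhds (by simp))

/-- The Poisson summation formula. -/
theorem hasSum_poisson {F : (ι → ℝ) → ℂ} (hF : Continuous F) {C : ℝ}
    (hC : ∀ x, (1 + ‖x‖) ^ (Fintype.card ι + 1) * ‖F x‖ ≤ C)
    (hs : Summable fun k : ι → ℤ => ∫ x, latticeChar (-k) x * F x) (x : ι → ℝ) :
    HasSum (fun k : ι → ℤ => (∫ y, latticeChar (-k) y * F y) * latticeChar k x)
      (∑' ν : ι → ℤ, F (x + latticeVec ν)) := by
  have hper : ∀ x (l : ι → ℤ), ∑' ν : ι → ℤ, F (x + latticeVec l + latticeVec ν) =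
      ∑' ν : ι → ℤ, F (x + latticeVec ν) := fun x l => by
    rw [← (Equiv.addLeft l).tsum_eq fun ν : ι → ℤ => F (x + latticeVec ν)]
    exact tsum_congr fun ν => by simp [latticeVec_add, add_assoc]
  -- The Fourier coefficients of a periodization unfold to integrals over the whole space, since the
  -- characters are periodic.
  have hcoeff : ∀ k : ι → ℤ, ∫ x in Set.Icc (0 : ι → ℝ) 1, latticeChar (-k) x *
      ∑' ν : ι → ℤ, F (x + latticeVec ν) = ∫ x, latticeChar (-k) x * F x := fun k => by
    have hc : Continuous fun x => latticeChar (-k) x * F x := (continuous_latticeChar _).mul hF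
    have hi : Integrable fun x => latticeChar (-k) x * F x :=
      integrable_of_decay hc (C := C) fun x => by
        rw [norm_mul, norm_latticeChar, one_mul]; exact hC x
    have h1 := hasSum_integral_cube hi
    have h2 := hasSum_integral_of_summable_integral_norm
      (μ := volume.restrict (Set.Icc (0 : ι → ℝ) 1))
      (F := fun (ν : ι → ℤ) x => latticeChar (-k) (x + latticeVec ν) * F (x + latticeVec ν))
      (fun ν => (hi.comp_add_right (latticeVec ν)).restrict)
      (hasSum_integral_cube hi.norm).summable
    rw [h1.unique h2]
    congr 1
    ext y
    rw [← tsum_mul_left]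
    exact tsum_congr fun ν => by rw [latticeChar_add, latticeChar_lattice, mul_one]
  have := hasSum_fourier_of_periodic (continuous_periodization hF hC) hper
    (hs.congr fun k => (hcoeff k).symm) x
  simpa only [hcoeff] using this

end Fourier

/-! ### Duality between sums over T(ℤ⁸) and over its symplectic dual lattice -/

section Janssen

open MeasureTheory

/-- `V4` carries the sup norm, so inversion is imported from Euclidean space along the
measure-preserving identification. -/
theorem fourier_inversion_V4 (K : 𝓢(V4, ℂ)) (w : V4) :
    ∫ y, Complex.exp (linPhase y w) * ∫ t, Complex.exp (-linPhase y t) * K t = K w := by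
  let K' : 𝓢(EuclideanSpace ℝ (Fin 4), ℂ) :=
    SchwartzMap.compCLMOfContinuousLinearEquiv ℂ (EuclideanSpace.equiv (Fin 4) ℝ) K
  have hmp := PiLp.volume_preserving_toLp (Fin 4)
  have hme := (MeasurableEquiv.toLp 2 (Fin 4 → ℝ)).measurableEmbedding
  have hin : ∀ u v : V4, inner ℝ (WithLp.toLp 2 u : EuclideanSpace ℝ (Fin 4)) (WithLp.toLp 2 v) =
      v ⬝ᵥ u := fun u v => by
    simp [PiLp.inner_apply, dotProduct]
  have hF : ∀ y : V4, (FourierTransform.fourier K') (WithLp.toLp 2 y) =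
      ∫ t, Complex.exp (-linPhase y t) * K t := fun y => by
    rw [SchwartzMap.fourier_coe, Real.fourier_eq', ← hmp.integral_comp hme]
    congr 1
    ext t
    refine congrArg₂ (· * ·) (congrArg Complex.exp ?_) rfl
    rw [hin, linPhase]
    push_cast
    ring
  have h : FourierTransformInv.fourierInv (FourierTransform.fourier K') (WithLp.toLp 2 w) = K w := by
    rw [FourierTransform.fourierInv_fourier_eq]
    rfl
  rw [← h, SchwartzMap.fourierInv_coe, Real.fourierInv_eq', ← hmp.integral_comp hme]
  congr 1
  ext y
  rw [hF, smul_eq_mul]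
  congr 2
  rw [hin, linPhase, dotProduct_comm]
  push_cast
  ring

theorem continuous_innerS_heis (f g : 𝓢(V4, ℂ)) : Continuous fun v => innerS f (heis v g) := by
  refine continuous_of_dominated (bound := fun z => ‖f z‖ * SchwartzMap.seminorm ℝ 0 0 g)
    (fun v => (innerS_integrable f (heis v g)).aestronglyMeasurable)
    (fun v => Filter.Eventually.of_forall fun z => ?_) (f.integrable.norm.mul_const _)
    (Filter.Eventually.of_forall fun z => ?_)
  · rw [norm_mul, RCLike.norm_conj, norm_heis_apply]
    gcongr
    exact SchwartzMap.norm_le_seminorm ℝ g _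
  · simp only [heis_apply, linPhase, dotProduct]
    fun_prop

theorem continuous_heis_apply (h : 𝓢(V4, ℂ)) (z : V4) : Continuous fun v => heis v h z := by
  simp only [heis_apply, linPhase, dotProduct]
  fun_prop

variable {T V : V8 →ₗ[ℝ] Phase}

theorem Omega_dual_single (hVT : ∀ γ w, Omega (V γ) (T w) = γ ⬝ᵥ w) (i : Fin 4 ⊕ Fin 4) (x : V8) :
    Omega (V (Pi.single i 1)) (T x) = x i := by
  rw [hVT, single_one_dotProduct]

theorem injective_of_dual (hVT : ∀ γ w, Omega (V γ) (T w) = γ ⬝ᵥ w) : Function.Injective T := by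
  rw [injective_iff_map_eq_zero]
  intro x hx
  ext i
  rw [← Omega_dual_single hVT i x, hx]
  simp [Omega]

theorem bijective_of_injective {L : V8 →ₗ[ℝ] Phase} (h : Function.Injective L) :
    Function.Bijective L :=
  ⟨h, (LinearMap.injective_iff_surjective_of_finrank_eq_finrank (by simp)).mp h⟩

/-- Change of variables along a linear isomorphism `ℝ⁸ ≃ ℝ⁴ ⊕ ℝ⁴`. -/
theorem exists_jacobian (hT : Function.Bijective T) :
    ∃ c : ℝ, 0 < c ∧ ∀ φ : Phase → ℂ, ∫ x, φ (T x) = c * ∫ p, φ p ∧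
      (Integrable (fun x => φ (T x)) → Integrable φ) := by
  let e := (LinearEquiv.ofBijective T hT).toContinuousLinearEquiv
  let μ : Measure Phase := (volume : Measure V8).map e
  have : (volume : Measure Phase).IsAddHaarMeasure :=
    Measure.prod.instIsAddHaarMeasure (volume : Measure V4) (volume : Measure V4)
  -- The image of Lebesgue measure is again a Haar measure, hence a positive multiple of Lebesgue
  -- measure. Only the positivity of the factor matters.
  have : μ.IsAddHaarMeasure := e.isAddHaarMeasure_map volume
  have hμ : μ = (μ.addHaarScalarFactor volume) • (volume : Measure Phase) :=
    Measure.isAddLeftInvariant_eq_smul μ volume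
  have hpos : 0 < μ.addHaarScalarFactor (volume : Measure Phase) :=
    Measure.addHaarScalarFactor_pos_of_isAddHaarMeasure μ volume
  have hme : MeasurableEmbedding e := e.toHomeomorph.measurableEmbedding
  generalize μ.addHaarScalarFactor (volume : Measure Phase) = r at hμ hpos
  refine ⟨r, hpos, fun φ => ⟨?_, fun h => ?_⟩⟩
  · have h1 : ∫ x, φ (T x) = ∫ p, φ p ∂μ := (hme.integral_map φ).symm
    rw [h1, hμ, integral_smul_nnreal_measure]
    rfl
  · have h1 : Integrable φ μ := hme.integrable_map_iff.mpr h
    rw [hμ] at h1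
    have := h1.smul_measure_nnreal (c := r⁻¹)
    rwa [smul_smul, inv_mul_cancel₀ hpos.ne', one_smul] at this

/-- The symplectic Fourier transform exchanges `f` and `h`. Integrating over the momentum first is
Fourier inversion, which evaluates the product of `f` and the conjugate of `g` at one point; the
remaining position integral is a matrix coefficient of `h` and `g`. -/
theorem integral_symplectic_fourier (f g h : 𝓢(V4, ℂ)) (z : V4) (u : Phase)
    (hi : Integrable fun p => Complex.exp (-(2 * Real.pi * Complex.I * (Omega u p : ℝ))) *
      (innerS f (heis p g) * heis p h z)) :
    ∫ p, Complex.exp (-(2 * Real.pi * Complex.I * (Omega u p : ℝ))) *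
      (innerS f (heis p g) * heis p h z) = innerS h (heis (-u) g) * heis (-u) f z := by
  rw [Measure.volume_eq_prod] at hi ⊢
  rw [integral_prod _ hi]
  -- Here the inverse transform of `t ↦ f(t) conj g(t + x)` is evaluated at `z - u.1`.
  have hinner : ∀ x : V4, ∫ y : V4, Complex.exp (-(2 * Real.pi * Complex.I * (Omega u (x, y) : ℝ))) *
      (innerS f (heis (x, y) g) * heis (x, y) h z) =
      Complex.exp (linPhase u.2 x) * h (z + x) * (f (z - u.1) * starRingEnd ℂ (g (z - u.1 + x))) := by
    intro x
    let K := mulSchwartz f (conjSchwartz (heis (x, 0) g))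
    have hK : ∀ t, K t = f t * starRingEnd ℂ (g (t + x)) := fun t => by
      rw [mulSchwartz_apply, conjSchwartz_apply, heis_apply]
      simp [linPhase_zero_left]
    rw [← hK, ← fourier_inversion_V4 K, ← integral_const_mul]
    congr 1
    ext y
    have h1 : innerS f (heis (x, y) g) = ∫ t, Complex.exp (-linPhase y t) * K t := by
      rw [innerS]
      congr 1
      ext t
      rw [heis_apply, map_mul, conj_exp_linPhase, hK]
      ring
    have h2 : Complex.exp (-(2 * Real.pi * Complex.I * (Omega u (x, y) : ℝ))) *
        Complex.exp (linPhase y z) =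
        Complex.exp (linPhase u.2 x) * Complex.exp (linPhase y (z - u.1)) := by
      rw [← Complex.exp_add, ← Complex.exp_add]
      congr 1
      simp [Omega, linPhase, dotProduct_sub]
      ring
    rw [h1, heis_apply]
    calc _ = (Complex.exp (-(2 * Real.pi * Complex.I * (Omega u (x, y) : ℝ))) *
        Complex.exp (linPhase y z)) * h (z + x) * ∫ t, Complex.exp (-linPhase y t) * K t := by ring
      _ = _ := by rw [h2]; ring
  simp only [hinner]
  rw [heis_apply, innerS, ← integral_mul_const]
  -- The substitution `s = z + x` makes the integrand that of `innerS h (heis (-u) g)`.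
  rw [← integral_add_left_eq_self (μ := volume) (fun s => h s * starRingEnd ℂ (heis (-u) g s) *
    (Complex.exp (linPhase (-u).2 z) * f (z + (-u).1))) z]
  congr 1
  ext x
  have h3 : Complex.exp (linPhase u.2 (z + x)) * Complex.exp (-linPhase u.2 z) =
      Complex.exp (linPhase u.2 x) := by
    rw [← Complex.exp_add, linPhase_add_right]; congr 1; ring
  rw [heis_apply, map_mul, conj_exp_linPhase, Prod.snd_neg, Prod.fst_neg, linPhase_neg_left,
    linPhase_neg_left, neg_neg, ← h3, ← sub_eq_add_neg, ← sub_eq_add_neg,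
    show z + x - u.1 = z - u.1 + x by abel]
  ring

/-- The fundamental identity of Gabor analysis, relating sums over the lattice `T(ℤ⁸)` and its
symplectic dual `V(ℤ⁸)`. -/
theorem exists_hasSum_dual_lattice (hVT : ∀ γ w, Omega (V γ) (T w) = γ ⬝ᵥ w) :
    ∃ c : ℝ, 0 < c ∧ ∀ (f g h : 𝓢(V4, ℂ)) (z : V4),
      HasSum (fun k => innerS h (heis (V (latticeVec k)) g) * heis (V (latticeVec k)) f z)
        (c * ∑' ν, innerS f (heis (T (latticeVec ν)) g) * heis (T (latticeVec ν)) h z) := by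
  obtain ⟨J, hJ, hint⟩ := exists_jacobian (bijective_of_injective (injective_of_dual hVT))
  refine ⟨J⁻¹, inv_pos.mpr hJ, fun f g h z => ?_⟩
  obtain ⟨C, hC0, hC⟩ := innerS_heis_decay T (fun i => V (Pi.single i 1))
    (Omega_dual_single hVT) (Fintype.card (Fin 4 ⊕ Fin 4) + 1) f g
  have hTV : ∀ γ w, Omega (T γ) (V w) = -(γ ⬝ᵥ w) := fun γ w => by
    rw [Omega_swap, hVT, dotProduct_comm]
  let F : V8 → ℂ := fun x => innerS f (heis (T x) g) * heis (T x) h z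
  have hTc : Continuous T := T.continuous_of_finiteDimensional
  have hFc : Continuous F := ((continuous_innerS_heis f g).comp hTc).mul
    ((continuous_heis_apply h z).comp hTc)
  have hFC : ∀ x, (1 + ‖x‖) ^ (Fintype.card (Fin 4 ⊕ Fin 4) + 1) * ‖F x‖ ≤
      C * SchwartzMap.seminorm ℝ 0 0 h := fun x => by
    rw [norm_mul, ← mul_assoc]
    refine mul_le_mul (hC x) ?_ (norm_nonneg _) hC0
    rw [norm_heis_apply]
    exact SchwartzMap.norm_le_seminorm ℝ h _
  -- A character of ℝ⁸ is exp(2πiΩ(V k, T x)), so after the change of variables `p = T x` the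
  -- Fourier coefficient is a symplectic Fourier transform.
  have hcoeff : ∀ k : Fin 4 ⊕ Fin 4 → ℤ, ∫ x, latticeChar (-k) x * F x =
      J * (innerS h (heis (V (latticeVec (-k))) g) * heis (V (latticeVec (-k))) f z) := fun k => by
    obtain ⟨h1, h2⟩ := hint fun p => Complex.exp (-(2 * Real.pi * Complex.I *
      (Omega (V (latticeVec k)) p : ℝ))) * (innerS f (heis p g) * heis p h z)
    have e1 : (fun x => Complex.exp (-(2 * Real.pi * Complex.I *
        (Omega (V (latticeVec k)) (T x) : ℝ))) * (innerS f (heis (T x) g) * heis (T x) h z)) =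
        fun x => latticeChar (-k) x * F x := by
      ext x
      rw [hVT, latticeChar, latticeVec_neg, neg_dotProduct]
      push_cast
      rw [mul_neg]
    rw [e1] at h1 h2
    have h3 : Integrable fun x => latticeChar (-k) x * F x :=
      integrable_of_decay ((continuous_latticeChar _).mul hFc) fun x => by
        rw [norm_mul, norm_latticeChar, one_mul]; exact hFC x
    rw [h1, integral_symplectic_fourier f g h z _ (h2 h3), latticeVec_neg, map_neg]
  -- Poisson summation needs summable coefficients. The roles of `T` and `V` are symmetric up to
  -- sign, so the decay estimate also applies along the dual lattice.
  have hdual : Summable fun k => innerS h (heis (V (latticeVec k)) g) *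
      heis (V (latticeVec k)) f z := by
    obtain ⟨D, hD0, hD⟩ := innerS_heis_decay V (fun i => -T (Pi.single i 1))
      (fun i x => by rw [Omega_neg_left, hTV, neg_neg, single_one_dotProduct])
      (Fintype.card (Fin 4 ⊕ Fin 4) + 1) h g
    refine Summable.of_norm_bounded (summable_lattice.mul_left (D * SchwartzMap.seminorm ℝ 0 0 f))
      fun k => ?_
    rw [← div_eq_mul_inv, le_div_iff₀ (by positivity), norm_mul, norm_heis_apply]
    have h1 := hD (latticeVec k)
    rw [norm_latticeVec] at h1
    have h2 := SchwartzMap.norm_le_seminorm ℝ f (z + (V (latticeVec k)).1)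
    calc _ = ((1 + ‖k‖) ^ (Fintype.card (Fin 4 ⊕ Fin 4) + 1) *
          ‖innerS h (heis (V (latticeVec k)) g)‖) * ‖f (z + (V (latticeVec k)).1)‖ := by ring
      _ ≤ _ := mul_le_mul h1 h2 (norm_nonneg _) hD0
  have hneg := ((Equiv.neg (Fin 4 ⊕ Fin 4 → ℤ)).summable_iff.mpr hdual).mul_left (J : ℂ)
  have hP := hasSum_poisson hFc hFC (hneg.congr fun k => (hcoeff k).symm) 0
  have hJ' : (J : ℂ) ≠ 0 := by exact_mod_cast hJ.ne'
  have h4 := ((Equiv.neg (Fin 4 ⊕ Fin 4 → ℤ)).hasSum_iff.mpr (hP.mul_left ((J : ℂ)⁻¹)))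
  simp only [zero_add] at h4
  rw [Complex.ofReal_inv]
  refine h4.congr_fun fun k => ?_
  have h0 : latticeChar (-k) (0 : V8) = 1 := by simp [latticeChar]
  simp only [Function.comp_apply, Equiv.neg_apply, hcoeff, h0, mul_one, neg_neg]
  rw [inv_mul_cancel_left₀ hJ']

end Janssen

/-! ### The torus-valued inner product -/

section TorusInner

variable {ι : Type} [Fintype ι] {θ : Matrix ι ι ℝ} {T : (ι → ℝ) →ₗ[ℝ] Phase}
  {c : (ι → ℤ) → ℂ}

theorem HasSum.innerS_left {β : Type*} {g : β → 𝓢(V4, ℂ)} {G : 𝓢(V4, ℂ)} (h : HasSum g G)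
    (f : 𝓢(V4, ℂ)) : HasSum (fun b => innerS (g b) f) (innerS G f) := by
  have key : ∀ u, (SchwartzMap.integralCLM ℂ MeasureTheory.volume ∘L
      SchwartzMap.smulLeftCLM ℂ (conjSchwartz f)) u = innerS u f := fun u => by
    rw [ContinuousLinearMap.comp_apply, SchwartzMap.integralCLM_apply, innerS]
    congr 1
    ext z
    rw [SchwartzMap.smulLeftCLM_apply_apply (conjSchwartz f).hasTemperateGrowth,
      conjSchwartz_apply, smul_eq_mul, mul_comm]
  simpa only [key] using h.mapL (SchwartzMap.integralCLM ℂ MeasureTheory.volume ∘L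
      SchwartzMap.smulLeftCLM ℂ (conjSchwartz f))

namespace IsWeylSystem

theorem mul_conj_phase (hW : IsWeylSystem θ T c) (ν : ι → ℤ) : starRingEnd ℂ (c ν) * c ν = 1 := by
  rw [mul_comm, Complex.mul_conj, Complex.normSq_eq_norm_sq, hW.norm_eq_one]
  simp

theorem innerS_weylOp_weylOp (hW : IsWeylSystem θ T c) (ν : ι → ℤ) (f g : 𝓢(V4, ℂ)) :
    innerS (weylOp T c ν f) (weylOp T c ν g) = innerS f g := by
  rw [weylOp_apply, weylOp_apply, innerS_smul_left, innerS_smul_right, innerS_heis_heis,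
    ← mul_assoc, mul_comm (c ν), hW.mul_conj_phase, one_mul]

theorem norm_innerS_weylOp (hW : IsWeylSystem θ T c) (ν : ι → ℤ) (f g : 𝓢(V4, ℂ)) :
    ‖innerS f (weylOp T c ν g)‖ = ‖innerS f (heis (T (latticeVec ν)) g)‖ := by
  rw [weylOp_apply, innerS_smul_right, norm_mul, RCLike.norm_conj, hW.norm_eq_one, one_mul]

variable [DecidableEq ι]

/-- The torus-valued inner product, with coefficients `∫ f conj (U_ν g)`. -/
def ip (hW : IsWeylSystem θ T c) (M : ι → Phase) (hM : ∀ i x, Omega (M i) (T x) = x i)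
    (f g : 𝓢(V4, ℂ)) : SmoothTorus θ where
  coeff ν := innerS f (weylOp T c ν g)
  rapid := rapid_of_decay fun k => by
    obtain ⟨C, -, hC⟩ := innerS_heis_decay T M hM k f g
    refine ⟨C, fun ν => ?_⟩
    rw [hW.norm_innerS_weylOp, ← norm_latticeVec]
    exact hC _

variable (hW : IsWeylSystem θ T c) {M : ι → Phase} (hM : ∀ i x, Omega (M i) (T x) = x i)

theorem ip_add_left (f f' g : 𝓢(V4, ℂ)) :
    hW.ip M hM (f + f') g = hW.ip M hM f g + hW.ip M hM f' g :=
  SmoothTorus.ext (funext fun _ => innerS_add_left _ _ _)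

/-- The operators of a Weyl system are unitary and `U_ν` is, up to the conjugate cocycle, `U_m
U_{ν-m}`; cancelling `U_m` on both sides of the pairing leaves the convolution formula. -/
theorem ip_smul_left (a : SmoothTorus θ) (f g : 𝓢(V4, ℂ)) :
    hW.ip M hM (hW.action a f) g = a * hW.ip M hM f g := by
  ext ν
  refine (((hW.action_hasSum a f).innerS_left (weylOp T c ν g)).tsum_eq).symm.trans ?_
  rw [mul_coeff]
  refine tsum_congr fun m => ?_
  have h := hW.weylOp_weylOp m (ν - m) g
  rw [add_sub_cancel] at h
  have h1 : starRingEnd ℂ (torusCocycle θ m (ν - m)) * torusCocycle θ m (ν - m) = 1 := by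
    rw [mul_comm, Complex.mul_conj, Complex.normSq_eq_norm_sq, norm_torusCocycle]
    simp
  have h2 : weylOp T c ν g = starRingEnd ℂ (torusCocycle θ m (ν - m)) •
      weylOp T c m (weylOp T c (ν - m) g) := by
    rw [h, smul_smul, h1, one_smul]
  rw [h2, innerS_smul_left, innerS_smul_right, hW.innerS_weylOp_weylOp, Complex.conj_conj]
  change _ = a.coeff m * innerS f (weylOp T c (ν - m) g) * _
  ring

/-- `⟨f, g⟩ h`, as a sum over the lattice of the Heisenberg operators. -/
theorem action_ip_apply (f g h : 𝓢(V4, ℂ)) (z : V4) :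
    hW.action (hW.ip M hM f g) h z = ∑' ν : ι → ℤ, innerS f (heis (T (latticeVec ν)) g) *
      heis (T (latticeVec ν)) h z := by
  rw [← ((hW.action_hasSum (hW.ip M hM f g) h).schwartz_apply z).tsum_eq]
  refine tsum_congr fun ν => ?_
  change innerS f (weylOp T c ν g) * (c ν * heis (T (latticeVec ν)) h z) = _
  rw [weylOp_apply, innerS_smul_right]
  -- The phase of `U_ν` enters once conjugated and once not, so it drops out.
  linear_combination (innerS f (heis (T (latticeVec ν)) g) * heis (T (latticeVec ν)) h z) *
    hW.mul_conj_phase ν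

end IsWeylSystem

end TorusInner

/-! ### Gabor frames and finite projectivity -/

section Frames

/-- Lets the dual lattice act through some smooth torus; which form appears is irrelevant, only that
it is skew. -/
theorem exists_form (L : V8 →ₗ[ℝ] Phase) : ∃ θ : Matrix (Fin 4 ⊕ Fin 4) (Fin 4 ⊕ Fin 4) ℝ,
    θᵀ = -θ ∧ ∀ v w, Omega (L v) (L w) = formOf θ v w := by
  let B : V8 →ₗ[ℝ] V8 →ₗ[ℝ] ℝ := LinearMap.mk₂ ℝ (fun v w => Omega (L v) (L w))
    (fun u v w => by rw [map_add, Omega_add_left]) (fun r v w => by rw [map_smul, Omega_smul_left]; rfl)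
    (fun u v w => by rw [map_add, Omega_add_right]) (fun r v w => by rw [map_smul, Omega_smul_right]; rfl)
  refine ⟨LinearMap.toMatrix₂' ℝ B, ?_, fun v w => ?_⟩
  · ext i j
    simp only [Matrix.transpose_apply, Matrix.neg_apply, LinearMap.toMatrix₂'_apply]
    exact Omega_swap _ _
  · rw [formOf, ← Matrix.toLinearMap₂'_apply', Matrix.toLinearMap₂'_toMatrix']
    rfl

theorem sum_root_of_unity {N : ℕ} (hN : N ≠ 0) (k : ℤ) :
    ∑ a : Fin N, Complex.exp (-(2 * Real.pi * Complex.I * (k * ((a : ℕ) / N) : ℝ))) =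
      if (N : ℤ) ∣ k then (N : ℂ) else 0 := by
  have hN' : (N : ℂ) ≠ 0 := by exact_mod_cast hN
  let x := Complex.exp (2 * Real.pi * Complex.I * (-k / N))
  have h1 : ∀ a : Fin N, Complex.exp (-(2 * Real.pi * Complex.I * (k * ((a : ℕ) / N) : ℝ))) =
      x ^ (a : ℕ) := fun a => by
    rw [← Complex.exp_nat_mul]
    congr 1
    push_cast
    ring
  simp only [h1]
  rw [Fin.sum_univ_eq_sum_range (fun a => x ^ a) N]
  have hx1 : x = 1 ↔ (N : ℤ) ∣ k := by
    rw [Complex.exp_eq_one_iff]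
    constructor
    · rintro ⟨n, hn⟩
      have h2 : (-k / N : ℂ) = n := by
        have h3 : (2 * Real.pi * Complex.I : ℂ) ≠ 0 := Complex.two_pi_I_ne_zero
        apply mul_left_cancel₀ h3
        rw [hn]; ring
      rw [div_eq_iff hN'] at h2
      refine ⟨-n, ?_⟩
      have h4 : (k : ℂ) = ((N * -n : ℤ) : ℂ) := by
        push_cast; linear_combination -h2
      exact_mod_cast h4
    · rintro ⟨n, rfl⟩
      refine ⟨-n, ?_⟩
      push_cast
      field_simp
  split_ifs with h
  · rw [hx1.mpr h]; simp
  · have hxN : x ^ N = 1 := by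
      rw [← Complex.exp_nat_mul, Complex.exp_eq_one_iff]
      refine ⟨-k, ?_⟩
      push_cast
      field_simp
    have hx : x ≠ 1 := fun h' => h (hx1.mp h')
    rw [geom_sum_eq hx, hxN, sub_self, zero_div]

/-- The points of `(1/N) ℤ⁸` in the unit cube. -/
def fractionVec {N : ℕ} (j : Fin 4 ⊕ Fin 4 → Fin N) : V8 := fun i => ((j i : ℕ) : ℝ) / N

/-- Orthogonality of characters of (ℤ/N)⁸: the sum factors into eight geometric sums over roots of
unity. -/
theorem sum_latticeChar_fractionVec {N : ℕ} (hN : N ≠ 0) (k : Fin 4 ⊕ Fin 4 → ℤ) :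
    ∑ j : Fin 4 ⊕ Fin 4 → Fin N, starRingEnd ℂ (latticeChar k (fractionVec j)) =
      if ∀ i, (N : ℤ) ∣ k i then (N : ℂ) ^ 8 else 0 := by
  have h1 : ∀ j : Fin 4 ⊕ Fin 4 → Fin N, starRingEnd ℂ (latticeChar k (fractionVec j)) =
      ∏ i, Complex.exp (-(2 * Real.pi * Complex.I * (k i * (((j i : Fin N) : ℕ) / N) : ℝ))) :=
    fun j => by
      rw [latticeChar, conj_exp_real_mul, ← Complex.exp_sum, Finset.sum_neg_distrib,
        ← Finset.mul_sum, dotProduct]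
      congr 2
      push_cast
      refine congrArg _ (Finset.sum_congr rfl fun i _ => ?_)
      simp [latticeVec, fractionVec]
  simp only [h1]
  rw [← Fintype.piFinset_univ, Finset.sum_prod_piFinset Finset.univ (fun i (a : Fin N) =>
    Complex.exp (-(2 * Real.pi * Complex.I * (k i * ((a : ℕ) / N) : ℝ))))]
  simp only [sum_root_of_unity hN]
  split_ifs with h
  · rw [Finset.prod_congr rfl fun i _ => if_pos (h i)]
    simp
  · push Not at h
    obtain ⟨i, hi⟩ := h
    exact Finset.prod_eq_zero (Finset.mem_univ i) (if_neg hi)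

theorem exists_schwartz_ne_zero : ∃ g : 𝓢(V4, ℂ), g ≠ 0 := by
  obtain ⟨f, hf1, hf2, hf3, -, hf5⟩ := exists_contDiff_tsupport_subset (E := V4) (n := ⊤)
    (Filter.univ_mem (f := 𝓝 (0 : V4)))
  let F : V4 → ℂ := fun z => (f z : ℂ)
  have hc : HasCompactSupport F := hf2.comp_left (g := fun t : ℝ => (t : ℂ)) (by simp)
  have hd : ContDiff ℝ ∞ F := Complex.ofRealCLM.contDiff.comp hf3
  refine ⟨hc.toSchwartzMap hd, fun h => ?_⟩
  have := congrArg (fun G : 𝓢(V4, ℂ) => G 0) h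
  simp [F, hf5] at this

/-- Translating the window by `u` changes its matrix coefficient at `v` only by a character of `v`,
so many translates can be averaged to kill unwanted dual points. -/
theorem innerS_window (u v : Phase) (g : 𝓢(V4, ℂ)) :
    innerS (heis u g) (heis v (heis u g)) =
      starRingEnd ℂ (Complex.exp (2 * Real.pi * Complex.I * (Omega v u : ℝ))) *
        innerS g (heis v g) := by
  rw [heis_comm, innerS_smul_right, innerS_heis_heis]

/-- The decay exponent is taken one larger than summability needs. Since `‖m‖ ≥ 1` for `m ≠ 0`, the
spare power gains a factor 1/N in the whole off-diagonal sum. -/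
theorem exists_dense_scale {V : V8 →ₗ[ℝ] Phase} (M : Fin 4 ⊕ Fin 4 → Phase)
    (hM : ∀ i x, Omega (M i) (V x) = x i) (g : 𝓢(V4, ℂ)) {ε : ℝ} (hε : 0 < ε) :
    ∃ N : ℕ, N ≠ 0 ∧ ∃ b : (Fin 4 ⊕ Fin 4 → ℤ) → ℝ, Summable b ∧ ∑' m, b m < ε ∧
      (∀ m, 0 ≤ b m) ∧ ∀ m ≠ 0, ‖innerS g (heis (V ((N : ℝ) • latticeVec m)) g)‖ ≤ b m := by
  obtain ⟨C, hC0, hC⟩ := innerS_heis_decay V M hM (Fintype.card (Fin 4 ⊕ Fin 4) + 1 + 1) g g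
  let s : (Fin 4 ⊕ Fin 4 → ℤ) → ℝ := fun m => ((1 + ‖m‖) ^ (Fintype.card (Fin 4 ⊕ Fin 4) + 1))⁻¹
  have hs : Summable s := summable_lattice
  -- The second bound makes the sum of `C / N * s m` less than `ε`; the first one gives `N > 1`,
  -- used to compare `1 + ‖m‖` with `1 + N‖m‖`.
  obtain ⟨N, hN⟩ := exists_nat_gt (max 1 (C * (∑' m, s m) / ε))
  have hN1 : (1 : ℝ) < N := (le_max_left _ _).trans_lt hN
  have hN0 : (0 : ℝ) < N := by linarith
  refine ⟨N, by exact_mod_cast hN0.ne', fun m => C / N * s m, hs.mul_left _, ?_,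
    fun m => by positivity, fun m hm => ?_⟩
  · rw [tsum_mul_left, div_mul_eq_mul_div, div_lt_iff₀ hN0]
    have := (le_max_right _ _).trans_lt hN
    rw [div_lt_iff₀ hε] at this
    linarith
  · have h1 := hC ((N : ℝ) • latticeVec m)
    rw [norm_smul, norm_latticeVec, Real.norm_of_nonneg hN0.le] at h1
    have hm1 : 1 ≤ ‖m‖ := by
      obtain ⟨i, hi⟩ := Function.ne_iff.mp hm
      refine le_trans ?_ (norm_le_pi_norm m i)
      rw [Int.norm_eq_abs]
      exact_mod_cast Int.one_le_abs hi
    have h2 : N * (1 + ‖m‖) ^ (Fintype.card (Fin 4 ⊕ Fin 4) + 1) ≤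
        (1 + N * ‖m‖) ^ (Fintype.card (Fin 4 ⊕ Fin 4) + 1 + 1) := by
      rw [pow_succ' (1 + (N : ℝ) * ‖m‖)]
      gcongr
      · nlinarith
      · nlinarith
    change _ ≤ C / N * s m
    rw [div_mul_eq_mul_div, le_div_iff₀ hN0, ← div_eq_mul_inv, le_div_iff₀ (by positivity)]
    refine le_trans ?_ h1
    calc _ = N * (1 + ‖m‖) ^ (Fintype.card (Fin 4 ⊕ Fin 4) + 1) *
          ‖innerS g (heis (V ((N : ℝ) • latticeVec m)) g)‖ := by ring
      _ ≤ _ := by gcongr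

variable {θ : Matrix (Fin 4 ⊕ Fin 4) (Fin 4 ⊕ Fin 4) ℝ} {T V : V8 →ₗ[ℝ] Phase}
  {c : (Fin 4 ⊕ Fin 4 → ℤ) → ℂ}

/-- The frame operator `f ↦ ∑ ⟨f, g_j⟩ g_j`. -/
def IsWeylSystem.frameOp {J : Type} [Fintype J] (hW : IsWeylSystem θ T c)
    {M : Fin 4 ⊕ Fin 4 → Phase} (hM : ∀ i x, Omega (M i) (T x) = x i) (g : J → 𝓢(V4, ℂ))
    (f : 𝓢(V4, ℂ)) : 𝓢(V4, ℂ) :=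
  ∑ j, hW.action (hW.ip M hM f (g j)) (g j)

/-- The frame operator of the translates of `g` along `(1/N) T(ℤ⁸)` is a sum of Heisenberg operators
over the lattice `N V(ℤ⁸)`. -/
theorem hasSum_frameOp (hVT : ∀ γ w, Omega (V γ) (T w) = γ ⬝ᵥ w) (hW : IsWeylSystem θ T c)
    {M : Fin 4 ⊕ Fin 4 → Phase} (hM : ∀ i x, Omega (M i) (T x) = x i) :
    ∃ r : ℝ, 0 < r ∧ ∀ (g : 𝓢(V4, ℂ)) (N : ℕ), N ≠ 0 → ∀ (f : 𝓢(V4, ℂ)) (z : V4),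
      HasSum (fun m => (N : ℂ) ^ 8 * innerS g (heis (V ((N : ℝ) • latticeVec m)) g) *
        heis (V ((N : ℝ) • latticeVec m)) f z)
        (r * hW.frameOp hM (fun j : Fin 4 ⊕ Fin 4 → Fin N => heis (T (fractionVec j)) g) f z) := by
  obtain ⟨r, hr, H⟩ := exists_hasSum_dual_lattice hVT
  refine ⟨r, hr, fun g N hN f z => ?_⟩
  -- The duality formula is used with the same translate in the roles of `g` and `h`, so the dual
  -- sum consists of diagonal window coefficients times Heisenberg operators on `f`.
  have h1 := hasSum_sum (s := Finset.univ) fun (j : Fin 4 ⊕ Fin 4 → Fin N) _ =>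
    H f (heis (T (fractionVec j)) g) (heis (T (fractionVec j)) g) z
  have h2 : ∀ k : Fin 4 ⊕ Fin 4 → ℤ, ∑ j : Fin 4 ⊕ Fin 4 → Fin N,
      innerS (heis (T (fractionVec j)) g) (heis (V (latticeVec k)) (heis (T (fractionVec j)) g)) *
        heis (V (latticeVec k)) f z = (if ∀ i, (N : ℤ) ∣ k i then (N : ℂ) ^ 8 else 0) *
          innerS g (heis (V (latticeVec k)) g) * heis (V (latticeVec k)) f z := fun k => by
    rw [← Finset.sum_mul]
    congr 1
    rw [← sum_latticeChar_fractionVec hN, Finset.sum_mul]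
    refine Finset.sum_congr rfl fun j _ => ?_
    rw [innerS_window, hVT]
    rfl
  have h3 : (r : ℂ) * hW.frameOp hM (fun j : Fin 4 ⊕ Fin 4 → Fin N =>
      heis (T (fractionVec j)) g) f z = ∑ j : Fin 4 ⊕ Fin 4 → Fin N, r * ∑' ν,
        innerS f (heis (T (latticeVec ν)) (heis (T (fractionVec j)) g)) *
          heis (T (latticeVec ν)) (heis (T (fractionVec j)) g) z := by
    rw [IsWeylSystem.frameOp, sum_apply, Finset.mul_sum]
    simp only [hW.action_ip_apply]
  rw [h3]
  simp only [h2] at h1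
  -- Only indices divisible by `N` survive the character sum, so the sum may be reindexed along
  -- multiplication by `N`.
  have hinj : Function.Injective fun (m : Fin 4 ⊕ Fin 4 → ℤ) => (N : ℤ) • m :=
    smul_right_injective _ (by exact_mod_cast hN)
  rw [← hinj.hasSum_iff] at h1
  · refine h1.congr_fun fun m => ?_
    have h4 : latticeVec ((N : ℤ) • m) = (N : ℝ) • latticeVec m := by
      ext i; simp [latticeVec]
    simp only [Function.comp_apply, h4]
    rw [if_pos fun i => ⟨m i, by simp⟩]
  · intro k hk
    rw [if_neg, zero_mul, zero_mul]
    intro h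
    choose m hm using h
    exact hk ⟨m, by ext i; simp [hm i]⟩

/-- Some frame operator is bijective. -/
theorem exists_bijective_frameOp (hVT : ∀ γ w, Omega (V γ) (T w) = γ ⬝ᵥ w)
    (hW : IsWeylSystem θ T c) {M : Fin 4 ⊕ Fin 4 → Phase}
    (hM : ∀ i x, Omega (M i) (T x) = x i) :
    ∃ (N : ℕ) (g : (Fin 4 ⊕ Fin 4 → Fin N) → 𝓢(V4, ℂ)), Function.Bijective (hW.frameOp hM g) := by
  obtain ⟨r, hr, H⟩ := hasSum_frameOp hVT hW hM
  obtain ⟨g, hg⟩ := exists_schwartz_ne_zero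
  have hVT' : ∀ i x, Omega (-T (Pi.single i 1)) (V x) = x i := fun i x => by
    rw [Omega_neg_left, Omega_swap, neg_neg, hVT, dotProduct_single_one]
  have hg0 : innerS g g ≠ 0 := fun h => hg (innerS_self_eq_zero h)
  obtain ⟨N, hN, b, hb, hb1, hb0, hb2⟩ := exists_dense_scale _ hVT' g (norm_pos_iff.mpr hg0)
  let L : V8 →ₗ[ℝ] Phase := (N : ℝ) • V
  have hL : ∀ m : Fin 4 ⊕ Fin 4 → ℤ, L (latticeVec m) = V ((N : ℝ) • latticeVec m) := fun m => by
    rw [map_smul]; rfl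
  have hN' : (N : ℝ) ≠ 0 := by exact_mod_cast hN
  have hLM : ∀ i x, Omega ((N : ℝ)⁻¹ • -T (Pi.single i 1)) (L x) = x i := fun i x => by
    rw [Omega_smul_left, LinearMap.smul_apply, Omega_smul_right, hVT', inv_mul_cancel_left₀ hN']
  -- The frame operator lives on the lattice `N V(ℤ⁸)`, whose Heisenberg operators generate an
  -- action of the torus of the pulled-back form.
  obtain ⟨θB, hθB, hform⟩ := exists_form L
  have hB : IsWeylSystem θB L (weylPhase L) := isWeylSystem_weylPhase L hform
  let y : SmoothTorus θB := hB.ip _ hLM g g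
  -- Dividing by the diagonal coefficient `⟨g, g⟩` makes the coefficient of `x` at 0 vanish, so the
  -- off-diagonal estimate bounds its ℓ¹ norm by a number below 1.
  let x : SmoothTorus θB := 1 - (innerS g g)⁻¹ • y
  have hy : y = innerS g g • (1 - x) := by
    rw [sub_sub_cancel, smul_smul, mul_inv_cancel₀ hg0, one_smul]
  have hx : ∀ m, ‖x.coeff m‖ ≤ ‖innerS g g‖⁻¹ * b m := fun m => by
    have hxm : x.coeff m = (1 : SmoothTorus θB).coeff m -
      (innerS g g)⁻¹ * innerS g (weylOp L (weylPhase L) m g) := sub_coeff _ _ _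
    rcases eq_or_ne m 0 with rfl | hm
    · rw [hxm, hB.weylOp_zero, one_coeff_zero, inv_mul_cancel₀ hg0, sub_self, norm_zero]
      have := hb0 0
      positivity
    · rw [hxm, one_coeff_of_ne hm, zero_sub, norm_neg, norm_mul, norm_inv, hB.norm_innerS_weylOp, hL]
      gcongr
      exact hb2 m hm
  have hx1 : ∑' m, ‖x.coeff m‖ < 1 := by
    refine ((x.summable_norm).tsum_le_tsum hx (hb.mul_left _)).trans_lt ?_
    rw [tsum_mul_left, inv_mul_lt_iff₀ (norm_pos_iff.mpr hg0), mul_one]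
    exact hb1
  -- Invertibility takes place in the smooth algebra, so the inverse also preserves the Schwartz
  -- space.
  have hbij : Function.Bijective (hB.action (1 - x)) :=
    (Module.End.isUnit_iff _).mp ((isUnit_one_sub hθB x hx1).map hB.action)
  let k : ℂ := (r : ℂ)⁻¹ * (N : ℂ) ^ 8 * innerS g g
  have hr0 : (r : ℂ) ≠ 0 := by exact_mod_cast hr.ne'
  have hNc : (N : ℂ) ≠ 0 := by exact_mod_cast hN
  have hk : k ≠ 0 := mul_ne_zero (mul_ne_zero (inv_ne_zero hr0) (pow_ne_zero _ hNc)) hg0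
  refine ⟨N, fun j => heis (T (fractionVec j)) g, ?_⟩
  have hS : hW.frameOp hM (fun j : Fin 4 ⊕ Fin 4 → Fin N => heis (T (fractionVec j)) g) =
      fun f => Units.mk0 k hk • hB.action (1 - x) f := by
    funext f
    ext z
    have h1 := (H g N hN f z).tsum_eq
    have h2 := hB.action_ip_apply hLM g g f z
    change hB.action y f z = _ at h2
    simp only [hL] at h2
    simp only [mul_assoc] at h1
    rw [tsum_mul_left, ← h2, hy, map_smul] at h1
    change (N : ℂ) ^ 8 * (innerS g g * hB.action (1 - x) f z) = _ at h1
    change _ = k * hB.action (1 - x) f z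
    rw [← inv_mul_cancel_left₀ hr0 (hW.frameOp hM _ f z), ← h1]
    ring
  rw [hS]
  exact (MulAction.bijective (Units.mk0 k hk)).comp hbij

/-- The frame operator is a composite `p ∘ q` of module maps through a finite free module. Its
bijectivity makes `p` surjective with section `q` followed after the inverse of the composite. -/
theorem finite_projective (hVT : ∀ γ w, Omega (V γ) (T w) = γ ⬝ᵥ w) (hW : IsWeylSystem θ T c) :
    @Module.Finite (SmoothTorus θ) 𝓢(V4, ℂ) _ _ (Module.compHom _ hW.action.toRingHom) ∧
    @Module.Projective (SmoothTorus θ) _ 𝓢(V4, ℂ) _ (Module.compHom _ hW.action.toRingHom) := by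
  have hM := Omega_dual_single hVT
  obtain ⟨N, g, hg⟩ := exists_bijective_frameOp hVT hW hM
  let _ : Module (SmoothTorus θ) 𝓢(V4, ℂ) := Module.compHom _ hW.action.toRingHom
  have hsmul : ∀ (a : SmoothTorus θ) (f : 𝓢(V4, ℂ)), a • f = hW.action a f := fun _ _ => rfl
  let p : ((Fin 4 ⊕ Fin 4 → Fin N) → SmoothTorus θ) →ₗ[SmoothTorus θ] 𝓢(V4, ℂ) :=
    { toFun := fun a => ∑ j, a j • g j
      map_add' := fun a b => by simp [add_smul, Finset.sum_add_distrib]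
      map_smul' := fun a b => by simp [mul_smul, Finset.smul_sum] }
  let q : 𝓢(V4, ℂ) →ₗ[SmoothTorus θ] ((Fin 4 ⊕ Fin 4 → Fin N) → SmoothTorus θ) :=
    { toFun := fun f j => hW.ip _ hM f (g j)
      map_add' := fun f f' => funext fun j => hW.ip_add_left hM f f' (g j)
      map_smul' := fun a f => funext fun j => hW.ip_smul_left hM a f (g j) }
  let e := LinearEquiv.ofBijective (p ∘ₗ q) hg
  have hpq : p ∘ₗ (q ∘ₗ e.symm.toLinearMap) = LinearMap.id :=
    LinearMap.ext fun f => e.apply_symm_apply f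
  exact ⟨Module.Finite.of_surjective p fun f => ⟨q (e.symm f), e.apply_symm_apply f⟩,
    Module.Projective.of_split _ p hpq⟩

end Frames

/-! ### Leibniz rule, commuting actions, Hermitian structure and curvature -/

section Connections

variable {ι : Type} [Fintype ι] {θ : Matrix ι ι ℝ} {T : (ι → ℝ) →ₗ[ℝ] Phase}
  {c : (ι → ℤ) → ℂ}

namespace IsWeylSystem

theorem Qop_weylOp (v : Phase) {α : ι → ℝ} {ν : ι → ℤ}
    (hv : Omega v (T (latticeVec ν)) = α ⬝ᵥ latticeVec ν) (f : 𝓢(V4, ℂ)) :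
    Qop v (weylOp T c ν f) = weylOp T c ν (Qop v f) +
      (2 * Real.pi * Complex.I * (α ⬝ᵥ latticeVec ν : ℝ)) • weylOp T c ν f := by
  rw [weylOp_apply, weylOp_apply, map_smul, eq_add_of_sub_eq (Qop_heis v (T (latticeVec ν)) f), hv,
    smul_add, smul_comm, add_comm]

/-- The Leibniz rule for the operators `Q_v`. -/
theorem Qop_action (hW : IsWeylSystem θ T c) (v : Phase) (α : ι → ℝ)
    (hv : ∀ ν, Omega v (T (latticeVec ν)) = α ⬝ᵥ latticeVec ν) (a : SmoothTorus θ)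
    (f : 𝓢(V4, ℂ)) :
    Qop v (hW.action a f) = hW.action a (Qop v f) + hW.action (delta α a) f := by
  refine ((hW.action_hasSum a f).mapL (Qop v)).unique
    (((hW.action_hasSum a (Qop v f)).add (hW.action_hasSum (delta α a) f)).congr_fun fun ν => ?_)
  rw [map_smul, Qop_weylOp v (hv ν), smul_add, smul_smul, delta_coeff, mul_comm (a.coeff ν)]

/-- Commutation of the generating operators passes to infinite sums by Fubini, evaluated at a point.
-/
theorem action_comm {ι' : Type} [Fintype ι'] {θ' : Matrix ι' ι' ℝ} {T' : (ι' → ℝ) →ₗ[ℝ] Phase}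
    {c' : (ι' → ℤ) → ℂ} (hW : IsWeylSystem θ T c) (hW' : IsWeylSystem θ' T' c')
    (h : ∀ m n f, weylOp T c m (weylOp T' c' n f) = weylOp T' c' n (weylOp T c m f))
    (a : SmoothTorus θ) (b : SmoothTorus θ') (f : 𝓢(V4, ℂ)) :
    hW.action a (hW'.action b f) = hW'.action b (hW.action a f) := by
  ext z
  have hs : Summable (Function.uncurry fun (m : ι → ℤ) (n : ι' → ℤ) =>
      a.coeff m * b.coeff n * weylOp T c m (weylOp T' c' n f) z) := by
    refine Summable.of_norm_bounded ((a.summable_norm.mul_of_nonneg b.summable_norm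
      (fun _ => norm_nonneg _) (fun _ => norm_nonneg _)).mul_right
        (SchwartzMap.seminorm ℝ 0 0 f)) ?_
    rintro ⟨m, n⟩
    simp only [Function.uncurry_apply_pair, norm_mul, hW.norm_weylOp_apply, hW'.norm_weylOp_apply]
    gcongr
    exact SchwartzMap.norm_le_seminorm ℝ f _
  have e1 : hW.action a (hW'.action b f) z =
      ∑' m, ∑' n, a.coeff m * b.coeff n * weylOp T c m (weylOp T' c' n f) z := by
    rw [← ((hW.action_hasSum a (hW'.action b f)).schwartz_apply z).tsum_eq]
    refine tsum_congr fun m => ?_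
    rw [smul_apply, smul_eq_mul,
      ← (((hW'.action_hasSum b f).mapL (weylOp T c m)).schwartz_apply z).tsum_eq, ← tsum_mul_left]
    refine tsum_congr fun n => ?_
    rw [map_smul, smul_apply, smul_eq_mul, mul_assoc]
  have e2 : hW'.action b (hW.action a f) z =
      ∑' n, ∑' m, a.coeff m * b.coeff n * weylOp T c m (weylOp T' c' n f) z := by
    rw [← ((hW'.action_hasSum b (hW.action a f)).schwartz_apply z).tsum_eq]
    refine tsum_congr fun n => ?_
    rw [smul_apply, smul_eq_mul,
      ← (((hW.action_hasSum a f).mapL (weylOp T' c' n)).schwartz_apply z).tsum_eq, ← tsum_mul_left]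
    refine tsum_congr fun m => ?_
    rw [map_smul, smul_apply, smul_eq_mul, h]
    ring
  rw [e1, e2]
  exact hs.tsum_comm.symm

theorem weylOp_neg_weylOp (hW : IsWeylSystem θ T c) (hθ : θᵀ = -θ) (ν : ι → ℤ) (f : 𝓢(V4, ℂ)) :
    weylOp T c ν (weylOp T c (-ν) f) = f := by
  rw [hW.weylOp_weylOp, add_neg_cancel, hW.weylOp_zero, torusCocycle, latticeVec_neg,
    formOf_neg_right, formOf_self hθ]
  simp

variable [DecidableEq ι] (hW : IsWeylSystem θ T c) {M : ι → Phase}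
  (hM : ∀ i x, Omega (M i) (T x) = x i)

theorem adj_ip (hθ : θᵀ = -θ) (f g : 𝓢(V4, ℂ)) : adj (hW.ip M hM f g) = hW.ip M hM g f := by
  ext ν
  change starRingEnd ℂ (innerS f (weylOp T c (-ν) g)) = innerS g (weylOp T c ν f)
  rw [innerS_conj, ← hW.innerS_weylOp_weylOp ν, hW.weylOp_neg_weylOp hθ]

/-- The element a*⟨f, f⟩a equals ⟨a*f, a*f⟩, whose trace is the square of an L² norm. -/
theorem isPos_ip (hθ : θᵀ = -θ) (f : 𝓢(V4, ℂ)) : IsPos (hW.ip M hM f f) := by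
  intro a
  have h : adj a * hW.ip M hM f f * a =
      hW.ip M hM (hW.action (adj a) f) (hW.action (adj a) f) := by
    rw [hW.ip_smul_left, ← hW.adj_ip hM hθ (hW.action (adj a) f) f, hW.ip_smul_left, adj_mul hθ,
      adj_adj, hW.adj_ip hM hθ, mul_assoc]
  have h2 : tau (adj a * hW.ip M hM f f * a) =
      innerS (hW.action (adj a) f) (hW.action (adj a) f) := by
    rw [h]
    change innerS _ (weylOp T c 0 _) = _
    rw [hW.weylOp_zero]
  rw [h2, innerS_self]
  exact ⟨by rw [Complex.ofReal_re]; positivity, Complex.ofReal_im _⟩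

theorem ip_definite {f : 𝓢(V4, ℂ)} (h : hW.ip M hM f f = 0) : f = 0 := by
  have h0 : innerS f (weylOp T c 0 f) = 0 := congrArg (fun a => a.coeff 0) h
  rw [hW.weylOp_zero] at h0
  exact innerS_self_eq_zero h0

/-- Skew-adjointness of `Q_v` cancels everything except its scalar commutator with `U_ν`, which is
exactly the eigenvalue of the derivation. -/
theorem delta_ip (v : Phase) (α : ι → ℝ)
    (hv : ∀ ν, Omega v (T (latticeVec ν)) = α ⬝ᵥ latticeVec ν) (f g : 𝓢(V4, ℂ)) :
    delta α (hW.ip M hM f g) = hW.ip M hM (Qop v f) g + hW.ip M hM f (Qop v g) := by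
  ext ν
  change 2 * Real.pi * Complex.I * (α ⬝ᵥ latticeVec ν : ℝ) * innerS f (weylOp T c ν g) =
    innerS (Qop v f) (weylOp T c ν g) + innerS f (weylOp T c ν (Qop v g))
  rw [innerS_Qop, Qop_weylOp v (hv ν), innerS_add_right, innerS_smul_right]
  simp only [map_mul, conj_two, Complex.conj_ofReal, Complex.conj_I]
  ring

end IsWeylSystem

theorem isConstantCurvatureModule {θ : Matrix (Fin 4 ⊕ Fin 4) (Fin 4 ⊕ Fin 4) ℝ}
    {T V : V8 →ₗ[ℝ] Phase} {c : (Fin 4 ⊕ Fin 4 → ℤ) → ℂ} (hθ : θᵀ = -θ)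
    (hVT : ∀ γ w, Omega (V γ) (T w) = γ ⬝ᵥ w) (hW : IsWeylSystem θ T c) :
    IsConstantCurvatureModule θ hW.action (hW.ip _ (Omega_dual_single hVT))
      (fun γ => (Qop (V γ)).toLinearMap)
      fun γ γ' => 2 * Real.pi * Complex.I * (Omega (V γ) (V γ') : ℝ) where
  finite := (finite_projective hVT hW).1
  projective := (finite_projective hVT hW).2
  ip_add_left := hW.ip_add_left _
  ip_smul_left := hW.ip_smul_left _
  ip_adj := hW.adj_ip _ hθ
  ip_pos := hW.isPos_ip _ hθ
  ip_definite _ := hW.ip_definite _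
  nabla_add α β := by rw [map_add, Qop_add]; rfl
  nabla_smul r α := by
    refine LinearMap.ext fun f => ?_
    rw [map_smul]
    exact Qop_smul r (V α) f
  leibniz α a e := hW.Qop_action (V α) α (fun _ => hVT _ _) a e
  hermitian α e f := hW.delta_ip _ (V α) α (fun _ => hVT _ _) e f
  curvature α β := LinearMap.ext fun f => Qop_Qop (V α) (V β) f

end Connections

/-! ### Right modules as left modules over the opposite form -/

section OppositeTorus

variable {ι : Type} [Fintype ι] {θ : Matrix ι ι ℝ}

/-- The isomorphism of the opposite torus with the torus of the opposite form. -/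
def opTorus (hθ : θᵀ = -θ) : (SmoothTorus θ)ᵐᵒᵖ →ₐ[ℂ] SmoothTorus (-θ) :=
  AlgHom.ofLinearMap
    { toFun := fun b => ⟨b.unop.coeff, b.unop.rapid⟩
      map_add' := fun _ _ => rfl
      map_smul' := fun _ _ => rfl }
    rfl
    (fun a b => by
      ext ν
      change (b.unop * a.unop).coeff ν = _
      rw [mul_coeff, mul_coeff]
      refine Eq.trans (tsum_congr fun m => ?_) ((Equiv.subLeft ν).tsum_eq _)
      have h : torusCocycle (-θ) (ν - m) m = torusCocycle θ m (ν - m) := by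
        rw [torusCocycle, torusCocycle, formOf_swap hθ (latticeVec m), formOf, formOf,
          Matrix.neg_mulVec, dotProduct_neg]
      simp only [Equiv.subLeft_apply, LinearMap.coe_mk, AddHom.coe_mk, sub_sub_cancel]
      rw [h]
      ring)

theorem opTorus_coeff (hθ : θᵀ = -θ) (b : SmoothTorus θ) (ν : ι → ℤ) :
    (opTorus hθ (MulOpposite.op b)).coeff ν = b.coeff ν := rfl

end OppositeTorus

/-! ### Symplectic linear algebra: existence and uniqueness of T, its dual, kernels of σ -/

section NormalForm

/-- A skew-symmetric bilinear form of rank at most `2 n` is a sum of `n` elementary two-forms. -/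
theorem exists_normal_form {V : Type*} [AddCommGroup V] [Module ℝ V] [FiniteDimensional ℝ V]
    (n : ℕ) : ∀ B : V →ₗ[ℝ] V →ₗ[ℝ] ℝ, (∀ x y, B x y = -B y x) →
      Module.finrank ℝ V ≤ Module.finrank ℝ (LinearMap.ker B) + 2 * n →
      ∃ a b : Fin n → V →ₗ[ℝ] ℝ, ∀ x y, B x y = ∑ i, (a i x * b i y - b i x * a i y) := by
  induction n with
  | zero =>
    intro B _ h
    refine ⟨Fin.elim0, Fin.elim0, fun x y => ?_⟩
    have hk : LinearMap.ker B = ⊤ :=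
      Submodule.eq_top_of_finrank_eq (le_antisymm (Submodule.finrank_le _) (by simpa using h))
    have hx : B x = 0 := LinearMap.mem_ker.mp (hk ▸ Submodule.mem_top)
    simp [hx]
  | succ n ih =>
    intro B hB h
    by_cases h0 : ∀ x y, B x y = 0
    · exact ⟨0, 0, fun x y => by simp [h0]⟩
    push Not at h0
    obtain ⟨u, v', hv'⟩ := h0
    -- A hyperbolic pair `B u v = 1`, obtained by rescaling.
    obtain ⟨v, huv⟩ : ∃ v, B u v = 1 := ⟨(B u v')⁻¹ • v', by simp [hv']⟩
    have hself : ∀ x, B x x = 0 := fun x => by linarith [hB x x]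
    let p : V →ₗ[ℝ] ℝ := B u
    let q : V →ₗ[ℝ] ℝ := B.flip v
    -- Subtracting the elementary two-form of B(·, v) and B(u, ·) splits off the plane spanned by
    -- `u` and `v`.
    let B' : V →ₗ[ℝ] V →ₗ[ℝ] ℝ := B - (q.smulRight p - p.smulRight q)
    have hB' : ∀ x y, B' x y = B x y - (B x v * B u y - B u x * B y v) := fun x y => rfl
    have hle : LinearMap.ker B ≤ LinearMap.ker B' ⊓ LinearMap.ker p := by
      intro x hx
      rw [LinearMap.mem_ker] at hx
      have hux : B u x = 0 := by rw [hB, hx]; simp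
      refine ⟨LinearMap.ext fun y => ?_, hux⟩
      rw [hB', hx, hux]
      simp
    have hu : u ∈ LinearMap.ker B' := LinearMap.ext fun y => by
      rw [hB', huv, hself]; simp
    have hv : v ∈ LinearMap.ker B' := LinearMap.ext fun y => by
      rw [hB', huv, hself, hB v y]; simp
    -- The chain of kernels is strict twice: `u` lies in the middle space but not in the first, `v`
    -- in the last but not in the middle. Hence the kernel grows by at least two and the induction
    -- closes.
    have h1 : LinearMap.ker B < LinearMap.ker B' ⊓ LinearMap.ker p := by
      refine lt_of_le_of_ne hle fun he => ?_
      have : u ∈ LinearMap.ker B := he ▸ ⟨hu, hself u⟩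
      rw [LinearMap.mem_ker] at this
      rw [this] at huv
      simp at huv
    have h2 : LinearMap.ker B' ⊓ LinearMap.ker p < LinearMap.ker B' := by
      refine lt_of_le_of_ne inf_le_left fun he => ?_
      have : v ∈ LinearMap.ker B' ⊓ LinearMap.ker p := by rw [he]; exact hv
      have : B u v = 0 := this.2
      linarith
    have h3 := Submodule.finrank_lt_finrank_of_lt h1
    have h4 := Submodule.finrank_lt_finrank_of_lt h2
    obtain ⟨a, b, hab⟩ := ih B' (fun x y => by rw [hB', hB', hB x y]; ring) (by omega)
    refine ⟨Fin.cons q a, Fin.cons p b, fun x y => ?_⟩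
    rw [Fin.sum_univ_succ]
    simp only [Fin.cons_zero, Fin.cons_succ, ← hab, hB']
    change _ = B x v * B u y - B u x * B y v + _
    ring

/-- In dimension 8 the rank bound for four two-forms is automatic, so no nondegeneracy is needed.
The two families of functionals become the position and momentum components of `T`. -/
theorem exists_pullback {M : Matrix (Fin 4 ⊕ Fin 4) (Fin 4 ⊕ Fin 4) ℝ} (hM : Mᵀ = -M) :
    ∃ T : V8 →ₗ[ℝ] Phase, ∀ v w, Omega (T v) (T w) = formOf M v w := by
  have hB : ∀ x y, Matrix.toLinearMap₂' ℝ M x y = formOf M x y := fun x y => by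
    rw [Matrix.toLinearMap₂'_apply']; rfl
  obtain ⟨a, b, hab⟩ := exists_normal_form 4 (Matrix.toLinearMap₂' ℝ M)
    (fun x y => by rw [hB, hB, formOf_swap hM]) (by simp)
  refine ⟨(LinearMap.pi a).prod (LinearMap.pi b), fun v w => ?_⟩
  rw [← hB, hab, Omega, dotProduct, dotProduct, ← Finset.sum_sub_distrib]
  exact Finset.sum_congr rfl fun i _ => by
    simp only [LinearMap.prod_apply, Function.prod_apply, LinearMap.pi_apply]; ring

variable {M : Matrix (Fin 4 ⊕ Fin 4) (Fin 4 ⊕ Fin 4) ℝ} {T T' : V8 →ₗ[ℝ] Phase}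

theorem bijective_iff_det_ne_zero (hT : ∀ v w, Omega (T v) (T w) = formOf M v w) :
    Function.Bijective T ↔ M.det ≠ 0 := by
  constructor
  · intro h h0
    obtain ⟨v, hv, hMv⟩ := Matrix.exists_mulVec_eq_zero_iff.mpr h0
    refine hv (h.1 ?_)
    rw [map_zero]
    refine Omega_nondegenerate fun w => ?_
    obtain ⟨w, rfl⟩ := h.2 w
    rw [Omega_swap, hT, formOf, hMv, dotProduct_zero, neg_zero]
  · intro h
    refine bijective_of_injective ((injective_iff_map_eq_zero T).mpr fun v hv => ?_)
    by_contra hne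
    refine h (Matrix.exists_vecMul_eq_zero_iff.mp ⟨v, hne, ?_⟩)
    refine dotProduct_eq_zero _ fun w => ?_
    rw [← Matrix.dotProduct_mulVec]
    change formOf M v w = 0
    rw [← hT, hv]
    simp [Omega]

theorem exists_symplectic (hM : M.det ≠ 0) (hT : ∀ v w, Omega (T v) (T w) = formOf M v w)
    (hT' : ∀ v w, Omega (T' v) (T' w) = formOf M v w) :
    ∃ S : Phase ≃ₗ[ℝ] Phase, (∀ v w, Omega (S v) (S w) = Omega v w) ∧ ∀ v, T' v = S (T v) := by
  let e := LinearEquiv.ofBijective T ((bijective_iff_det_ne_zero hT).mpr hM)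
  let e' := LinearEquiv.ofBijective T' ((bijective_iff_det_ne_zero hT').mpr hM)
  have he : ∀ v, T' v = (e.symm.trans e') (T v) := fun v => by
    change _ = e' (e.symm (e v))
    rw [LinearEquiv.symm_apply_apply]
    rfl
  refine ⟨e.symm.trans e', fun v w => ?_, he⟩
  obtain ⟨v, rfl⟩ := e.surjective v
  obtain ⟨w, rfl⟩ := e.surjective w
  change Omega ((e.symm.trans e') (T v)) ((e.symm.trans e') (T w)) = Omega (T v) (T w)
  rw [← he, ← he, hT, hT']

/-- The witness is `T` after the inverse transpose of `M`, which moves the matrix of the form onto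
the dual variable. -/
theorem exists_dual (hM : M.det ≠ 0) (hT : ∀ v w, Omega (T v) (T w) = formOf M v w) :
    ∃ V : V8 →ₗ[ℝ] Phase, ∀ γ w, Omega (V γ) (T w) = γ ⬝ᵥ w := by
  refine ⟨T ∘ₗ (M⁻¹ᵀ).mulVecLin, fun γ w => ?_⟩
  rw [LinearMap.comp_apply, hT, formOf, Matrix.mulVecLin_apply, Matrix.mulVec_transpose,
    ← Matrix.dotProduct_mulVec, Matrix.mulVec_mulVec, Matrix.nonsing_inv_mul _
      (isUnit_iff_ne_zero.mpr hM), Matrix.one_mulVec]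

theorem eq_of_Omega_eq (hT : Function.Surjective T) {u v : Phase}
    (h : ∀ w, Omega u (T w) = Omega v (T w)) : u = v := by
  refine sub_eq_zero.mp (Omega_nondegenerate fun w => ?_)
  obtain ⟨w, rfl⟩ := hT w
  rw [sub_eq_add_neg, Omega_add_left, Omega_neg_left, h, add_neg_cancel]

theorem sumElim_comp (w : V8) : Sum.elim (w ∘ Sum.inl) (w ∘ Sum.inr) = w :=
  Sum.elim_comp_inl_inr w

/-- The map `ℝ⁴ → ℝ⁸`, `α ↦ (α, 0)`. -/
def inlMap : V4 →ₗ[ℝ] V8 where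
  toFun α := Sum.elim α 0
  map_add' α β := by ext (i | i) <;> simp
  map_smul' r α := by ext (i | i) <;> simp

/-- The map `ℝ⁴ → ℝ⁸`, `α ↦ (0, α)`. -/
def inrMap : V4 →ₗ[ℝ] V8 where
  toFun α := Sum.elim 0 α
  map_add' α β := by ext (i | i) <;> simp
  map_smul' r α := by ext (i | i) <;> simp

theorem existsUnique_V₁ (hM : M.det ≠ 0) (hT : ∀ v w, Omega (T v) (T w) = formOf M v w) :
    ∃! V₁, IsV₁ T V₁ := by
  obtain ⟨V, hV⟩ := exists_dual hM hT
  have hV' : IsV₁ T (V ∘ₗ inlMap) := fun α ν μ => by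
    change Omega (V (Sum.elim α 0)) _ = _
    rw [hV]
    simp
  refine ⟨_, hV', fun V' h => LinearMap.ext fun α =>
    eq_of_Omega_eq ((bijective_iff_det_ne_zero hT).mpr hM).2 fun w => ?_⟩
  rw [← sumElim_comp w, h, hV']

theorem existsUnique_V₂ (hM : M.det ≠ 0) (hT : ∀ v w, Omega (T v) (T w) = formOf M v w) :
    ∃! V₂, IsV₂ T V₂ := by
  obtain ⟨V, hV⟩ := exists_dual hM hT
  have hV' : IsV₂ T (V ∘ₗ inrMap) := fun α ν μ => by
    change Omega (V (Sum.elim 0 α)) _ = _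
    rw [hV]
    simp
  refine ⟨_, hV', fun V' h => LinearMap.ext fun α =>
    eq_of_Omega_eq ((bijective_iff_det_ne_zero hT).mpr hM).2 fun w => ?_⟩
  rw [← sumElim_comp w, h, hV']

/-- The linear map `γ ↦ V₁(γ₁) + V₂(γ₂)`. -/
def sumMap (V₁ V₂ : V4 →ₗ[ℝ] Phase) : V8 →ₗ[ℝ] Phase where
  toFun := sumVec V₁ V₂
  map_add' γ γ' := by
    change V₁ (γ ∘ Sum.inl + γ' ∘ Sum.inl) + V₂ (γ ∘ Sum.inr + γ' ∘ Sum.inr) = _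
    rw [map_add, map_add]
    exact add_add_add_comm _ _ _ _
  map_smul' r γ := by
    change V₁ (r • (γ ∘ Sum.inl)) + V₂ (r • (γ ∘ Sum.inr)) = _
    rw [map_smul, map_smul, ← smul_add]
    rfl

theorem Omega_sumMap {V₁ V₂ : V4 →ₗ[ℝ] Phase} (h₁ : IsV₁ T V₁) (h₂ : IsV₂ T V₂) (γ w : V8) :
    Omega (sumMap V₁ V₂ γ) (T w) = γ ⬝ᵥ w := by
  conv_lhs => rw [← sumElim_comp w]
  change Omega (V₁ _ + V₂ _) _ = _
  rw [Omega_add_left, h₁, h₂]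
  simp [dotProduct, Fintype.sum_sum_type]

theorem nablaSum_eq (V₁ V₂ : V4 →ₗ[ℝ] Phase) (γ : V8) :
    nablaSum V₁ V₂ γ = (Qop (sumMap V₁ V₂ γ)).toLinearMap := by
  change _ = (Qop (V₁ _ + V₂ _)).toLinearMap
  rw [Qop_add]
  rfl

theorem sigma_eq_zero_iff {V₁ V₂ : V4 →ₗ[ℝ] Phase} {α β : V4} :
    sigma V₁ V₂ α β = 0 ↔ Omega (V₁ α) (V₂ β) = 0 := by
  simp [sigma, Real.pi_ne_zero]

theorem formOf_elim_left (w₁ w₂ ν μ : V4) :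
    formOf M (Sum.elim w₁ w₂) (Sum.elim ν μ) =
      w₁ ⬝ᵥ (M.toBlocks₁₁ *ᵥ ν) + w₁ ⬝ᵥ (M.toBlocks₁₂ *ᵥ μ) +
        (w₂ ⬝ᵥ (M.toBlocks₂₁ *ᵥ ν) + w₂ ⬝ᵥ (M.toBlocks₂₂ *ᵥ μ)) := by
  conv_lhs => rw [formOf, ← Matrix.fromBlocks_toBlocks M, Matrix.fromBlocks_mulVec]
  simp only [Sum.elim_comp_inl, Sum.elim_comp_inr, dotProduct, Fintype.sum_sum_type, Sum.elim_inl,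
    Sum.elim_inr, Pi.add_apply, mul_add, Finset.sum_add_distrib]

/-- Write V₁(α) = T(w₁, w₂). Pairing with V₂(β) gives -⟨β, w₂⟩, so α lies in the left kernel of σ
iff w₂ = 0; then orthogonality of V₁(α) to T(0, μ) says that w₁ annihilates the mixed block. Thus
the left kernels of σ and of the mixed block correspond, and likewise the right kernels. -/
theorem sigmaNondegenerate_iff (hM : M.det ≠ 0) (hskew : Mᵀ = -M)
    (hT : ∀ v w, Omega (T v) (T w) = formOf M v w) {V₁ V₂ : V4 →ₗ[ℝ] Phase} (h₁ : IsV₁ T V₁)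
    (h₂ : IsV₂ T V₂) : SigmaNondegenerate V₁ V₂ ↔ M.toBlocks₁₂.det ≠ 0 := by
  have hbij := (bijective_iff_det_ne_zero hT).mpr hM
  have h21 : M.toBlocks₂₁ = -M.toBlocks₁₂ᵀ := by
    ext i j
    have := congrFun (congrFun hskew (Sum.inr i)) (Sum.inl j)
    simp only [Matrix.transpose_apply, Matrix.neg_apply] at this
    simp [Matrix.toBlocks₂₁, Matrix.toBlocks₁₂, this]
  have hsurj : ∀ u : Phase, ∃ w₁ w₂ : V4, T (Sum.elim w₁ w₂) = u := fun u => by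
    obtain ⟨w, rfl⟩ := hbij.2 u
    exact ⟨_, _, congrArg T (sumElim_comp w)⟩
  constructor
  · intro h h0
    obtain ⟨w, hw, hMw⟩ := Matrix.exists_mulVec_eq_zero_iff.mpr h0
    -- If the mixed block kills `w`, then T(0, w) is Ω-orthogonal to T(ℝ⁴ ⊕ 0), hence is a value of
    -- `V₂`; the argument is read off from the lower diagonal block.
    have hV : T (Sum.elim 0 w) = V₂ (w ᵥ* M.toBlocks₂₂) := by
      refine eq_of_Omega_eq hbij.2 fun x => ?_
      rw [← sumElim_comp x, h₂, hT, formOf_elim_left, h21, Matrix.neg_mulVec,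
        Matrix.mulVec_transpose, dotProduct_neg, ← Matrix.dotProduct_mulVec _ _ (x ∘ Sum.inr),
        dotProduct_comm w, ← Matrix.dotProduct_mulVec, hMw]
      simp
    have hβ := h.2 (w ᵥ* M.toBlocks₂₂) fun α => by
      rw [sigma_eq_zero_iff, ← hV, h₁, dotProduct_zero]
    rw [hβ, map_zero, map_eq_zero_iff T hbij.1] at hV
    exact hw (funext fun i => congrFun hV (Sum.inr i))
  · intro h
    constructor
    · intro α hα
      obtain ⟨w₁, w₂, hw⟩ := hsurj (V₁ α)
      have hw2 : w₂ = 0 := dotProduct_eq_zero _ fun β => by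
        have := hα β
        rw [sigma_eq_zero_iff, Omega_swap, ← hw, h₂, neg_eq_zero, dotProduct_comm] at this
        exact this
      subst hw2
      have hw1 : w₁ = 0 := by
        by_contra hne
        refine h (Matrix.exists_vecMul_eq_zero_iff.mp ⟨w₁, hne, dotProduct_eq_zero _ fun μ => ?_⟩)
        have := h₁ α 0 μ
        rw [← hw, hT, formOf_elim_left] at this
        rw [← Matrix.dotProduct_mulVec]
        simpa using this
      subst hw1
      refine dotProduct_eq_zero _ fun ν => ?_
      rw [← h₁ α ν 0, ← hw, hT, formOf_elim_left]
      simp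
    · intro β hβ
      obtain ⟨w₁, w₂, hw⟩ := hsurj (V₂ β)
      have hw1 : w₁ = 0 := dotProduct_eq_zero _ fun α => by
        have := hβ α
        rw [sigma_eq_zero_iff, ← hw, h₁, dotProduct_comm] at this
        exact this
      subst hw1
      have hw2 : w₂ = 0 := by
        by_contra hne
        refine h (Matrix.exists_mulVec_eq_zero_iff.mp ⟨w₂, hne, dotProduct_eq_zero _ fun ν => ?_⟩)
        have := h₂ β ν 0
        rw [← hw, hT, formOf_elim_left, h21] at this
        rw [dotProduct_comm, Matrix.dotProduct_mulVec, ← Matrix.mulVec_transpose, dotProduct_comm]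
        simpa [Matrix.neg_mulVec] using this
      subst hw2
      refine dotProduct_eq_zero _ fun μ => ?_
      rw [← h₂ β 0 μ, ← hw, hT, formOf_elim_left]
      simp

end NormalForm

/-! ### The form θ ⊕ (-θ') + η and its mixed block -/

section FullForm

variable {θ θ' : Matrix (Fin 4) (Fin 4) ℝ} {η : Matrix (Fin 4 ⊕ Fin 4) (Fin 4 ⊕ Fin 4) ℤ}

theorem twoForm_transpose (hθ : θᵀ = -θ) (hθ' : θ'ᵀ = -θ') : (twoForm θ θ')ᵀ = -twoForm θ θ' := by
  simp [twoForm, Matrix.fromBlocks_transpose, Matrix.fromBlocks_neg, hθ, hθ']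

theorem fullForm_transpose (hθ : θᵀ = -θ) (hθ' : θ'ᵀ = -θ') (hη : ηᵀ = -η) :
    (fullForm θ θ' η)ᵀ = -fullForm θ θ' η := by
  rw [fullForm, Matrix.transpose_add, twoForm_transpose hθ hθ', ← Matrix.transpose_map, hη, neg_add]
  congr 1
  ext i j
  simp

theorem fullForm_toBlocks₁₂ : (fullForm θ θ' η).toBlocks₁₂ = η.toBlocks₁₂.map fun k : ℤ => (k : ℝ) := by
  ext i j
  simp [fullForm, twoForm, Matrix.toBlocks₁₂]

theorem det_fullForm_toBlocks₁₂ :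
    (fullForm θ θ' η).toBlocks₁₂.det ≠ 0 ↔ η.toBlocks₁₂.det ≠ 0 := by
  have : (fullForm θ θ' η).toBlocks₁₂.det = (η.toBlocks₁₂.det : ℝ) := by
    rw [fullForm_toBlocks₁₂, Int.cast_det]
  rw [this, Int.cast_ne_zero]

theorem IsPullback.sigmaNondegenerate_iff {T : V8 →ₗ[ℝ] Phase} (hθ : θᵀ = -θ) (hθ' : θ'ᵀ = -θ')
    (hη : ηᵀ = -η) (hT : IsPullback θ θ' η T) (hdet : (fullForm θ θ' η).det ≠ 0)
    {V₁ V₂ : V4 →ₗ[ℝ] Phase} (h₁ : IsV₁ T V₁) (h₂ : IsV₂ T V₂) :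
    SigmaNondegenerate V₁ V₂ ↔ η.toBlocks₁₂.det ≠ 0 :=
  (_root_.sigmaNondegenerate_iff hdet (fullForm_transpose hθ hθ' hη) hT h₁ h₂).trans
    det_fullForm_toBlocks₁₂

end FullForm

/-! ### Genericity through determinant polynomials -/

section Genericity

/-- `det (X K + B)` is a polynomial in X with top coefficient `det K`, so it cannot vanish at every
positive integer. -/
theorem exists_det_ne_zero {n : Type*} [Fintype n] [DecidableEq n] {K : Matrix n n ℝ}
    (hK : K.det ≠ 0) (B : Matrix n n ℝ) :
    ∃ k : ℕ, k ≠ 0 ∧ ((k : ℝ) • K + B).det ≠ 0 := by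
  by_contra! h
  let q : Polynomial ℝ := ((Polynomial.X : Polynomial ℝ) • K.map Polynomial.C + B.map Polynomial.C).det
  have hq : q = 0 := by
    refine Polynomial.eq_zero_of_infinite_isRoot _ (Set.infinite_of_injective_forall_mem
      (f := fun k : ℕ => ((k + 1 : ℕ) : ℝ)) (fun a b hab => by simpa using hab) fun k => ?_)
    change q.eval _ = 0
    rw [← h (k + 1) (by omega), ← Polynomial.coe_evalRingHom, RingHom.map_det]
    congr 1
    ext i j
    simp
    ring
  exact hK ((Polynomial.coeff_det_X_add_C_card K B).symm.trans (by
    change q.coeff _ = 0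
    rw [hq, Polynomial.coeff_zero]))

/-- A nondegenerate skew-symmetric form on `ℝ⁴`. -/
def standardSkew : Matrix (Fin 4) (Fin 4) ℝ := !![0, 1, 0, 0; -1, 0, 0, 0; 0, 0, 0, 1; 0, 0, -1, 0]

theorem standardSkew_transpose : standardSkewᵀ = -standardSkew := by
  ext i j
  fin_cases i <;> fin_cases j <;> simp [standardSkew]

theorem det_standardSkew : standardSkew.det ≠ 0 := by
  refine Matrix.det_ne_zero_of_left_inverse (B := -standardSkew) ?_
  ext i j
  fin_cases i <;> fin_cases j <;> simp [standardSkew, Matrix.mul_apply, Fin.sum_univ_four]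

/-- The exceptional set is the zero set of a product of three determinants, so one pair where none
of them vanishes is enough. -/
theorem genericPair_nondegenerate (η : Matrix (Fin 4 ⊕ Fin 4) (Fin 4 ⊕ Fin 4) ℤ) :
    GenericPair fun θ θ' => θ.det ≠ 0 ∧ θ'.det ≠ 0 ∧ (fullForm θ θ' η).det ≠ 0 := by
  let P : Matrix (Fin 4) (Fin 4) (MvPolynomial ((Fin 4 × Fin 4) ⊕ (Fin 4 × Fin 4)) ℝ) :=
    Matrix.of fun i j => MvPolynomial.X (Sum.inl (i, j))
  let P' : Matrix (Fin 4) (Fin 4) (MvPolynomial ((Fin 4 × Fin 4) ⊕ (Fin 4 × Fin 4)) ℝ) :=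
    Matrix.of fun i j => MvPolynomial.X (Sum.inr (i, j))
  obtain ⟨p, h⟩ : ∃ p : MvPolynomial ((Fin 4 × Fin 4) ⊕ (Fin 4 × Fin 4)) ℝ,
      ∀ θ θ' : Matrix (Fin 4) (Fin 4) ℝ,
      MvPolynomial.eval (Sum.elim (fun k => θ k.1 k.2) (fun k => θ' k.1 k.2)) p =
        θ.det * θ'.det * (fullForm θ θ' η).det := by
    refine ⟨P.det * P'.det * (Matrix.fromBlocks P 0 0 (-P') +
      η.map fun k : ℤ => MvPolynomial.C (k : ℝ)).det, fun θ θ' => ?_⟩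
    rw [map_mul, map_mul, RingHom.map_det, RingHom.map_det, RingHom.map_det]
    congr 1
    · congr 2 <;> ext i j <;> simp [P, P']
    · congr 1
      ext (i | i) (j | j) <;> simp [P, P', fullForm, twoForm]
  refine ⟨p, ?_, fun θ θ' _ _ hp => ?_⟩
  · have hK : (twoForm standardSkew standardSkew).det ≠ 0 := by
      rw [twoForm, Matrix.det_fromBlocks_zero₁₂, Matrix.det_neg]
      simp [det_standardSkew]
    -- Scaling a fixed nondegenerate pair makes it dominate the integral form.
    obtain ⟨k, hk, hdet⟩ := exists_det_ne_zero hK (η.map fun k : ℤ => (k : ℝ))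
    refine ⟨(k : ℝ) • standardSkew, (k : ℝ) • standardSkew, ?_, ?_, ?_⟩
    · rw [Matrix.transpose_smul, standardSkew_transpose, smul_neg]
    · rw [Matrix.transpose_smul, standardSkew_transpose, smul_neg]
    rw [h]
    have h1 : fullForm ((k : ℝ) • standardSkew) ((k : ℝ) • standardSkew) η =
        (k : ℝ) • twoForm standardSkew standardSkew + η.map fun k : ℤ => (k : ℝ) := by
      rw [fullForm, twoForm, twoForm, Matrix.fromBlocks_smul]
      simp
    rw [h1, Matrix.det_smul]
    have : (k : ℝ) ≠ 0 := Nat.cast_ne_zero.mpr hk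
    have := det_standardSkew
    positivity
  · rw [h] at hp
    exact ⟨left_ne_zero_of_mul (left_ne_zero_of_mul hp),
      right_ne_zero_of_mul (left_ne_zero_of_mul hp), right_ne_zero_of_mul hp⟩

theorem genericIntegral_nondegenerate (θ θ' : Matrix (Fin 4) (Fin 4) ℝ) :
    GenericIntegral fun η => (fullForm θ θ' η).det ≠ 0 ∧ η.toBlocks₁₂.det ≠ 0 := by
  let P : Matrix (Fin 4 ⊕ Fin 4) (Fin 4 ⊕ Fin 4)
      (MvPolynomial ((Fin 4 ⊕ Fin 4) × (Fin 4 ⊕ Fin 4)) ℝ) :=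
    Matrix.of fun i j => MvPolynomial.X (i, j)
  obtain ⟨p, h⟩ : ∃ p : MvPolynomial ((Fin 4 ⊕ Fin 4) × (Fin 4 ⊕ Fin 4)) ℝ,
      ∀ η : Matrix (Fin 4 ⊕ Fin 4) (Fin 4 ⊕ Fin 4) ℤ,
      MvPolynomial.eval (fun k => (η k.1 k.2 : ℝ)) p =
        (fullForm θ θ' η).det * (η.toBlocks₁₂.det : ℝ) := by
    refine ⟨((twoForm θ θ').map MvPolynomial.C + P).det * P.toBlocks₁₂.det, fun η => ?_⟩
    rw [map_mul, RingHom.map_det, RingHom.map_det, Int.cast_det]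
    congr 2 <;> ext i j <;> simp [P, fullForm, Matrix.toBlocks₁₂]
  refine ⟨p, ?_, fun η _ hp => ?_⟩
  -- A suitable multiple of the standard symplectic matrix dominates the fixed forms; its mixed
  -- block is scalar, hence invertible.
  · obtain ⟨k, hk, hdet⟩ := exists_det_ne_zero (Matrix.isUnit_det_J (Fin 4) ℝ).ne_zero (twoForm θ θ')
    refine ⟨(k : ℤ) • Matrix.J (Fin 4) ℤ, ?_, ?_⟩
    · rw [Matrix.transpose_smul, Matrix.J_transpose, smul_neg]
    rw [h]
    have h1 : fullForm θ θ' ((k : ℤ) • Matrix.J (Fin 4) ℤ) =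
        (k : ℝ) • Matrix.J (Fin 4) ℝ + twoForm θ θ' := by
      rw [fullForm, add_comm]
      congr 1
      ext (i | i) (j | j) <;> by_cases hij : i = j <;>
        simp only [Matrix.map_apply, Matrix.smul_apply, Matrix.J] <;> simp [hij]
    have h2 : ((k : ℤ) • Matrix.J (Fin 4) ℤ).toBlocks₁₂ = (-k : ℤ) • 1 := by
      ext i j
      simp [Matrix.J, Matrix.toBlocks₁₂]
    rw [h1, h2, Matrix.det_smul, Matrix.det_one]
    exact mul_ne_zero hdet (by simp [hk])
  · rw [h] at hp
    exact ⟨left_ne_zero_of_mul hp, by exact_mod_cast right_ne_zero_of_mul hp⟩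

end Genericity

/-! ### Block form of T and the Poincaré form -/

section Deformation

theorem formOf_injective {ι : Type} [Fintype ι] {M N : Matrix ι ι ℝ}
    (h : ∀ v w, formOf M v w = formOf N v w) : M = N := by
  classical
  ext i j
  simpa [formOf] using h (Pi.single i 1) (Pi.single j 1)

theorem dotProduct_transpose_mul_mulVec (P R : Matrix (Fin 4) (Fin 4) ℝ) (v w : V4) :
    v ⬝ᵥ ((Pᵀ * R) *ᵥ w) = (P *ᵥ v) ⬝ᵥ (R *ᵥ w) := by
  rw [← Matrix.mulVec_mulVec, Matrix.dotProduct_mulVec, Matrix.vecMul_transpose]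

theorem Omega_blockMap (A B C D : Matrix (Fin 4) (Fin 4) ℝ) (v w : V8) :
    Omega (blockMap A B C D v) (blockMap A B C D w) =
      formOf (Matrix.fromBlocks (Bᵀ * D - Dᵀ * B) (Bᵀ * A - Dᵀ * C)
        (Cᵀ * D - Aᵀ * B) (Cᵀ * A - Aᵀ * C)) v w := by
  conv_rhs => rw [← sumElim_comp v, ← sumElim_comp w]
  rw [formOf_elim_left]
  simp only [Matrix.toBlocks_fromBlocks₁₁, Matrix.toBlocks_fromBlocks₁₂,
    Matrix.toBlocks_fromBlocks₂₁, Matrix.toBlocks_fromBlocks₂₂, Matrix.sub_mulVec, dotProduct_sub,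
    dotProduct_transpose_mul_mulVec]
  simp only [Omega, blockMap, LinearMap.coe_mk, AddHom.coe_mk, add_dotProduct,
    dotProduct_sub, dotProduct_neg]
  simp only [dotProduct_comm (_ *ᵥ (w ∘ _)) (_ *ᵥ (v ∘ _))]
  ring

theorem isPullback_blockMap_iff (θ θ' A B C D : Matrix (Fin 4) (Fin 4) ℝ)
    (E : Matrix (Fin 4) (Fin 4) ℤ) :
    IsPullback θ θ' (mixedForm E) (blockMap A B C D) ↔
      Bᵀ * D - Dᵀ * B = θ ∧ Cᵀ * A - Aᵀ * C = -θ' ∧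
      Bᵀ * A - Dᵀ * C = E.map fun k : ℤ => (k : ℝ) := by
  have hfull : fullForm θ θ' (mixedForm E) = Matrix.fromBlocks θ (E.map fun k : ℤ => (k : ℝ))
      (-(E.map fun k : ℤ => (k : ℝ))ᵀ) (-θ') := by
    ext (i | i) (j | j) <;> simp [fullForm, twoForm, mixedForm]
  have h : IsPullback θ θ' (mixedForm E) (blockMap A B C D) ↔
      Matrix.fromBlocks (Bᵀ * D - Dᵀ * B) (Bᵀ * A - Dᵀ * C) (Cᵀ * D - Aᵀ * B) (Cᵀ * A - Aᵀ * C) =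
        fullForm θ θ' (mixedForm E) :=
    ⟨fun h => formOf_injective fun v w => by rw [← Omega_blockMap, h],
      fun h v w => by rw [Omega_blockMap, h]⟩
  rw [h, hfull, Matrix.fromBlocks_inj]
  -- The fourth block equation is minus the transpose of the mixed one, hence redundant.
  refine ⟨fun h => ⟨h.1, h.2.2.2, h.2.1⟩, fun h => ⟨h.1, h.2.2, ?_, h.2.1⟩⟩
  rw [← h.2.2]
  simp

theorem det_fullForm_poincare : (fullForm 0 0 poincareEta).det ≠ 0 := by
  have h : fullForm 0 0 poincareEta = Matrix.J (Fin 4) ℝ := by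
    ext (i | i) (j | j) <;>
      simp [fullForm, twoForm, poincareEta, mixedForm, Matrix.J, Matrix.one_apply, apply_ite]
  rw [h]
  exact (Matrix.isUnit_det_J (Fin 4) ℝ).ne_zero

theorem poincareEta_transpose : poincareEtaᵀ = -poincareEta := by
  ext (i | i) (j | j) <;> simp [poincareEta, mixedForm, Matrix.one_apply, eq_comm]

theorem det_poincareEta_toBlocks₁₂ : poincareEta.toBlocks₁₂.det ≠ 0 := by
  simp [poincareEta, mixedForm, Matrix.det_neg]

theorem isPullback_poincareT : IsPullback 0 0 poincareEta poincareT := by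
  refine (isPullback_blockMap_iff _ _ _ _ _ _ _).mpr ⟨by simp, by simp, ?_⟩
  ext i j
  simp [Matrix.one_apply, apply_ite]

end Deformation

/-! ### Explicit solution of the deformation equations -/

section DeformationSolution

/-- The skew-symmetric matrix with given entries above the diagonal. -/
def skewMatrix (a b c d e f : ℝ) : Matrix (Fin 4) (Fin 4) ℝ :=
  !![0, a, b, c; -a, 0, d, e; -b, -d, 0, f; -c, -e, -f, 0]

theorem eq_skewMatrix {θ : Matrix (Fin 4) (Fin 4) ℝ} (hθ : θᵀ = -θ) :
    θ = skewMatrix (θ 0 1) (θ 0 2) (θ 0 3) (θ 1 2) (θ 1 3) (θ 2 3) := by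
  have h : ∀ i j, θ j i = -θ i j := fun i j => congrFun (congrFun hθ i) j
  have h0 : ∀ i, θ i i = 0 := fun i => by linarith [h i i]
  ext i j
  fin_cases i <;> fin_cases j <;> simp [skewMatrix, h0, ← h]

/-- The strictly upper triangular matrix with given entries above the diagonal. -/
def upperMatrix (a b c d e f : ℝ) : Matrix (Fin 4) (Fin 4) ℝ :=
  !![0, a, b, c; 0, 0, d, e; 0, 0, 0, f; 0, 0, 0, 0]

/-- The first column of a strictly upper triangular A is zero, so the quadratic term AᵗθA has no
first row or column and the first row of A is prescribed outright. What remains is one equation for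
`d` and a linear pair for `e` and `f`, whose solution by elimination gives the denominators
`deformU` and `deformW`. -/
theorem upperMatrix_equation {a b c d e f x₁ x₂ x₃ x₄ x₅ x₆ y₄ y₅ y₆ : ℝ}
    (hd : d - a * x₁ * d = -y₄) (he : e - a * (x₁ * e + x₂ * f) = -y₅)
    (hf : f - (b * (x₁ * e + x₂ * f) + d * (-x₁ * c + x₄ * f)) = -y₆) :
    upperMatrix a b c d e f - (upperMatrix a b c d e f)ᵀ -
      (upperMatrix a b c d e f)ᵀ * (skewMatrix x₁ x₂ x₃ x₄ x₅ x₆ * upperMatrix a b c d e f) =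
      -skewMatrix (-a) (-b) (-c) y₄ y₅ y₆ := by
  ext i j
  fin_cases i <;> fin_cases j <;>
    simp [upperMatrix, skewMatrix, Matrix.mul_apply, Fin.sum_univ_four] <;> linarith

/-- Denominator of the entry `A₂₃`. -/
def deformU (q : Matrix (Fin 4) (Fin 4) ℝ × Matrix (Fin 4) (Fin 4) ℝ) : ℝ :=
  1 + q.2 0 1 * q.1 0 1

/-- The entry `A₂₃`. -/
def deformD (q : Matrix (Fin 4) (Fin 4) ℝ × Matrix (Fin 4) (Fin 4) ℝ) : ℝ :=
  -q.2 1 2 / deformU q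

/-- Denominator of the entry `A₃₄`. -/
def deformW (q : Matrix (Fin 4) (Fin 4) ℝ × Matrix (Fin 4) (Fin 4) ℝ) : ℝ :=
  1 + q.2 0 2 * q.1 0 2 - deformD q * q.1 1 2 -
    q.2 0 1 * q.2 0 2 * q.1 0 1 * q.1 0 2 / deformU q

/-- The entry `A₃₄`. -/
def deformF (q : Matrix (Fin 4) (Fin 4) ℝ × Matrix (Fin 4) (Fin 4) ℝ) : ℝ :=
  (-q.2 2 3 + deformD q * q.1 0 1 * q.2 0 3 + q.2 0 2 * q.1 0 1 * q.2 1 3 / deformU q) / deformW q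

/-- The entry `A₂₄`. -/
def deformE (q : Matrix (Fin 4) (Fin 4) ℝ × Matrix (Fin 4) (Fin 4) ℝ) : ℝ :=
  (-q.2 1 3 - q.2 0 1 * q.1 0 2 * deformF q) / deformU q

/-- A strictly upper triangular solution `A` of `A - Aᵗ - Aᵗ θ A = -θ'`. -/
def deformA (q : Matrix (Fin 4) (Fin 4) ℝ × Matrix (Fin 4) (Fin 4) ℝ) : Matrix (Fin 4) (Fin 4) ℝ :=
  upperMatrix (-q.2 0 1) (-q.2 0 2) (-q.2 0 3) (deformD q) (deformE q) (deformF q)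

theorem deformA_equation {q : Matrix (Fin 4) (Fin 4) ℝ × Matrix (Fin 4) (Fin 4) ℝ}
    (h₁ : q.1ᵀ = -q.1) (h₂ : q.2ᵀ = -q.2) (hU : deformU q ≠ 0) (hW : deformW q ≠ 0) :
    deformA q - (deformA q)ᵀ - (deformA q)ᵀ * (q.1 * deformA q) = -q.2 := by
  have hd : deformD q * deformU q = -q.2 1 2 := div_mul_cancel₀ _ hU
  have he : deformE q * deformU q = -q.2 1 3 - q.2 0 1 * q.1 0 2 * deformF q :=
    div_mul_cancel₀ _ hU
  have hf : deformF q * deformW q = -q.2 2 3 + deformD q * q.1 0 1 * q.2 0 3 +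
      q.2 0 2 * q.1 0 1 * q.2 1 3 / deformU q := div_mul_cancel₀ _ hW
  have he' : deformE q = -(q.2 1 3 / deformU q) - q.2 0 1 * q.1 0 2 * deformF q / deformU q := by
    rw [deformE]; ring
  have hk := upperMatrix_equation (a := -q.2 0 1) (b := -q.2 0 2) (c := -q.2 0 3) (d := deformD q)
    (e := deformE q) (f := deformF q) (x₁ := q.1 0 1) (x₂ := q.1 0 2) (x₃ := q.1 0 3)
    (x₄ := q.1 1 2) (x₅ := q.1 1 3) (x₆ := q.1 2 3) (y₄ := q.2 1 2) (y₅ := q.2 1 3)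
    (y₆ := q.2 2 3) (by rw [← hd, deformU]; ring) (by
      rw [deformU] at he
      linear_combination he) (by
      rw [he']
      rw [deformW] at hf
      linear_combination hf)
  rw [← eq_skewMatrix h₁, neg_neg, neg_neg, neg_neg, ← eq_skewMatrix h₂] at hk
  exact hk

/-- With D = 1, the choice B = -θ/2 settles the equation for θ and the mixed equation forces C = 1 +
θA/2; substituting both, the last equation becomes A - Aᵗ - AᵗθA = -θ'. -/
theorem isPullback_deform {q : Matrix (Fin 4) (Fin 4) ℝ × Matrix (Fin 4) (Fin 4) ℝ}
    (h₁ : q.1ᵀ = -q.1) (h₂ : q.2ᵀ = -q.2) (hU : deformU q ≠ 0) (hW : deformW q ≠ 0) :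
    IsPullback q.1 q.2 poincareEta
      (blockMap (deformA q) (-(1 / 2 : ℝ) • q.1) (1 + (1 / 2 : ℝ) • (q.1 * deformA q)) 1) := by
  refine (isPullback_blockMap_iff _ _ _ _ _ _ _).mpr ⟨?_, ?_, ?_⟩
  · simp only [Matrix.transpose_smul, h₁, Matrix.transpose_one, Matrix.mul_one, Matrix.one_mul]
    module
  · rw [← deformA_equation h₁ h₂ hU hW]
    simp only [Matrix.transpose_add, Matrix.transpose_smul, Matrix.transpose_mul, h₁,
      Matrix.transpose_one, Matrix.add_mul, Matrix.mul_add, Matrix.one_mul, Matrix.mul_one,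
      Matrix.smul_mul, Matrix.mul_smul, Matrix.mul_neg, Matrix.neg_mul, Matrix.mul_assoc]
    module
  · have : ((-1 : Matrix (Fin 4) (Fin 4) ℤ).map fun k : ℤ => (k : ℝ)) = -1 := by
      ext i j
      simp [Matrix.one_apply, apply_ite]
    rw [this]
    simp only [Matrix.transpose_smul, h₁, Matrix.transpose_one, Matrix.one_mul, Matrix.smul_mul,
      Matrix.neg_mul]
    module

/-- Pairs of forms for which the deformation exists. -/
def deformDomain : Set (Matrix (Fin 4) (Fin 4) ℝ × Matrix (Fin 4) (Fin 4) ℝ) :=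
  {q | deformU q ≠ 0 ∧ deformW q ≠ 0 ∧ (fullForm q.1 q.2 poincareEta).det ≠ 0}

theorem continuous_deformU : Continuous deformU := by
  unfold deformU; fun_prop

theorem continuousAt_deformD {q : Matrix (Fin 4) (Fin 4) ℝ × Matrix (Fin 4) (Fin 4) ℝ}
    (hU : deformU q ≠ 0) : ContinuousAt deformD q :=
  ContinuousAt.div (by fun_prop) continuous_deformU.continuousAt hU

theorem continuousAt_deformW {q : Matrix (Fin 4) (Fin 4) ℝ × Matrix (Fin 4) (Fin 4) ℝ}
    (hU : deformU q ≠ 0) : ContinuousAt deformW q :=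
  ContinuousAt.sub (ContinuousAt.sub (by fun_prop) ((continuousAt_deformD hU).mul (by fun_prop)))
    (ContinuousAt.div (by fun_prop) continuous_deformU.continuousAt hU)

theorem continuousAt_deformF {q : Matrix (Fin 4) (Fin 4) ℝ × Matrix (Fin 4) (Fin 4) ℝ}
    (hU : deformU q ≠ 0) (hW : deformW q ≠ 0) : ContinuousAt deformF q :=
  ContinuousAt.div (ContinuousAt.add (ContinuousAt.add (by fun_prop)
    (((continuousAt_deformD hU).mul (by fun_prop)).mul (by fun_prop)))
    (ContinuousAt.div (by fun_prop) continuous_deformU.continuousAt hU))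
    (continuousAt_deformW hU) hW

theorem continuousAt_deformE {q : Matrix (Fin 4) (Fin 4) ℝ × Matrix (Fin 4) (Fin 4) ℝ}
    (hU : deformU q ≠ 0) (hW : deformW q ≠ 0) : ContinuousAt deformE q :=
  ContinuousAt.div (ContinuousAt.sub (by fun_prop)
    (ContinuousAt.mul (by fun_prop) (continuousAt_deformF hU hW)))
    continuous_deformU.continuousAt hU

theorem continuousAt_deformA {q : Matrix (Fin 4) (Fin 4) ℝ × Matrix (Fin 4) (Fin 4) ℝ}
    (hU : deformU q ≠ 0) (hW : deformW q ≠ 0) : ContinuousAt deformA q := by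
  refine continuousAt_pi.mpr fun i => continuousAt_pi.mpr fun j => ?_
  fin_cases i <;> fin_cases j <;> first
    | exact continuousAt_const
    | exact (by fun_prop : ContinuousAt (fun q : Matrix (Fin 4) (Fin 4) ℝ ×
        Matrix (Fin 4) (Fin 4) ℝ => -q.2 0 1) q)
    | exact (by fun_prop : ContinuousAt (fun q : Matrix (Fin 4) (Fin 4) ℝ ×
        Matrix (Fin 4) (Fin 4) ℝ => -q.2 0 2) q)
    | exact (by fun_prop : ContinuousAt (fun q : Matrix (Fin 4) (Fin 4) ℝ ×
        Matrix (Fin 4) (Fin 4) ℝ => -q.2 0 3) q)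
    | exact continuousAt_deformD hU
    | exact continuousAt_deformE hU hW
    | exact continuousAt_deformF hU hW

theorem deformU_zero : deformU 0 = 1 := by simp [deformU]

theorem deformW_zero : deformW 0 = 1 := by simp [deformW]

theorem deformA_zero : deformA 0 = 0 := by
  ext i j
  fin_cases i <;> fin_cases j <;> simp [deformA, upperMatrix, deformD, deformE, deformF]

theorem continuous_fullForm (η : Matrix (Fin 4 ⊕ Fin 4) (Fin 4 ⊕ Fin 4) ℤ) :
    Continuous fun q : Matrix (Fin 4) (Fin 4) ℝ × Matrix (Fin 4) (Fin 4) ℝ =>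
      fullForm q.1 q.2 η := by
  refine Continuous.add ?_ continuous_const
  exact Continuous.matrix_fromBlocks continuous_fst continuous_const continuous_const
    continuous_snd.neg

theorem deformDomain_mem_nhds : deformDomain ∈ 𝓝 0 := by
  have h1 : ∀ᶠ q in 𝓝 0, deformU q ≠ 0 :=
    continuous_deformU.continuousAt.eventually_ne (by simp [deformU_zero])
  have h2 : ∀ᶠ q in 𝓝 0, deformW q ≠ 0 :=
    (continuousAt_deformW (by simp [deformU_zero])).eventually_ne (by simp [deformW_zero])
  have h3 : ∀ᶠ q : Matrix (Fin 4) (Fin 4) ℝ × Matrix (Fin 4) (Fin 4) ℝ in 𝓝 0,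
      (fullForm q.1 q.2 poincareEta).det ≠ 0 :=
    (continuous_fullForm poincareEta).matrix_det.continuousAt.eventually_ne det_fullForm_poincare
  filter_upwards [h1, h2, h3] with q a b c using ⟨a, b, c⟩

theorem exists_smallPairs_subset {S : Set (Matrix (Fin 4) (Fin 4) ℝ × Matrix (Fin 4) (Fin 4) ℝ)}
    (hS : S ∈ 𝓝 0) : ∃ ε, 0 < ε ∧ smallPairs ε ⊆ S := by
  obtain ⟨ε, hε, h⟩ := (Metric.mem_nhds_iff
    (α := (Fin 4 → Fin 4 → ℝ) × (Fin 4 → Fin 4 → ℝ))).mp hS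
  refine ⟨ε, hε, fun q hq => h ?_⟩
  refine (mem_ball_zero_iff (E := (Fin 4 → Fin 4 → ℝ) × (Fin 4 → Fin 4 → ℝ))).mpr (max_lt ?_ ?_)
  · exact (pi_norm_lt_iff hε).mpr fun i => (pi_norm_lt_iff hε).mpr fun j => (hq.2.2 i j).1
  · exact (pi_norm_lt_iff hε).mpr fun i => (pi_norm_lt_iff hε).mpr fun j => (hq.2.2 i j).2

end DeformationSolution

/-! ### Representations are determined by the generators -/

section Generators

variable {ι : Type} [Fintype ι] {θ : Matrix ι ι ℝ}

theorem SmoothTorus.U_mul_U (m n : ι → ℤ) : U θ m * U θ n = torusCocycle θ m n • U θ (m + n) := by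
  classical
  have h : ∀ k l : ι → ℤ, (U θ k).coeff l = if l = k then 1 else 0 := fun k l => by
    split_ifs with hl
    · rw [hl]
      exact Pi.single_eq_same _ _
    · exact Pi.single_eq_of_ne hl _
  ext ν
  rw [mul_coeff, tsum_eq_single m fun l hl => by rw [h, if_neg hl]; ring, smul_coeff, h, h, h,
    if_pos rfl]
  by_cases hν : ν = m + n
  · rw [if_pos hν, if_pos (by rw [hν]; abel), hν, add_sub_cancel_left]
    ring
  · rw [if_neg hν, if_neg fun h' => hν (by rw [← h']; abel)]
    ring

theorem SmoothTorus.torusCocycle_neg_self (hθ : θᵀ = -θ) (m : ι → ℤ) :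
    torusCocycle θ m (-m) = 1 ∧ torusCocycle θ (-m) m = 1 := by
  simp [torusCocycle, latticeVec_neg, formOf_neg_left, formOf_neg_right, formOf_self hθ]

/-- Two representations of a smooth torus which agree on the generators agree on all `U_ν`. -/
theorem SmoothTorus.algHom_U_eq [DecidableEq ι] {R : Type*} [Ring R] [Algebra ℂ R] (hθ : θᵀ = -θ)
    {ρ ρ' : SmoothTorus θ →ₐ[ℂ] R}
    (h : ∀ k, ρ (U θ (Pi.single k 1)) = ρ' (U θ (Pi.single k 1))) (ν : ι → ℤ) :
    ρ (U θ ν) = ρ' (U θ ν) := by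
  -- The indices where the two representations agree form a subgroup: sums because the cocycle is
  -- nonzero, negatives by uniqueness of inverses.
  let S : AddSubgroup (ι → ℤ) :=
    { carrier := {ν | ρ (U θ ν) = ρ' (U θ ν)}
      zero_mem' := (map_one ρ).trans (map_one ρ').symm
      add_mem' := fun {m n} hm hn => by
        have hne : torusCocycle θ m n ≠ 0 := by
          rw [← norm_ne_zero_iff, norm_torusCocycle]; exact one_ne_zero
        have h1 : ρ (U θ m * U θ n) = ρ' (U θ m * U θ n) := by
          rw [map_mul, map_mul]
          exact congrArg₂ _ hm hn
        rw [U_mul_U, map_smul, map_smul] at h1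
        exact smul_right_injective _ hne h1
      neg_mem' := fun {m} hm => by
        have h1 : U θ m * U θ (-m) = 1 := by
          rw [U_mul_U, (torusCocycle_neg_self hθ m).1, one_smul, add_neg_cancel]; rfl
        have h2 : U θ (-m) * U θ m = 1 := by
          rw [U_mul_U, (torusCocycle_neg_self hθ m).2, one_smul, neg_add_cancel]; rfl
        refine left_inv_eq_right_inv (a := ρ (U θ m)) ?_ ?_
        · rw [← map_mul, h2, map_one]
        · rw [show ρ (U θ m) = ρ' (U θ m) from hm, ← map_mul, h1, map_one] }
  change ν ∈ S
  rw [← Finset.univ_sum_single ν]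
  refine S.sum_mem fun i _ => ?_
  have : Pi.single i (ν i) = ν i • (Pi.single i 1 : ι → ℤ) := by simp [← Pi.single_smul]
  rw [this]
  exact S.zsmul_mem (h i) _

end Generators

/-! ### Removing an integral form by signs -/

section IntegralTwist

variable {ι : Type} [Fintype ι]

theorem exists_integral_half {η : Matrix ι ι ℤ} (hη : ηᵀ = -η) :
    ∃ N : Matrix ι ι ℤ, η = N - Nᵀ := by
  classical
  let e := Fintype.equivFin ι
  refine ⟨Matrix.of fun i j => if e i < e j then η i j else 0, ?_⟩
  have h : ∀ i j, η j i = -η i j := fun i j => congrFun (congrFun hη i) j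
  ext i j
  simp only [Matrix.sub_apply, Matrix.of_apply, Matrix.transpose_apply]
  rcases lt_trichotomy (e i) (e j) with hij | hij | hij
  · rw [if_pos hij, if_neg hij.not_gt, sub_zero]
  · have := e.injective hij
    subst this
    simp only [lt_irrefl, if_false, sub_self]
    linarith [h i i]
  · rw [if_neg hij.not_gt, if_pos hij, h, zero_sub]

/-- The sign `exp (π i ⟨ν, N ν⟩)`. -/
def signTwist (N : Matrix ι ι ℤ) (ν : ι → ℤ) : ℂ :=
  Complex.exp (Real.pi * Complex.I * ((ν ⬝ᵥ (N *ᵥ ν) : ℤ) : ℂ))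

theorem norm_signTwist (N : Matrix ι ι ℤ) (ν : ι → ℤ) : ‖signTwist N ν‖ = 1 := by
  have : signTwist N ν = Complex.exp (((Real.pi * (ν ⬝ᵥ (N *ᵥ ν) : ℤ) : ℝ) : ℂ) * Complex.I) := by
    rw [signTwist]; congr 1; push_cast; ring
  rw [this, Complex.norm_exp_ofReal_mul_I]

theorem formOf_intCast (η : Matrix ι ι ℤ) (m n : ι → ℤ) :
    formOf (η.map fun k : ℤ => (k : ℝ)) (latticeVec m) (latticeVec n) = (m ⬝ᵥ (η *ᵥ n) : ℤ) := by
  simp [formOf, latticeVec, dotProduct, Matrix.mulVec]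

/-- The function ν ↦ ⟨ν, Nν⟩ is a quadratic refinement of η modulo 2: its polarization is η plus an
even term, which exp(πi·) does not see. -/
theorem signTwist_mul {η N : Matrix ι ι ℤ} (h : η = N - Nᵀ) (m n : ι → ℤ) :
    signTwist N m * signTwist N n * torusCocycle (η.map fun k : ℤ => (k : ℝ)) m n =
      signTwist N (m + n) := by
  have e : n ⬝ᵥ (N *ᵥ m) = m ⬝ᵥ (Nᵀ *ᵥ n) := by
    rw [Matrix.dotProduct_mulVec, ← Matrix.mulVec_transpose, dotProduct_comm]
  have hq : (m + n) ⬝ᵥ (N *ᵥ (m + n)) =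
      m ⬝ᵥ (N *ᵥ m) + n ⬝ᵥ (N *ᵥ n) + m ⬝ᵥ (η *ᵥ n) + 2 * (m ⬝ᵥ (Nᵀ *ᵥ n)) := by
    rw [h, Matrix.sub_mulVec, Matrix.mulVec_add, dotProduct_sub, add_dotProduct, dotProduct_add,
      dotProduct_add, e]
    ring
  rw [signTwist, signTwist, signTwist, torusCocycle, formOf_intCast, hq, ← Complex.exp_add,
    ← Complex.exp_add, ← mul_one (Complex.exp _),
    ← Complex.exp_int_mul_two_pi_mul_I (m ⬝ᵥ (Nᵀ *ᵥ n)), ← Complex.exp_add]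
  congr 1
  push_cast
  ring

/-- The character of `ℤ^ι` with given values on the generators. -/
def latticeCharacter (z : ι → ℂ) (ν : ι → ℤ) : ℂ := ∏ i, z i ^ ν i

theorem latticeCharacter_add {z : ι → ℂ} (hz : ∀ i, z i ≠ 0) (m n : ι → ℤ) :
    latticeCharacter z (m + n) = latticeCharacter z m * latticeCharacter z n := by
  rw [latticeCharacter, latticeCharacter, latticeCharacter, ← Finset.prod_mul_distrib]
  exact Finset.prod_congr rfl fun i _ => zpow_add₀ (hz i) _ _

theorem latticeCharacter_single [DecidableEq ι] (z : ι → ℂ) (k : ι) :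
    latticeCharacter z (Pi.single k 1) = z k := by
  rw [latticeCharacter, Finset.prod_eq_single k (fun i _ hi => by simp [hi]) (by simp)]
  simp

/-- If `T^* Ω` differs from `θ` by an integral form, then there are phases for which the `T(ν)`
represent the torus of `θ` and the generators are represented by the `T(e_k)`. -/
theorem exists_isWeylSystem [DecidableEq ι] {θ : Matrix ι ι ℝ} {η : Matrix ι ι ℤ} (hη : ηᵀ = -η)
    {T : (ι → ℝ) →ₗ[ℝ] Phase}
    (hT : ∀ v w, Omega (T v) (T w) = formOf (θ + η.map fun k : ℤ => (k : ℝ)) v w) :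
    ∃ c, IsWeylSystem θ T c ∧ ∀ k, c (Pi.single k 1) = 1 := by
  obtain ⟨N, hN⟩ := exists_integral_half hη
  -- The symmetrized phase realizes the cocycle of θ + η, and the sign cancels the η part.
  let c₀ : (ι → ℤ) → ℂ := fun ν => signTwist N ν * weylPhase T ν
  have hc₀ : ∀ ν, ‖c₀ ν‖ = 1 := fun ν => by
    rw [norm_mul, norm_signTwist, norm_weylPhase, one_mul]
  have hmul : ∀ m n, c₀ m * c₀ n *
      Complex.exp (linPhase (T (latticeVec n)).2 (T (latticeVec m)).1) =
      torusCocycle θ m n * c₀ (m + n) := fun m n => by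
    have h1 := weylPhase_mul T m n
    have h2 : Complex.exp (Real.pi * Complex.I *
        (Omega (T (latticeVec m)) (T (latticeVec n)) : ℝ)) =
        torusCocycle θ m n * torusCocycle (η.map fun k : ℤ => (k : ℝ)) m n := by
      rw [hT, torusCocycle, torusCocycle, ← Complex.exp_add, formOf, formOf, formOf,
        Matrix.add_mulVec, dotProduct_add]
      congr 1
      push_cast
      ring
    rw [h2] at h1
    calc _ = signTwist N m * signTwist N n * (weylPhase T m * weylPhase T n *
          Complex.exp (linPhase (T (latticeVec n)).2 (T (latticeVec m)).1)) := by
          simp only [c₀]; ring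
      _ = torusCocycle θ m n * ((signTwist N m * signTwist N n *
          torusCocycle (η.map fun k : ℤ => (k : ℝ)) m n) * weylPhase T (m + n)) := by rw [h1]; ring
      _ = _ := by rw [signTwist_mul hN]
  have hz : ∀ k, (c₀ (Pi.single k 1))⁻¹ ≠ 0 := fun k => by
    rw [← norm_ne_zero_iff, norm_inv, hc₀]; norm_num
  -- Multiplying by a character leaves the cocycle unchanged and is used to make the phases of the
  -- generators equal to 1.
  refine ⟨fun ν => latticeCharacter (fun k => (c₀ (Pi.single k 1))⁻¹) ν * c₀ ν, ⟨fun ν => ?_, ?_,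
    fun m n => ?_⟩, fun k => ?_⟩
  · rw [norm_mul, hc₀, mul_one, latticeCharacter, norm_prod]
    exact Finset.prod_eq_one fun i _ => by rw [norm_zpow, norm_inv, hc₀]; simp
  · simp [c₀, latticeCharacter, signTwist, weylPhase, latticeVec_zero, linPhase_zero_left]
  · rw [latticeCharacter_add hz]
    linear_combination latticeCharacter (fun k => (c₀ (Pi.single k 1))⁻¹) m *
      latticeCharacter (fun k => (c₀ (Pi.single k 1))⁻¹) n * hmul m n
  · beta_reduce
    rw [latticeCharacter_single]
    exact inv_mul_cancel₀ (inv_eq_zero.not.mp (hz k))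

end IntegralTwist

/-! ### Assembly of the elementary modules -/

section ElementaryModules

variable {θ θ' : Matrix (Fin 4) (Fin 4) ℝ} {T : V8 →ₗ[ℝ] Phase} {c : (Fin 4 ⊕ Fin 4 → ℤ) → ℂ}

theorem latticeVec_single {ι : Type} [DecidableEq ι] (k : ι) :
    latticeVec (Pi.single k 1 : ι → ℤ) = Pi.single k 1 := by
  ext i
  simp [latticeVec, Pi.single_apply]

theorem IsWeylSystem.isElementaryAction (hW : IsWeylSystem (twoForm θ θ') T c)
    (hc : ∀ k, c (Pi.single k 1) = 1) : IsElementaryAction θ θ' T hW.action where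
  generator k f := by rw [hW.action_U, weylOp_apply, hc, one_smul, latticeVec_single]
  hasSum a f := (hW.action_hasSum a f).congr_fun fun ν => by rw [hW.action_U]

/-- The generators determine every `U_ν`, and the prescribed convergence determines the rest. -/
theorem IsElementaryAction.unique (hθ : θᵀ = -θ) (hθ' : θ'ᵀ = -θ')
    {ρ ρ' : SmoothTorus (twoForm θ θ') →ₐ[ℂ] Module.End ℂ 𝓢(V4, ℂ)}
    (h : IsElementaryAction θ θ' T ρ) (h' : IsElementaryAction θ θ' T ρ') : ρ = ρ' := by
  have hU := algHom_U_eq (twoForm_transpose hθ hθ') (ρ := ρ) (ρ' := ρ') fun k =>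
    LinearMap.ext fun f => (h.generator k f).trans (h'.generator k f).symm
  refine AlgHom.ext fun a => LinearMap.ext fun f => (h.hasSum a f).unique ?_
  simp only [hU]
  exact h'.hasSum a f

theorem latticeVec_elim_zero (ν : Fin 4 → ℤ) :
    latticeVec (Sum.elim ν 0) = inlMap (latticeVec ν) := by
  ext (i | i) <;> simp [latticeVec, inlMap]

theorem latticeVec_zero_elim (ν : Fin 4 → ℤ) :
    latticeVec (Sum.elim 0 ν) = inrMap (latticeVec ν) := by
  ext (i | i) <;> simp [latticeVec, inrMap]

theorem formOf_twoForm (w₁ w₂ ν μ : V4) :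
    formOf (twoForm θ θ') (Sum.elim w₁ w₂) (Sum.elim ν μ) = formOf θ w₁ ν + formOf (-θ') w₂ μ := by
  rw [formOf_elim_left]
  simp [twoForm, formOf]

theorem torusCocycle_inl (m n : Fin 4 → ℤ) :
    torusCocycle (twoForm θ θ') (Sum.elim m 0) (Sum.elim n 0) = torusCocycle θ m n := by
  rw [torusCocycle, latticeVec_elim_zero, latticeVec_elim_zero]
  change Complex.exp (_ * ((formOf _ (Sum.elim _ 0) (Sum.elim _ 0) : ℝ) : ℂ)) = _
  rw [formOf_twoForm]
  simp [torusCocycle, formOf]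

theorem torusCocycle_inr (m n : Fin 4 → ℤ) :
    torusCocycle (twoForm θ θ') (Sum.elim 0 m) (Sum.elim 0 n) = torusCocycle (-θ') m n := by
  rw [torusCocycle, latticeVec_zero_elim, latticeVec_zero_elim]
  change Complex.exp (_ * ((formOf _ (Sum.elim 0 _) (Sum.elim 0 _) : ℝ) : ℂ)) = _
  rw [formOf_twoForm]
  simp [torusCocycle, formOf]

theorem torusCocycle_inl_inr (m n : Fin 4 → ℤ) :
    torusCocycle (twoForm θ θ') (Sum.elim m 0) (Sum.elim 0 n) = 1 ∧
      torusCocycle (twoForm θ θ') (Sum.elim 0 n) (Sum.elim m 0) = 1 := by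
  constructor
  · rw [torusCocycle, latticeVec_elim_zero, latticeVec_zero_elim]
    change Complex.exp (_ * ((formOf _ (Sum.elim _ 0) (Sum.elim 0 _) : ℝ) : ℂ)) = _
    rw [formOf_twoForm]
    simp [formOf]
  · rw [torusCocycle, latticeVec_elim_zero, latticeVec_zero_elim]
    change Complex.exp (_ * ((formOf _ (Sum.elim 0 _) (Sum.elim _ 0) : ℝ) : ℂ)) = _
    rw [formOf_twoForm]
    simp [formOf]

theorem elim_add_elim {α : Type*} [AddMonoid α] (a b : Fin 4 → α) (a' b' : Fin 4 → α) :
    Sum.elim a a' + Sum.elim b b' = Sum.elim (a + b) (a' + b') := by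
  ext (i | i) <;> rfl

theorem weylOp_inl (ν : Fin 4 → ℤ) :
    weylOp (T ∘ₗ inlMap) (fun ν => c (Sum.elim ν 0)) ν = weylOp T c (Sum.elim ν 0) := by
  rw [weylOp, weylOp, latticeVec_elim_zero]
  rfl

theorem weylOp_inr (ν : Fin 4 → ℤ) :
    weylOp (T ∘ₗ inrMap) (fun ν => c (Sum.elim 0 ν)) ν = weylOp T c (Sum.elim 0 ν) := by
  rw [weylOp, weylOp, latticeVec_zero_elim]
  rfl

theorem IsWeylSystem.inl (hW : IsWeylSystem (twoForm θ θ') T c) :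
    IsWeylSystem θ (T ∘ₗ inlMap) fun ν => c (Sum.elim ν 0) where
  norm_eq_one ν := hW.norm_eq_one _
  map_zero := by rw [Sum.elim_zero_zero, hW.map_zero]
  mul m n := by
    have h := hW.mul (Sum.elim m 0) (Sum.elim n 0)
    rw [torusCocycle_inl, latticeVec_elim_zero, latticeVec_elim_zero, elim_add_elim, add_zero] at h
    exact h

/-- The second summand carries the form -θ', which is that of the opposite torus; this is where the
right action of the torus of θ' comes from. -/
theorem IsWeylSystem.inr (hW : IsWeylSystem (twoForm θ θ') T c) :
    IsWeylSystem (-θ') (T ∘ₗ inrMap) fun ν => c (Sum.elim 0 ν) where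
  norm_eq_one ν := hW.norm_eq_one _
  map_zero := by rw [Sum.elim_zero_zero, hW.map_zero]
  mul m n := by
    have h := hW.mul (Sum.elim 0 m) (Sum.elim 0 n)
    rw [torusCocycle_inr, latticeVec_zero_elim, latticeVec_zero_elim, elim_add_elim, add_zero] at h
    exact h

theorem SmoothTorus.delta_zero {ι : Type} [Fintype ι] {θ : Matrix ι ι ℝ} (a : SmoothTorus θ) :
    delta 0 a = 0 := by
  ext ν
  simp [delta_coeff]

theorem IsWeylSystem.isElementaryModule (hθ : θᵀ = -θ) (hθ' : θ'ᵀ = -θ')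
    (hW : IsWeylSystem (twoForm θ θ') T c) (hc : ∀ k, c (Pi.single k 1) = 1)
    {V₁ V₂ : V4 →ₗ[ℝ] Phase} (h₁ : IsV₁ T V₁) (h₂ : IsV₂ T V₂) :
    IsElementaryModule θ θ' T V₁ V₂ hW.action hW.inl.action (hW.inr.action.comp (opTorus hθ'))
      (hW.ip _ (Omega_dual_single (Omega_sumMap h₁ h₂))) where
  isV₁ := h₁
  isV₂ := h₂
  action := hW.isElementaryAction hc
  phase ν := ⟨c ν, hW.norm_eq_one ν, fun f => by rw [hW.action_U, weylOp_apply]⟩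
  left_hasSum a f := (hW.inl.action_hasSum a f).congr_fun fun ν => by rw [hW.action_U, weylOp_inl]
  right_hasSum b f := (hW.inr.action_hasSum (opTorus hθ' (MulOpposite.op b)) f).congr_fun fun ν => by
    rw [hW.action_U, weylOp_inr, opTorus_coeff]
  -- The form has no mixed part, so both cross cocycles equal 1 and the two families of generators
  -- commute.
  bimodule a b f := hW.inl.action_comm hW.inr (fun m n f => by
    rw [weylOp_inl, weylOp_inr, hW.weylOp_weylOp, hW.weylOp_weylOp, (torusCocycle_inl_inr m n).1,
      (torusCocycle_inl_inr m n).2, add_comm]) a (opTorus hθ' b) f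
  nabla_left α a f := hW.inl.Qop_action (V₁ α) α (fun ν => h₁ α (latticeVec ν) 0) a f
  nabla_right α b f := by
    -- V₁(α) is Ω-orthogonal to T(0, ν), so the Leibniz rule holds with the zero derivation.
    have h := hW.inr.Qop_action (V₁ α) 0 (fun ν => by
      rw [zero_dotProduct, ← dotProduct_zero α]; exact h₁ α 0 (latticeVec ν)) (opTorus hθ' b) f
    rw [delta_zero, _root_.map_zero, LinearMap.zero_apply, add_zero] at h
    exact h
  nablaHat_right β b f := hW.inr.Qop_action (V₂ β) β (fun ν => h₂ β 0 (latticeVec ν))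
    (opTorus hθ' (MulOpposite.op b)) f
  nablaHat_left β a f := by
    have h := hW.inl.Qop_action (V₂ β) 0 (fun ν => by
      rw [zero_dotProduct, ← dotProduct_zero β]; exact h₂ β (latticeVec ν) 0) a f
    rw [delta_zero, _root_.map_zero, LinearMap.zero_apply, add_zero] at h
    exact h
  ip_coeff f g ν := by rw [hW.action_U]; rfl
  constantCurvature := by
    have h : nablaSum V₁ V₂ = fun γ => (Qop (sumMap V₁ V₂ γ)).toLinearMap :=
      funext fun γ => nablaSum_eq V₁ V₂ γ
    rw [h]
    exact isConstantCurvatureModule (twoForm_transpose hθ hθ') (Omega_sumMap h₁ h₂) hW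
  mixed α β := LinearMap.ext fun f => Qop_Qop (V₁ α) (V₂ β) f

variable {η : Matrix (Fin 4 ⊕ Fin 4) (Fin 4 ⊕ Fin 4) ℤ}

theorem existsUnique_elementaryAction (hθ : θᵀ = -θ) (hθ' : θ'ᵀ = -θ') (hη : ηᵀ = -η)
    (hT : IsPullback θ θ' η T) : ∃! ρ, IsElementaryAction θ θ' T ρ := by
  obtain ⟨c, hW, hc⟩ := exists_isWeylSystem hη hT
  exact ⟨_, hW.isElementaryAction hc, fun ρ hρ => hρ.unique hθ hθ' (hW.isElementaryAction hc)⟩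

theorem exists_elementaryModule (hθ : θᵀ = -θ) (hθ' : θ'ᵀ = -θ') (hη : ηᵀ = -η)
    (hT : IsPullback θ θ' η T) (hdet : (fullForm θ θ' η).det ≠ 0) :
    ∃ V₁ V₂ ρ ρ₁ ρ₂ ip, IsElementaryModule θ θ' T V₁ V₂ ρ ρ₁ ρ₂ ip := by
  obtain ⟨c, hW, hc⟩ := exists_isWeylSystem hη hT
  obtain ⟨V₁, h₁, -⟩ := existsUnique_V₁ hdet hT
  obtain ⟨V₂, h₂, -⟩ := existsUnique_V₂ hdet hT
  exact ⟨V₁, V₂, _, _, _, _, hW.isElementaryModule hθ hθ' hc h₁ h₂⟩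

end ElementaryModules

/-! ### The Zak transform of Schwartz functions -/

section ZakTransform

theorem schwartz_decay_le (φ : 𝓢(V4, ℂ)) (n : ℕ) (z : V4) :
    (1 + ‖z‖) ^ n * ‖φ z‖ ≤
      2 ^ n * (Finset.Iic (n, 0)).sup (fun m => SchwartzMap.seminorm ℂ m.1 m.2) φ := by
  have h := SchwartzMap.one_add_le_sup_seminorm_apply (𝕜 := ℂ) (m := (n, 0)) (le_refl n)
    (le_refl 0) φ z
  rwa [norm_iteratedFDeriv_zero] at h

theorem schwartz_fderiv_decay (φ : 𝓢(V4, ℂ)) (n : ℕ) :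
    ∃ C, ∀ z, (1 + ‖z‖) ^ n * ‖fderiv ℝ φ z‖ ≤ C :=
  ⟨_, fun z => by
    have h := SchwartzMap.one_add_le_sup_seminorm_apply (𝕜 := ℂ) (m := (n, 1)) (le_refl n)
      (le_refl 1) φ z
    rwa [norm_iteratedFDeriv_one] at h⟩

/-- The function `∑_μ exp (2 π i ⟨μ, x⟩) φ(x̂ + μ)`. -/
def zakFun (φ : 𝓢(V4, ℂ)) (p : Phase) : ℂ :=
  ∑' μ : Fin 4 → ℤ, latticeChar μ p.1 * φ (p.2 + latticeVec μ)

theorem summable_norm_zak (φ : 𝓢(V4, ℂ)) (y : V4) :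
    Summable fun μ : Fin 4 → ℤ => ‖φ (y + latticeVec μ)‖ :=
  (summable_translates (schwartz_decay_le φ _) y).norm

theorem summable_zak (φ : 𝓢(V4, ℂ)) (p : Phase) :
    Summable fun μ : Fin 4 → ℤ => latticeChar μ p.1 * φ (p.2 + latticeVec μ) :=
  Summable.of_norm ((summable_norm_zak φ p.2).congr fun μ => by
    rw [norm_mul, norm_latticeChar, one_mul])

theorem hasSum_zak (φ : 𝓢(V4, ℂ)) (p : Phase) :
    HasSum (fun μ : Fin 4 → ℤ => latticeChar μ p.1 * φ (p.2 + latticeVec μ)) (zakFun φ p) :=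
  (summable_zak φ p).hasSum

/-- The real linear function `linPhase y`. -/
def linPhaseCLM (y : V4) : V4 →L[ℝ] ℂ :=
  LinearMap.toContinuousLinearMap
    { toFun := linPhase y
      map_add' := linPhase_add_right y
      map_smul' := fun r u => by simp [linPhase_smul_right] }

theorem linPhaseCLM_apply (y z : V4) : linPhaseCLM y z = linPhase y z := rfl

theorem norm_linPhaseCLM_le (y : V4) : ‖linPhaseCLM y‖ ≤ 8 * Real.pi * ‖y‖ := by
  refine ContinuousLinearMap.opNorm_le_bound _ (by positivity) fun z => ?_
  have h := dotProduct_abs_le y z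
  rw [linPhaseCLM_apply, linPhase, norm_mul, Complex.norm_real, Real.norm_eq_abs]
  have h2 : ‖2 * (Real.pi : ℂ) * Complex.I‖ = 2 * Real.pi := by
    simp [abs_of_pos Real.pi_pos]
  rw [h2]
  nlinarith [Real.pi_pos]

/-- The derivative of a term of `zakFun`. -/
def zakDeriv (φ : 𝓢(V4, ℂ)) (μ : Fin 4 → ℤ) (p : Phase) : Phase →L[ℝ] ℂ :=
  latticeChar μ p.1 • (φ (p.2 + latticeVec μ) •
    (linPhaseCLM (latticeVec μ) ∘L ContinuousLinearMap.fst ℝ V4 V4) +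
      fderiv ℝ φ (p.2 + latticeVec μ) ∘L ContinuousLinearMap.snd ℝ V4 V4)

theorem hasFDerivAt_zakTerm (φ : 𝓢(V4, ℂ)) (μ : Fin 4 → ℤ) (p : Phase) :
    HasFDerivAt (fun p : Phase => latticeChar μ p.1 * φ (p.2 + latticeVec μ)) (zakDeriv φ μ p) p := by
  have h1 : HasFDerivAt (fun p : Phase => latticeChar μ p.1)
      (latticeChar μ p.1 • (linPhaseCLM (latticeVec μ) ∘L ContinuousLinearMap.fst ℝ V4 V4)) p :=
    ((linPhaseCLM (latticeVec μ)).hasFDerivAt.comp p hasFDerivAt_fst).cexp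
  have h2 : HasFDerivAt (fun p : Phase => φ (p.2 + latticeVec μ))
      (fderiv ℝ φ (p.2 + latticeVec μ) ∘L ContinuousLinearMap.snd ℝ V4 V4) p :=
    (φ.hasFDerivAt (p.2 + latticeVec μ)).comp p (hasFDerivAt_snd.add_const _)
  refine (h1.mul h2).congr_fderiv ?_
  rw [zakDeriv, smul_add, smul_smul, smul_smul, add_comm, mul_comm (φ _)]

theorem exists_zakDeriv_bound (φ : 𝓢(V4, ℂ)) (R : ℝ) :
    ∃ u : (Fin 4 → ℤ) → ℝ, Summable u ∧ ∀ μ (p : Phase), ‖p.2‖ ≤ R → ‖zakDeriv φ μ p‖ ≤ u μ := by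
  obtain ⟨C', hC'⟩ := schwartz_fderiv_decay φ (Fintype.card (Fin 4) + 1)
  -- One power more than summability needs, since differentiating the character in x produces a
  -- factor of size ‖μ‖.
  obtain ⟨C, hC⟩ : ∃ C, ∀ z, (1 + ‖z‖) ^ (Fintype.card (Fin 4) + 2) * ‖φ z‖ ≤ C :=
    ⟨_, schwartz_decay_le φ _⟩
  refine ⟨fun μ => (8 * Real.pi * ((1 + R) ^ (Fintype.card (Fin 4) + 2) * C) +
    (1 + R) ^ (Fintype.card (Fin 4) + 1) * C') * ((1 + ‖μ‖) ^ (Fintype.card (Fin 4) + 1))⁻¹,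
    summable_lattice.mul_left _, fun μ p hp => ?_⟩
  have hR : 0 ≤ R := (norm_nonneg _).trans hp
  have hC0 : 0 ≤ C := le_trans (by positivity) (hC 0)
  have h1 := norm_translate_le hC hp μ
  have h2 := norm_translate_le (F := fun z => ((‖fderiv ℝ φ z‖ : ℝ) : ℂ)) (C := C')
    (n := Fintype.card (Fin 4) + 1)
    (fun z => by rw [Complex.norm_real, norm_norm]; exact hC' z) hp μ
  rw [Complex.norm_real, norm_norm] at h2
  rw [zakDeriv, norm_smul, norm_latticeChar, one_mul]
  beta_reduce
  rw [add_mul]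
  refine (norm_add_le _ _).trans (add_le_add ?_ ?_)
  · rw [norm_smul]
    have h3 : ‖linPhaseCLM (latticeVec μ) ∘L ContinuousLinearMap.fst ℝ V4 V4‖ ≤
        8 * Real.pi * (1 + ‖μ‖) := by
      refine (ContinuousLinearMap.opNorm_comp_le _ _).trans ?_
      have := norm_linPhaseCLM_le (latticeVec μ)
      rw [norm_latticeVec] at this
      have h4 := ContinuousLinearMap.norm_fst_le ℝ V4 V4
      calc _ ≤ 8 * Real.pi * ‖μ‖ * 1 := by gcongr
        _ ≤ _ := by nlinarith [Real.pi_pos]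
    calc _ ≤ (1 + R) ^ (Fintype.card (Fin 4) + 2) * C *
          ((1 + ‖μ‖) ^ (Fintype.card (Fin 4) + 2))⁻¹ * (8 * Real.pi * (1 + ‖μ‖)) := by gcongr
      _ = _ := by
        have : 1 + ‖μ‖ ≠ 0 := by positivity
        rw [pow_succ (1 + ‖μ‖) (Fintype.card (Fin 4) + 1)]
        field_simp
  · refine (ContinuousLinearMap.opNorm_comp_le _ _).trans ?_
    have h4 := ContinuousLinearMap.norm_snd_le ℝ V4 V4
    calc _ ≤ ‖fderiv ℝ φ (p.2 + latticeVec μ)‖ * 1 := by gcongr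
      _ ≤ _ := by rw [mul_one]; exact h2

theorem hasFDerivAt_zakFun (φ : 𝓢(V4, ℂ)) (p : Phase) :
    HasFDerivAt (zakFun φ) (∑' μ, zakDeriv φ μ p) p := by
  obtain ⟨u, hu, hb⟩ := exists_zakDeriv_bound φ (‖p‖ + 1)
  refine hasFDerivAt_tsum_of_isPreconnected (s := Metric.ball 0 (‖p‖ + 1)) hu Metric.isOpen_ball
    (convex_ball _ _).isPreconnected (fun μ x _ => hasFDerivAt_zakTerm φ μ x)
    (fun μ x hx => hb μ x ?_) (x₀ := p) ?_ (summable_zak φ p) ?_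
  · rw [mem_ball_zero_iff] at hx
    exact (norm_snd_le x).trans hx.le
  · simp
  · simp

/-- Differentiating the character brings down μ = (x̂ + μ) - x̂: the first part is absorbed into
`Qop`, the second leaves the sum. Derivatives are thus again Zak transforms with smooth
coefficients, which drives the induction in `contDiff_zakFun`. -/
theorem fderiv_zakFun (φ : 𝓢(V4, ℂ)) (p w : Phase) :
    fderiv ℝ (zakFun φ) p w = zakFun (Qop (w.2, w.1) φ) p - linPhase w.1 p.2 * zakFun φ p := by
  obtain ⟨u, hu, hb⟩ := exists_zakDeriv_bound φ ‖p.2‖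
  have hs : Summable fun μ => zakDeriv φ μ p :=
    Summable.of_norm_bounded hu fun μ => hb μ p le_rfl
  rw [(hasFDerivAt_zakFun φ p).fderiv]
  refine (hs.hasSum.mapL (ContinuousLinearMap.apply ℝ ℂ w)).unique
    (((hasSum_zak (Qop (w.2, w.1) φ) p).sub ((hasSum_zak φ p).mul_left (linPhase w.1 p.2))).congr_fun
      fun μ => ?_)
  simp only [ContinuousLinearMap.apply_apply, zakDeriv, smul_apply, add_apply,
    ContinuousLinearMap.comp_apply, ContinuousLinearMap.coe_fst', ContinuousLinearMap.coe_snd',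
    smul_eq_mul, linPhaseCLM_apply, Qop_apply', linPhase_add_right,
    linPhase_comm (latticeVec μ) w.1]
  ring

theorem contDiff_zakFun (φ : 𝓢(V4, ℂ)) : ContDiff ℝ ∞ (zakFun φ) := by
  rw [contDiff_infty]
  intro n
  induction n generalizing φ with
  | zero =>
    exact contDiff_zero.mpr (Differentiable.continuous fun p =>
      (hasFDerivAt_zakFun φ p).differentiableAt)
  | succ n ih =>
    push_cast
    refine contDiff_succ_iff_fderiv_apply.mpr
      ⟨fun p => (hasFDerivAt_zakFun φ p).differentiableAt, by simp, fun w => ?_⟩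
    simp only [fderiv_zakFun]
    exact (ih _).sub (((linPhaseCLM w.1).contDiff.comp contDiff_snd).mul (ih φ))

theorem zakFun_quasiperiodic (φ : 𝓢(V4, ℂ)) (x y : V4) (l m : Fin 4 → ℤ) :
    zakFun φ (x + latticeVec l, y + latticeVec m) =
      Complex.exp (-linPhase (latticeVec m) x) * zakFun φ (x, y) := by
  have h : Complex.exp (-linPhase (latticeVec m) x) = latticeChar (-m) x := by
    rw [← linPhase_neg_left, ← latticeVec_neg]; rfl
  rw [h, zakFun, zakFun, ← tsum_mul_left, ← (Equiv.subRight m).tsum_eq]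
  refine tsum_congr fun μ => ?_
  have h2 : latticeChar (μ - m) x = latticeChar (-m) x * latticeChar μ x := by
    rw [latticeChar, latticeChar, latticeChar, ← Complex.exp_add, latticeVec_sub, latticeVec_neg,
      sub_dotProduct, neg_dotProduct]
    congr 1
    push_cast
    ring
  have h3 : y + latticeVec m + latticeVec (μ - m) = y + latticeVec μ := by
    rw [latticeVec_sub]; abel
  simp only [Equiv.subRight_apply, latticeChar_add, latticeChar_lattice, mul_one, h2, h3]
  ring

theorem zakFun_mem (φ : 𝓢(V4, ℂ)) : zakFun φ ∈ PoincareModule :=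
  ⟨contDiff_zakFun φ, zakFun_quasiperiodic φ⟩

/-- Evaluation of `zakFun` at a point, as a continuous functional. -/
def zakCLM (p : Phase) : 𝓢(V4, ℂ) →L[ℂ] ℂ :=
  SchwartzMap.mkCLMtoNormedSpace (fun φ => zakFun φ p)
    (fun φ ψ => (hasSum_zak (φ + ψ) p).unique
      (((hasSum_zak φ p).add (hasSum_zak ψ p)).congr_fun fun μ => by simp [mul_add]))
    (fun a φ => (hasSum_zak (a • φ) p).unique
      (((hasSum_zak φ p).mul_left a).congr_fun fun μ => by
        simp only [smul_apply, smul_eq_mul]; ring))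
    ⟨Finset.Iic (Fintype.card (Fin 4) + 1, 0), (1 + ‖p.2‖) ^ (Fintype.card (Fin 4) + 1) *
      2 ^ (Fintype.card (Fin 4) + 1) * ∑' μ : Fin 4 → ℤ, ((1 + ‖μ‖) ^ (Fintype.card (Fin 4) + 1))⁻¹,
      mul_nonneg (by positivity) (tsum_nonneg fun μ => by positivity), fun φ => by
        have h := tsum_of_norm_bounded ((summable_lattice (ι := Fin 4)).hasSum.mul_left
          ((1 + ‖p.2‖) ^ (Fintype.card (Fin 4) + 1) * (2 ^ (Fintype.card (Fin 4) + 1) *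
            (Finset.Iic (Fintype.card (Fin 4) + 1, 0)).sup
              (fun m => SchwartzMap.seminorm ℂ m.1 m.2) φ)))
          (f := fun μ => latticeChar μ p.1 * φ (p.2 + latticeVec μ)) fun μ => by
            rw [norm_mul, norm_latticeChar, one_mul]
            exact norm_translate_le (schwartz_decay_le φ _) le_rfl μ
        refine h.trans_eq ?_
        change _ = _ * (Finset.Iic (Fintype.card (Fin 4) + 1, 0)).sup
          (fun m => SchwartzMap.seminorm ℂ m.1 m.2) φ
        ring⟩

theorem zakCLM_apply (p : Phase) (φ : 𝓢(V4, ℂ)) : zakCLM p φ = zakFun φ p := rfl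

end ZakTransform
-- Integrals over the unit cube
section CubeIntegrals

/-- The divergence theorem for a field with a single nonzero component: the two opposite faces
cancel by periodicity. -/
theorem integral_cube_fderiv_single {F : V4 → ℂ} (hF : ContDiff ℝ 1 F)
    (hp : ∀ x (l : Fin 4 → ℤ), F (x + latticeVec l) = F x) (j : Fin 4) :
    ∫ x in Set.Icc (0 : V4) 1, fderiv ℝ F x (Pi.single j 1) = 0 := by
  have hdiff : Differentiable ℝ F := hF.differentiable one_ne_zero
  have hsum : ∀ x : V4, ∑ i, (if i = j then fderiv ℝ F x else 0) (Pi.single i 1) =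
      fderiv ℝ F x (Pi.single j 1) := fun x => by
    rw [Finset.sum_eq_single j (fun i _ hi => by simp [hi]) (by simp), if_pos rfl]
  have hcont : Continuous fun x => fderiv ℝ F x (Pi.single j 1) :=
    (hF.continuous_fderiv one_ne_zero).clm_apply continuous_const
  have h := MeasureTheory.integral_divergence_of_hasFDerivAt_off_countable' (n := 3) (0 : V4) 1
    zero_le_one (fun i x => if i = j then F x else 0) (fun i x => if i = j then fderiv ℝ F x else 0)
    ∅ Set.countable_empty (fun i => by
      by_cases hi : i = j
      · simpa [hi] using hF.continuous.continuousOn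
      · simpa [hi] using continuousOn_const) (fun x _ i => by
      by_cases hi : i = j
      · simpa [hi] using (hdiff x).hasFDerivAt
      · simpa [hi] using hasFDerivAt_const (0 : ℂ) x) (by
      simp only [hsum]
      exact hcont.integrableOn_Icc)
  simp only [hsum] at h
  rw [h]
  refine Finset.sum_eq_zero fun i _ => sub_eq_zero.mpr ?_
  congr 1
  funext x
  by_cases hi : i = j
  · rw [if_pos hi, if_pos hi]
    refine Eq.trans ?_ (hp _ (Pi.single i 1))
    congr 1
    rw [latticeVec_single]
    funext k
    refine Fin.succAboveCases i ?_ (fun k => ?_) k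
    · simp
    · simp
  · rw [if_neg hi, if_neg hi]

theorem integral_cube_fderiv {F : V4 → ℂ} (hF : ContDiff ℝ 1 F)
    (hp : ∀ x (l : Fin 4 → ℤ), F (x + latticeVec l) = F x) (w : V4) :
    ∫ x in Set.Icc (0 : V4) 1, fderiv ℝ F x w = 0 := by
  have h : ∀ x, fderiv ℝ F x w = ∑ j, (w j : ℂ) * fderiv ℝ F x (Pi.single j 1) := fun x => by
    refine (congrArg (fun L : V4 →L[ℝ] ℂ => L w) (fderiv_eq_sum_coord F x)).trans ?_
    rw [sum_apply]
    exact Finset.sum_congr rfl fun j _ => by simp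
  simp only [h]
  rw [MeasureTheory.integral_finsetSum _ fun j _ => ?_]
  · refine Finset.sum_eq_zero fun j _ => ?_
    rw [MeasureTheory.integral_const_mul, integral_cube_fderiv_single hF hp, mul_zero]
  · exact (continuous_const.mul
      ((hF.continuous_fderiv one_ne_zero).clm_apply continuous_const)).integrableOn_Icc

/-- A nontrivial character is an eigenfunction of some partial derivative with nonzero eigenvalue,
while derivatives of periodic functions integrate to zero. -/
theorem integral_cube_latticeChar (μ : Fin 4 → ℤ) :
    ∫ x in Set.Icc (0 : V4) 1, latticeChar μ x = if μ = 0 then 1 else 0 := by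
  split_ifs with h
  · subst h
    simp [latticeChar, latticeVec_zero, MeasureTheory.measureReal_def, Real.volume_Icc_pi]
  · obtain ⟨j, hj⟩ := Function.ne_iff.mp h
    have hd : ∀ x, HasFDerivAt (latticeChar μ) (latticeChar μ x • linPhaseCLM (latticeVec μ)) x :=
      fun x => (linPhaseCLM (latticeVec μ)).hasFDerivAt.cexp
    have hc : ContDiff ℝ 1 (latticeChar μ) := (linPhaseCLM (latticeVec μ)).contDiff.cexp
    have h0 := integral_cube_fderiv_single hc (fun x l => by
      rw [latticeChar_add, latticeChar_lattice, mul_one]) j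
    have h1 : ∀ x, fderiv ℝ (latticeChar μ) x (Pi.single j 1) =
        linPhase (latticeVec μ) (Pi.single j 1) * latticeChar μ x := fun x => by
      rw [(hd x).fderiv, smul_apply, linPhaseCLM_apply, smul_eq_mul, mul_comm]
    simp only [h1] at h0
    rw [MeasureTheory.integral_const_mul] at h0
    refine (mul_eq_zero.mp h0).resolve_left ?_
    have : (μ j : ℂ) ≠ 0 := by exact_mod_cast hj
    simp [linPhase, latticeVec, Real.pi_ne_zero, this]

theorem hasFDerivAt_cubeIntegral {f : Phase → ℂ} (hf : ContDiff ℝ 1 f) (y : V4) :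
    HasFDerivAt (fun y => ∫ x in Set.Icc (0 : V4) 1, f (x, y))
      (∫ x in Set.Icc (0 : V4) 1, fderiv ℝ f (x, y) ∘L ContinuousLinearMap.inr ℝ V4 V4) y := by
  have hcont : Continuous fun p : Phase => fderiv ℝ f p ∘L ContinuousLinearMap.inr ℝ V4 V4 :=
    (hf.continuous_fderiv one_ne_zero).clm_comp continuous_const
  obtain ⟨C, hC⟩ := (isCompact_Icc (a := (0 : V4)) (b := 1)).prod (isCompact_closedBall y 1)
    |>.exists_bound_of_continuousOn hcont.continuousOn
  refine hasFDerivAt_integral_of_dominated_of_fderiv_le (s := Metric.closedBall y 1)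
    (F := fun y x => f (x, y))
    (F' := fun y x => fderiv ℝ f (x, y) ∘L ContinuousLinearMap.inr ℝ V4 V4)
    (bound := fun _ => C) (Metric.closedBall_mem_nhds y one_pos)
    (Filter.Eventually.of_forall fun y' => ?_) ?_ ?_ ?_ ?_ ?_
  · exact (hf.continuous.comp (by fun_prop : Continuous fun x : V4 => (x, y'))).aestronglyMeasurable
  · exact (hf.continuous.comp (by fun_prop : Continuous fun x : V4 => (x, y))).integrableOn_Icc
  · exact (hcont.comp (by fun_prop : Continuous fun x : V4 => (x, y))).aestronglyMeasurable
  · exact (MeasureTheory.ae_restrict_iff' measurableSet_Icc).mpr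
      (Filter.Eventually.of_forall fun x hx y' hy' => hC (x, y') ⟨hx, hy'⟩)
  · exact continuous_const.integrableOn_Icc
  · refine Filter.Eventually.of_forall fun x y' _ => ?_
    exact ((hf.differentiable one_ne_zero) (x, y')).hasFDerivAt.comp y'
      (hasFDerivAt_prodMk_right x y')

theorem fderiv_cubeIntegral {f : Phase → ℂ} (hf : ContDiff ℝ 1 f) (y w : V4) :
    fderiv ℝ (fun y => ∫ x in Set.Icc (0 : V4) 1, f (x, y)) y w =
      ∫ x in Set.Icc (0 : V4) 1, fderiv ℝ f (x, y) (0, w) := by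
  have hcont : Continuous fun p : Phase => fderiv ℝ f p ∘L ContinuousLinearMap.inr ℝ V4 V4 :=
    (hf.continuous_fderiv one_ne_zero).clm_comp continuous_const
  rw [(hasFDerivAt_cubeIntegral hf y).fderiv, ContinuousLinearMap.integral_apply]
  · rfl
  · exact (hcont.comp (by fun_prop : Continuous fun x : V4 => (x, y))).integrableOn_Icc

theorem contDiff_cubeIntegral {f : Phase → ℂ} (hf : ContDiff ℝ ∞ f) :
    ContDiff ℝ ∞ fun y => ∫ x in Set.Icc (0 : V4) 1, f (x, y) := by
  rw [contDiff_infty]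
  intro n
  have h1 : ∀ {f : Phase → ℂ}, ContDiff ℝ ∞ f → ContDiff ℝ 1 f := fun hf => hf.of_le (by simp)
  induction n generalizing f with
  | zero =>
    exact contDiff_zero.mpr (Differentiable.continuous fun y =>
      (hasFDerivAt_cubeIntegral (h1 hf) y).differentiableAt)
  | succ n ih =>
    push_cast
    refine contDiff_succ_iff_fderiv_apply.mpr
      ⟨fun y => (hasFDerivAt_cubeIntegral (h1 hf) y).differentiableAt, by simp, fun w => ?_⟩
    simp only [fderiv_cubeIntegral (h1 hf)]
    exact ih (f := fun p => fderiv ℝ f p (0, w))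
      ((hf.fderiv_right (m := ∞) (by simp)).clm_apply contDiff_const)

end CubeIntegrals

/-! ### Inverting the Zak transform -/

section PoincareInverse

theorem PoincareModule.periodic {f : Phase → ℂ} (hf : f ∈ PoincareModule) (y x : V4)
    (l : Fin 4 → ℤ) : f (x + latticeVec l, y) = f (x, y) := by
  have := hf.2 x y l 0
  rwa [latticeVec_zero, add_zero, linPhase_zero_left, neg_zero, Complex.exp_zero, one_mul] at this

theorem PoincareModule.translate {f : Phase → ℂ} (hf : f ∈ PoincareModule) (x y : V4)
    (m : Fin 4 → ℤ) : f (x, y + latticeVec m) = latticeChar (-m) x * f (x, y) := by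
  have := hf.2 x y 0 m
  rw [latticeVec_zero, add_zero, ← linPhase_neg_left, ← latticeVec_neg] at this
  exact this

/-- Quasi-periodicity changes values only by phases, so |f| is determined on the compact unit cube.
-/
theorem PoincareModule.bounded {f : Phase → ℂ} (hf : f ∈ PoincareModule) :
    ∃ C, 0 ≤ C ∧ ∀ p, ‖f p‖ ≤ C := by
  obtain ⟨C, hC⟩ := (isCompact_Icc (a := (0 : V4)) (b := 1)).prod (isCompact_Icc (a := (0 : V4)) (b := 1))
    |>.exists_bound_of_continuousOn hf.1.continuous.continuousOn
  have h : ∀ x : V4, ∃ x' ∈ Set.Icc (0 : V4) 1, ∃ l : Fin 4 → ℤ, x = x' + latticeVec l := fun x =>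
    ⟨fun i => Int.fract (x i), ⟨fun i => Int.fract_nonneg _, fun i => (Int.fract_lt_one _).le⟩,
      fun i => ⌊x i⌋, funext fun i => (Int.fract_add_floor _).symm⟩
  refine ⟨max C 0, le_max_right _ _, fun ⟨x, y⟩ => ?_⟩
  obtain ⟨x, hx, l, rfl⟩ := h x
  obtain ⟨y, hy, m, rfl⟩ := h y
  rw [periodic hf, translate hf, norm_mul, norm_latticeChar, one_mul]
  exact (hC (x, y) ⟨hx, hy⟩).trans (le_max_left _ _)

/-- When x̂ is shifted by m, the derivative of the phase exp(-2πi⟨m, x⟩) is compensated by the shift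
in the term 2πi⟨x̂, dx⟩. -/
theorem PoincareModule.nabla_mem {f : Phase → ℂ} (hf : f ∈ PoincareModule) (γ : V8) :
    poincareNabla γ f ∈ PoincareModule := by
  refine ⟨?_, fun x y l m => ?_⟩
  · refine ((hf.1.fderiv_right (m := ∞) (by simp)).clm_apply contDiff_const).add (ContDiff.mul ?_ hf.1)
    simp only [linPhase_comm _ (γ ∘ Sum.inl)]
    exact (linPhaseCLM _).contDiff.comp contDiff_snd
  · have hdiff : Differentiable ℝ f := hf.1.differentiable (by simp)
    have h1 : (fun p : Phase => f (p + (latticeVec l, latticeVec m))) =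
        fun p => Complex.exp (-linPhase (latticeVec m) p.1) * f p := funext fun p => hf.2 p.1 p.2 l m
    have h2 : HasFDerivAt (fun p : Phase => Complex.exp (-linPhase (latticeVec m) p.1) * f p) _
        (x, y) :=
      (((linPhaseCLM (latticeVec m)).hasFDerivAt.comp (x, y) hasFDerivAt_fst).neg.cexp).mul
        (hdiff (x, y)).hasFDerivAt
    have h3 := congrArg (fun g => fderiv ℝ g (x, y) (γ ∘ Sum.inl, γ ∘ Sum.inr)) h1
    simp only [fderiv_comp_add_right, h2.fderiv] at h3
    simp only [Prod.mk_add_mk] at h3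
    simp only [poincareNabla]
    rw [h3, hf.2 x y l m, linPhase_add_left]
    simp only [add_apply, smul_apply, neg_apply, ContinuousLinearMap.comp_apply,
      ContinuousLinearMap.coe_fst', linPhaseCLM_apply, smul_eq_mul]
    simp only [Function.comp_apply, linPhaseCLM_apply, Pi.neg_apply]
    ring

/-- The function `x̂ ↦ ∫ f(x, x̂) dx` over the unit cube. -/
def cubeIntegral (f : Phase → ℂ) (y : V4) : ℂ := ∫ x in Set.Icc (0 : V4) 1, f (x, y)

/-- The x-derivative integrates to zero by periodicity, so the connection turns into multiplication
by a linear function of x̂ plus a derivative in x̂. -/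
theorem cubeIntegral_nabla {f : Phase → ℂ} (hf : f ∈ PoincareModule) (γ : V8) (y : V4) :
    cubeIntegral (poincareNabla γ f) y =
      linPhase y (γ ∘ Sum.inl) * cubeIntegral f y + fderiv ℝ (cubeIntegral f) y (γ ∘ Sum.inr) := by
  have hf1 : ContDiff ℝ 1 f := hf.1.of_le (by simp)
  have hx : Continuous fun x : V4 => (x, y) := by fun_prop
  have hd : ∀ w : Phase, MeasureTheory.IntegrableOn (fun x : V4 => fderiv ℝ f (x, y) w)
      (Set.Icc 0 1) := fun w =>
    (((hf1.continuous_fderiv one_ne_zero).comp hx).clm_apply continuous_const).integrableOn_Icc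
  have h0 : ∫ x in Set.Icc (0 : V4) 1, fderiv ℝ f (x, y) (γ ∘ Sum.inl, 0) = 0 := by
    have h1 : ∀ x : V4, fderiv ℝ f (x, y) (γ ∘ Sum.inl, 0) =
        fderiv ℝ (fun x => f (x, y)) x (γ ∘ Sum.inl) := fun x => by
      have : HasFDerivAt (fun x => f (x, y)) _ x :=
        ((hf1.differentiable one_ne_zero) (x, y)).hasFDerivAt.comp x (hasFDerivAt_prodMk_left x y)
      rw [this.fderiv]
      rfl
    simp only [h1]
    exact integral_cube_fderiv (hf1.comp (contDiff_id.prodMk contDiff_const))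
      (PoincareModule.periodic hf y) _
  have h2 : ∀ x : V4, poincareNabla γ f (x, y) = fderiv ℝ f (x, y) (γ ∘ Sum.inl, 0) +
      fderiv ℝ f (x, y) (0, γ ∘ Sum.inr) + linPhase y (γ ∘ Sum.inl) * f (x, y) := fun x => by
    rw [← map_add, Prod.mk_add_mk, add_zero, zero_add]
    rfl
  have h3 : MeasureTheory.IntegrableOn (fun x : V4 => linPhase y (γ ∘ Sum.inl) * f (x, y))
      (Set.Icc 0 1) := (continuous_const.mul (hf1.continuous.comp hx)).integrableOn_Icc
  have h4 : MeasureTheory.IntegrableOn (fun x : V4 => fderiv ℝ f (x, y) (γ ∘ Sum.inl, 0) +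
      fderiv ℝ f (x, y) (0, γ ∘ Sum.inr)) (Set.Icc 0 1) := (hd _).add (hd _)
  rw [cubeIntegral]
  simp only [h2]
  rw [MeasureTheory.integral_add h4 h3, MeasureTheory.integral_add (hd _) (hd _),
    h0, zero_add, MeasureTheory.integral_const_mul, add_comm, ← fderiv_cubeIntegral hf1]
  rfl

theorem cubeIntegral_bounded {f : Phase → ℂ} (hf : f ∈ PoincareModule) :
    ∃ C, ∀ y, ‖cubeIntegral f y‖ ≤ C := by
  obtain ⟨C, hC0, hC⟩ := PoincareModule.bounded hf
  refine ⟨C, fun y => ?_⟩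
  refine (MeasureTheory.norm_setIntegral_le_of_norm_le_const (C := C)
    isCompact_Icc.measure_lt_top fun x _ => hC (x, y)).trans_eq ?_
  simp [MeasureTheory.measureReal_def, Real.volume_Icc_pi]

/-- Multiplying the integral by a coordinate of x̂ amounts to applying the connection to `f`, which
stays in the module, where integrals are bounded. -/
theorem cubeIntegral_coord_decay (j : Fin 4) (k : ℕ) : ∀ f ∈ PoincareModule,
    ∃ C, ∀ y : V4, |y j| ^ k * ‖cubeIntegral f y‖ ≤ C := by
  induction k with
  | zero => intro f hf; simpa using cubeIntegral_bounded hf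
  | succ k ih =>
    intro f hf
    obtain ⟨C, hC⟩ := ih _ (PoincareModule.nabla_mem hf (Sum.elim (Pi.single j 1) 0))
    refine ⟨C / (2 * Real.pi), fun y => ?_⟩
    have h := hC y
    rw [cubeIntegral_nabla hf, Sum.elim_comp_inl, Sum.elim_comp_inr, map_zero, add_zero, norm_mul,
      linPhase, dotProduct_single_one, norm_mul, Complex.norm_real, Real.norm_eq_abs] at h
    have h2 : ‖2 * (Real.pi : ℂ) * Complex.I‖ = 2 * Real.pi := by simp [abs_of_pos Real.pi_pos]
    rw [h2] at h
    rw [le_div_iff₀ (by positivity), pow_succ]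
    linarith

theorem cubeIntegral_decay (k n : ℕ) : ∀ f ∈ PoincareModule,
    ∃ C, ∀ y : V4, ‖y‖ ^ k * ‖iteratedFDeriv ℝ n (cubeIntegral f) y‖ ≤ C := by
  induction n with
  | zero =>
    intro f hf
    simp only [norm_iteratedFDeriv_zero]
    rcases eq_or_ne k 0 with rfl | hk
    · simpa using cubeIntegral_bounded hf
    choose C hC using fun j => cubeIntegral_coord_decay j k f hf
    refine ⟨∑ j, C j, fun y => ?_⟩
    refine (mul_le_mul_of_nonneg_right (norm_pow_le_sum y hk) (norm_nonneg _)).trans ?_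
    rw [Finset.sum_mul]
    exact Finset.sum_le_sum fun j _ => hC j y
  | succ n ih =>
    intro f hf
    choose C hC using fun j : Fin 4 =>
      ih _ (PoincareModule.nabla_mem hf (Sum.elim 0 (Pi.single j 1)))
    refine ⟨∑ j, C j, fun y => ?_⟩
    refine (mul_le_mul_of_nonneg_left
      (norm_iteratedFDeriv_succ_le (contDiff_cubeIntegral hf.1) n y) (by positivity)).trans ?_
    rw [Finset.mul_sum]
    refine Finset.sum_le_sum fun j _ => ?_
    refine le_trans (le_of_eq ?_) (hC j y)
    congr 3
    funext y
    rw [cubeIntegral_nabla hf, Sum.elim_comp_inl, Sum.elim_comp_inr, linPhase_zero_right, zero_mul,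
      zero_add]
    rfl

/-- `cubeIntegral f` as a Schwartz function. -/
def cubeSchwartz (f : PoincareModule) : 𝓢(V4, ℂ) where
  toFun := cubeIntegral f.1
  smooth' := contDiff_cubeIntegral f.2.1
  decay' k n := cubeIntegral_decay k n f.1 f.2

theorem cubeSchwartz_apply (f : PoincareModule) (y : V4) :
    cubeSchwartz f y = ∫ x in Set.Icc (0 : V4) 1, f.1 (x, y) := rfl

/-- By quasi-periodicity, the values of the integral at x̂ + μ are the Fourier coefficients in x of
f(·, x̂); the Zak sum is its Fourier series. -/
theorem zakFun_cubeSchwartz (f : PoincareModule) (p : Phase) : zakFun (cubeSchwartz f) p = f.1 p := by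
  have hcoeff : ∀ k : Fin 4 → ℤ, ∫ x in Set.Icc (0 : V4) 1, latticeChar (-k) x * f.1 (x, p.2) =
      cubeSchwartz f (p.2 + latticeVec k) := fun k => by
    rw [cubeSchwartz_apply]
    simp only [PoincareModule.translate f.2]
  have h := hasSum_fourier_of_periodic (F := fun x => f.1 (x, p.2))
    (f.2.1.continuous.comp (by fun_prop)) (PoincareModule.periodic f.2 p.2) (by
      simp only [hcoeff]
      exact (summable_norm_zak _ _).of_norm) p.1
  simp only [hcoeff] at h
  refine (hasSum_zak (cubeSchwartz f) p).unique (h.congr_fun fun μ => mul_comm _ _)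

theorem cubeIntegral_zakFun (φ : 𝓢(V4, ℂ)) (y : V4) : cubeIntegral (zakFun φ) y = φ y := by
  have h := MeasureTheory.hasSum_integral_of_summable_integral_norm
    (μ := MeasureTheory.volume.restrict (Set.Icc (0 : V4) 1))
    (F := fun (μ : Fin 4 → ℤ) x => latticeChar μ x * φ (y + latticeVec μ))
    (fun μ => ((continuous_latticeChar μ).mul continuous_const).integrableOn_Icc) (by
      simpa [norm_latticeChar, MeasureTheory.measureReal_def, Real.volume_Icc_pi] using
        summable_norm_zak φ y)
  simp only [MeasureTheory.integral_mul_const, integral_cube_latticeChar] at h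
  refine h.unique ?_
  have h2 := hasSum_single (f := fun μ : Fin 4 → ℤ =>
    (if μ = 0 then (1 : ℂ) else 0) * φ (y + latticeVec μ)) 0 fun μ hμ => by simp [hμ]
  simpa [latticeVec_zero] using h2

/-- The isomorphism of the Schwartz functions with the Poincaré module. -/
def zakEquiv : 𝓢(V4, ℂ) ≃ₗ[ℂ] PoincareModule where
  toFun φ := ⟨zakFun φ, zakFun_mem φ⟩
  map_add' φ ψ := Subtype.ext (funext fun p => map_add (zakCLM p) φ ψ)
  map_smul' a φ := Subtype.ext (funext fun p => map_smul (zakCLM p) a φ)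
  invFun := cubeSchwartz
  left_inv φ := SchwartzMap.ext fun y => cubeIntegral_zakFun φ y
  right_inv f := Subtype.ext (funext fun p => zakFun_cubeSchwartz f p)

end PoincareInverse

/-! ### Action, connection and inner product on the Poincaré module -/

section PoincareStructure

theorem poincareT_apply (w : V8) : poincareT w = (-(w ∘ Sum.inl), w ∘ Sum.inr) := by
  simp [poincareT, blockMap]

/-- The map T₀ is integral, so all Weyl phases are exp of 2πi times integers and no correction is
required. -/
theorem isWeylSystem_poincare : IsWeylSystem (twoForm 0 0) poincareT fun _ => 1 where
  norm_eq_one _ := norm_one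
  map_zero := rfl
  mul m n := by
    have h1 : twoForm 0 0 = 0 := by simp [twoForm]
    have h2 : Complex.exp (linPhase (poincareT (latticeVec n)).2 (poincareT (latticeVec m)).1) = 1 := by
      rw [poincareT_apply, poincareT_apply, linPhase_neg_right, Complex.exp_neg, inv_eq_one]
      exact latticeChar_lattice (n ∘ Sum.inr) (m ∘ Sum.inl)
    rw [h2, h1]
    simp [torusCocycle, formOf]

theorem heis_poincareT (ν : Fin 4 ⊕ Fin 4 → ℤ) (φ : 𝓢(V4, ℂ)) (z : V4) :
    heis (poincareT (latticeVec ν)) φ z =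
      latticeChar (ν ∘ Sum.inr) z * φ (z - latticeVec (ν ∘ Sum.inl)) := by
  rw [heis_apply, poincareT_apply]
  rfl

theorem zakFun_heis (ν : Fin 4 ⊕ Fin 4 → ℤ) (φ : 𝓢(V4, ℂ)) (p : Phase) :
    zakFun (heis (poincareT (latticeVec ν)) φ) p =
      Complex.exp (linPhase (latticeVec (ν ∘ Sum.inl)) p.1 +
        linPhase (latticeVec (ν ∘ Sum.inr)) p.2) * zakFun φ p := by
  rw [zakFun, zakFun, ← tsum_mul_left, ← (Equiv.addRight (ν ∘ Sum.inl)).tsum_eq]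
  refine tsum_congr fun μ => ?_
  have h1 : p.2 + latticeVec (μ + ν ∘ Sum.inl) - latticeVec (ν ∘ Sum.inl) = p.2 + latticeVec μ := by
    rw [latticeVec_add]; abel
  have h2 : latticeChar (μ + ν ∘ Sum.inl) p.1 =
      latticeChar μ p.1 * latticeChar (ν ∘ Sum.inl) p.1 := by
    rw [latticeChar, latticeChar, latticeChar, ← Complex.exp_add, latticeVec_add, add_dotProduct]
    congr 1
    push_cast
    ring
  rw [Equiv.coe_addRight, heis_poincareT, h1, h2, latticeChar_add, latticeChar_lattice, mul_one,
    Complex.exp_add]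
  change _ = latticeChar (ν ∘ Sum.inl) p.1 * latticeChar (ν ∘ Sum.inr) p.2 * _
  ring

theorem IsElementaryAction.eq_poincare
    {ρ : SmoothTorus (twoForm 0 0) →ₐ[ℂ] Module.End ℂ 𝓢(V4, ℂ)}
    (h : IsElementaryAction 0 0 poincareT ρ) : ρ = isWeylSystem_poincare.action :=
  h.unique (by simp) (by simp) (isWeylSystem_poincare.isElementaryAction fun _ => rfl)

theorem IsElementaryAction.poincare_U
    {ρ : SmoothTorus (twoForm 0 0) →ₐ[ℂ] Module.End ℂ 𝓢(V4, ℂ)}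
    (h : IsElementaryAction 0 0 poincareT ρ) (ν : Fin 4 ⊕ Fin 4 → ℤ) (φ : 𝓢(V4, ℂ)) :
    ρ (U _ ν) φ = heis (poincareT (latticeVec ν)) φ := by
  rw [h.eq_poincare, isWeylSystem_poincare.action_U, weylOp_apply, one_smul]

theorem IsElementaryAction.zakFun_action
    {ρ : SmoothTorus (twoForm 0 0) →ₐ[ℂ] Module.End ℂ 𝓢(V4, ℂ)}
    (h : IsElementaryAction 0 0 poincareT ρ) (a : SmoothTorus (twoForm 0 0)) (φ : 𝓢(V4, ℂ))
    (p : Phase) : zakFun (ρ a φ) p = torusFun a p * zakFun φ p := by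
  have h1 := ((h.hasSum a φ).mapL (zakCLM p)).tsum_eq
  rw [torusFun, ← tsum_mul_right]
  refine h1.symm.trans (tsum_congr fun ν => ?_)
  rw [map_smul, h.poincare_U, zakCLM_apply, zakFun_heis, smul_eq_mul, mul_assoc]

theorem summable_torusFun {θ : Matrix (Fin 4 ⊕ Fin 4) (Fin 4 ⊕ Fin 4) ℝ} (a : SmoothTorus θ)
    (p : Phase) : Summable fun q : (Fin 4 → ℤ) × (Fin 4 → ℤ) =>
      a.coeff (Sum.elim q.1 q.2) * (latticeChar q.1 p.1 * latticeChar q.2 p.2) := by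
  refine Summable.of_norm (((Equiv.sumArrowEquivProdArrow (Fin 4) (Fin 4) ℤ).symm.summable_iff.mpr
    a.summable_norm).congr fun q => ?_)
  rw [norm_mul, norm_mul, norm_latticeChar, norm_latticeChar, mul_one, mul_one]
  rfl

theorem torusFun_eq_tsum_prod {θ : Matrix (Fin 4 ⊕ Fin 4) (Fin 4 ⊕ Fin 4) ℝ} (a : SmoothTorus θ)
    (p : Phase) : torusFun a p = ∑' q : (Fin 4 → ℤ) × (Fin 4 → ℤ),
      a.coeff (Sum.elim q.1 q.2) * (latticeChar q.1 p.1 * latticeChar q.2 p.2) := by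
  rw [torusFun, ← (Equiv.sumArrowEquivProdArrow (Fin 4) (Fin 4) ℤ).symm.tsum_eq]
  refine tsum_congr fun q => ?_
  rw [Complex.exp_add]
  rfl

theorem integral_torusFun {θ : Matrix (Fin 4 ⊕ Fin 4) (Fin 4 ⊕ Fin 4) ℝ} (a : SmoothTorus θ) :
    ∫ p in Set.Icc (0 : Phase) 1, torusFun a p = a.coeff 0 := by
  have hcont : ∀ q : (Fin 4 → ℤ) × (Fin 4 → ℤ), Continuous fun p : Phase =>
      a.coeff (Sum.elim q.1 q.2) * (latticeChar q.1 p.1 * latticeChar q.2 p.2) := fun q =>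
    continuous_const.mul (((continuous_latticeChar _).comp continuous_fst).mul
      ((continuous_latticeChar _).comp continuous_snd))
  have h := MeasureTheory.hasSum_integral_of_summable_integral_norm
    (μ := MeasureTheory.volume.restrict (Set.Icc (0 : Phase) 1))
    (F := fun (q : (Fin 4 → ℤ) × (Fin 4 → ℤ)) (p : Phase) =>
      a.coeff (Sum.elim q.1 q.2) * (latticeChar q.1 p.1 * latticeChar q.2 p.2))
    (fun q => (hcont q).continuousOn.integrableOn_compact isCompact_Icc) (by
      simp only [norm_mul, norm_latticeChar, mul_one, MeasureTheory.integral_const, smul_eq_mul]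
      exact ((Equiv.sumArrowEquivProdArrow (Fin 4) (Fin 4) ℤ).symm.summable_iff.mpr
        a.summable_norm).mul_left _)
  have hint : ∀ q : (Fin 4 → ℤ) × (Fin 4 → ℤ), ∫ p in Set.Icc (0 : Phase) 1,
      a.coeff (Sum.elim q.1 q.2) * (latticeChar q.1 p.1 * latticeChar q.2 p.2) =
      a.coeff (Sum.elim q.1 q.2) * ((if q.1 = 0 then 1 else 0) * (if q.2 = 0 then 1 else 0)) :=
    fun q => by
      rw [MeasureTheory.integral_const_mul, ← integral_cube_latticeChar q.1,
        ← integral_cube_latticeChar q.2, ← MeasureTheory.setIntegral_prod_mul,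
        ← MeasureTheory.Measure.volume_eq_prod, Set.Icc_prod_Icc]
      rfl
  simp only [← torusFun_eq_tsum_prod, hint] at h
  refine h.unique ?_
  have h2 := hasSum_single (f := fun q : (Fin 4 → ℤ) × (Fin 4 → ℤ) => a.coeff (Sum.elim q.1 q.2) *
    ((if q.1 = 0 then 1 else 0) * (if q.2 = 0 then 1 else 0))) 0 fun q hq => by
      by_cases h1 : q.1 = 0
      · have h2 : q.2 ≠ 0 := fun h2 => hq (Prod.ext h1 h2)
        rw [if_neg h2, mul_zero, mul_zero]
      · rw [if_neg h1, zero_mul, mul_zero]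
  simpa using h2

/-- The change of variables `(μ, l) ↦ (l, l - μ)` on pairs of lattice vectors. -/
def differenceEquiv : (Fin 4 → ℤ) × (Fin 4 → ℤ) ≃ (Fin 4 → ℤ) × (Fin 4 → ℤ) where
  toFun q := (q.2, q.2 - q.1)
  invFun q := (q.1 - q.2, q.1)
  left_inv q := by simp
  right_inv q := by simp

/-- The product of `φ` with the conjugate of the translate of `ψ` by `μ`. -/
def translateProduct (φ ψ : 𝓢(V4, ℂ)) (μ : Fin 4 → ℤ) : 𝓢(V4, ℂ) :=
  mulSchwartz φ (conjSchwartz (heis (-latticeVec μ, 0) ψ))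

theorem translateProduct_apply (φ ψ : 𝓢(V4, ℂ)) (μ : Fin 4 → ℤ) (z : V4) :
    translateProduct φ ψ μ z = φ z * starRingEnd ℂ (ψ (z - latticeVec μ)) := by
  rw [translateProduct, mulSchwartz_apply, conjSchwartz_apply, heis_apply, linPhase_zero_left,
    Complex.exp_zero, one_mul, sub_eq_add_neg]

/-- Grouping the double series by the difference of the two indices gives a Fourier series in x
whose coefficients are periodizations in x̂. -/
theorem zakFun_mul_conj (φ ψ : 𝓢(V4, ℂ)) (p : Phase) :
    zakFun φ p * starRingEnd ℂ (zakFun ψ p) = ∑' μ : Fin 4 → ℤ, latticeChar μ p.1 *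
      ∑' l : Fin 4 → ℤ, translateProduct φ ψ μ (p.2 + latticeVec l) := by
  have hψ : starRingEnd ℂ (zakFun ψ p) = ∑' l : Fin 4 → ℤ,
      starRingEnd ℂ (latticeChar l p.1 * ψ (p.2 + latticeVec l)) :=
    Complex.conjCLE.map_tsum
  have hn : ∀ χ : 𝓢(V4, ℂ), Summable fun μ : Fin 4 → ℤ =>
      ‖latticeChar μ p.1 * χ (p.2 + latticeVec μ)‖ := fun χ =>
    (summable_norm_zak χ p.2).congr fun μ => by rw [norm_mul, norm_latticeChar, one_mul]
  have hnψ : Summable fun l : Fin 4 → ℤ =>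
      ‖starRingEnd ℂ (latticeChar l p.1 * ψ (p.2 + latticeVec l))‖ :=
    (hn ψ).congr fun l => (RCLike.norm_conj _).symm
  have hs := summable_mul_of_summable_norm (hn φ) hnψ
  have hterm : ∀ q : (Fin 4 → ℤ) × (Fin 4 → ℤ),
      latticeChar (differenceEquiv q).1 p.1 * φ (p.2 + latticeVec (differenceEquiv q).1) *
        starRingEnd ℂ (latticeChar (differenceEquiv q).2 p.1 *
          ψ (p.2 + latticeVec (differenceEquiv q).2)) =
      latticeChar q.1 p.1 * translateProduct φ ψ q.1 (p.2 + latticeVec q.2) := fun q => by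
    have h1 : latticeChar q.2 p.1 * starRingEnd ℂ (latticeChar (q.2 - q.1) p.1) =
        latticeChar q.1 p.1 := by
      rw [← latticeChar_neg, latticeChar, latticeChar, latticeChar, ← Complex.exp_add,
        latticeVec_neg, latticeVec_sub, neg_dotProduct, sub_dotProduct]
      congr 1
      push_cast
      ring
    rw [translateProduct_apply, ← h1, map_mul, add_sub_assoc, ← latticeVec_sub]
    simp only [differenceEquiv, Equiv.coe_fn_mk]
    ring
  rw [hψ, zakFun, tsum_mul_tsum_of_summable_norm (hn φ) hnψ, ← differenceEquiv.tsum_eq]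
  have hs' := differenceEquiv.summable_iff.mpr hs
  simp only [Function.comp_def] at hs'
  simp only [hterm] at hs' ⊢
  rw [hs'.tsum_prod]
  exact tsum_congr fun μ => by rw [← tsum_mul_left]

/-- Poisson summation in x̂ applies to each periodization in `zakFun_mul_conj`; its Fourier
coefficients are the integrals of φ against the conjugate of U_νψ. -/
theorem IsElementaryAction.torusFun_ip
    {ρ : SmoothTorus (twoForm 0 0) →ₐ[ℂ] Module.End ℂ 𝓢(V4, ℂ)}
    (h : IsElementaryAction 0 0 poincareT ρ) {φ ψ : 𝓢(V4, ℂ)} {a : SmoothTorus (twoForm 0 0)}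
    (ha : ∀ ν, a.coeff ν = ∫ z, φ z * starRingEnd ℂ (ρ (U _ ν) ψ z)) (p : Phase) :
    torusFun a p = zakFun φ p * starRingEnd ℂ (zakFun ψ p) := by
  have hcoeff : ∀ μ ν : Fin 4 → ℤ, a.coeff (Sum.elim μ ν) =
      ∫ z, latticeChar (-ν) z * translateProduct φ ψ μ z := fun μ ν => by
    rw [ha]
    congr 1
    funext z
    rw [h.poincare_U, heis_poincareT, translateProduct_apply, latticeChar_neg, map_mul,
      Sum.elim_comp_inl, Sum.elim_comp_inr]
    ring
  have hs : ∀ μ : Fin 4 → ℤ, Summable fun ν : Fin 4 → ℤ => a.coeff (Sum.elim μ ν) := fun μ =>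
    ((Equiv.sumArrowEquivProdArrow (Fin 4) (Fin 4) ℤ).symm.summable_iff.mpr
      a.summable_norm.of_norm).prod_factor μ
  rw [torusFun_eq_tsum_prod, (summable_torusFun a p).tsum_prod, zakFun_mul_conj]
  refine tsum_congr fun μ => ?_
  have hP := hasSum_poisson (translateProduct φ ψ μ).continuous (schwartz_decay_le _ _)
    (by simpa only [hcoeff] using hs μ) p.2
  rw [← hP.tsum_eq, ← tsum_mul_left]
  refine tsum_congr fun ν => ?_
  rw [hcoeff]
  ring

variable {V₁ V₂ : V4 →ₗ[ℝ] Phase}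

theorem IsV₁.eq_poincare (h : IsV₁ poincareT V₁) (α : V4) : V₁ α = (0, α) := by
  refine eq_of_Omega_eq ((bijective_iff_det_ne_zero isPullback_poincareT).mpr
    det_fullForm_poincare).2 fun w => ?_
  rw [← sumElim_comp w, h, poincareT_apply, Sum.elim_comp_inl, Sum.elim_comp_inr]
  simp [Omega]

theorem IsV₂.eq_poincare (h : IsV₂ poincareT V₂) (α : V4) : V₂ α = (α, 0) := by
  refine eq_of_Omega_eq ((bijective_iff_det_ne_zero isPullback_poincareT).mpr
    det_fullForm_poincare).2 fun w => ?_
  rw [← sumElim_comp w, h, poincareT_apply, Sum.elim_comp_inl, Sum.elim_comp_inr]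
  simp [Omega, dotProduct_comm]

theorem zakFun_nablaSum (h₁ : IsV₁ poincareT V₁) (h₂ : IsV₂ poincareT V₂) (γ : V8)
    (φ : 𝓢(V4, ℂ)) (p : Phase) :
    zakFun (nablaSum V₁ V₂ γ φ) p = poincareNabla γ (zakFun φ) p := by
  have h : sumMap V₁ V₂ γ = (γ ∘ Sum.inr, γ ∘ Sum.inl) := by
    change V₁ _ + V₂ _ = _
    rw [h₁.eq_poincare, h₂.eq_poincare]
    simp
  rw [nablaSum_eq, h, poincareNabla, fderiv_zakFun, linPhase_comm p.2]
  simp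

theorem IsElementaryModule.poincare
    {ρ : SmoothTorus (twoForm 0 0) →ₐ[ℂ] Module.End ℂ 𝓢(V4, ℂ)}
    {ρ₁ : SmoothTorus (0 : Matrix (Fin 4) (Fin 4) ℝ) →ₐ[ℂ] Module.End ℂ 𝓢(V4, ℂ)}
    {ρ₂ : (SmoothTorus (0 : Matrix (Fin 4) (Fin 4) ℝ))ᵐᵒᵖ →ₐ[ℂ] Module.End ℂ 𝓢(V4, ℂ)}
    {ip : 𝓢(V4, ℂ) → 𝓢(V4, ℂ) → SmoothTorus (twoForm 0 0)}
    (h : IsElementaryModule 0 0 poincareT V₁ V₂ ρ ρ₁ ρ₂ ip) :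
    SigmaNondegenerate V₁ V₂ ∧
      (∀ (μ : Fin 4 → ℤ) (φ : 𝓢(V4, ℂ)) (z : V4),
        ρ (SmoothTorus.U _ (Sum.elim μ 0)) φ z = φ (z - latticeVec μ) ∧
        ρ (SmoothTorus.U _ (Sum.elim 0 μ)) φ z
          = Complex.exp (linPhase (latticeVec μ) z) * φ z) ∧
      (∀ (α : V4) (φ : 𝓢(V4, ℂ)) (z : V4),
        nablaOf V₁ α φ z = linPhase α z * φ z ∧
        nablaOf V₂ α φ z = deriv (fun t : ℝ => φ (z + t • α)) 0) ∧
      ∃ Φ : 𝓢(V4, ℂ) ≃ₗ[ℂ] PoincareModule,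
        (∀ (φ : 𝓢(V4, ℂ)) (x y : V4),
          HasSum (fun μ : Fin 4 → ℤ =>
            Complex.exp (linPhase (latticeVec μ) x) * φ (y + latticeVec μ)) ((Φ φ).1 (x, y))) ∧
        (∀ (f : PoincareModule) (y : V4), Φ.symm f y = ∫ x in Set.Icc (0 : V4) 1, f.1 (x, y)) ∧
        (∀ a φ p, (Φ (ρ a φ)).1 p = torusFun a p * (Φ φ).1 p) ∧
        (∀ γ φ p, (Φ (nablaSum V₁ V₂ γ φ)).1 p = poincareNabla γ (Φ φ).1 p) ∧
        (∀ φ ψ p, torusFun (ip φ ψ) p = (Φ φ).1 p * starRingEnd ℂ ((Φ ψ).1 p)) ∧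
        (∀ φ ψ, ∫ p in Set.Icc (0 : Phase) 1, (Φ φ).1 p * starRingEnd ℂ ((Φ ψ).1 p)
          = ∫ z, φ z * starRingEnd ℂ (ψ z)) := by
  have hip := fun φ ψ p => h.action.torusFun_ip (h.ip_coeff φ ψ) p
  refine ⟨(isPullback_poincareT.sigmaNondegenerate_iff (by simp) (by simp) poincareEta_transpose
    det_fullForm_poincare h.isV₁ h.isV₂).mpr det_poincareEta_toBlocks₁₂,
    fun μ φ z => ⟨?_, ?_⟩, fun α φ z => ⟨?_, ?_⟩, zakEquiv, fun φ x y => hasSum_zak φ (x, y),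
    fun _ _ => rfl, fun a φ p => h.action.zakFun_action a φ p,
    fun γ φ p => zakFun_nablaSum h.isV₁ h.isV₂ γ φ p, hip, fun φ ψ => ?_⟩
  · rw [h.action.poincare_U, heis_poincareT]
    simp [latticeChar, latticeVec_zero]
  · rw [h.action.poincare_U, heis_poincareT, Sum.elim_comp_inl, Sum.elim_comp_inr, latticeVec_zero,
      sub_zero]
    rfl
  · change Qop (V₁ α) φ z = _
    rw [h.isV₁.eq_poincare, Qop_apply', map_zero, add_zero]
  · change Qop (V₂ α) φ z = _
    rw [h.isV₂.eq_poincare, Qop_apply, linPhase_zero_left, zero_mul, zero_add]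
  -- Integration over the cube is the trace of the torus-valued inner product, whose zeroth
  -- coefficient is the L² pairing.
  · have h0 : ∫ p in Set.Icc (0 : Phase) 1, torusFun (ip φ ψ) p = (ip φ ψ).coeff 0 :=
      integral_torusFun (ip φ ψ)
    simp only [hip] at h0
    refine h0.trans ?_
    rw [h.ip_coeff]
    congr 1
    funext z
    rw [show U (twoForm 0 0) 0 = 1 from rfl, map_one]
    rfl

end PoincareStructure

end

/-! ### The main theorem -/

theorem mainTheorem6 :
    -- commutators of the operators `Q`
    (∀ (v w : Phase) (f : 𝓢(V4, ℂ)),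
      Qop v (heis w f) - heis w (Qop v f)
          = (2 * Real.pi * Complex.I * (Omega v w : ℝ)) • heis w f ∧
      Qop v (Qop w f) - Qop w (Qop v f) = (2 * Real.pi * Complex.I * (Omega v w : ℝ)) • f) ∧
    -- existence of `T`, and its uniqueness up to the symplectic group
    (∀ (θ θ' : Matrix (Fin 4) (Fin 4) ℝ) (η : Matrix (Fin 4 ⊕ Fin 4) (Fin 4 ⊕ Fin 4) ℤ),
      θᵀ = -θ → θ'ᵀ = -θ' → ηᵀ = -η →
      (∃ T : V8 →ₗ[ℝ] Phase, IsPullback θ θ' η T) ∧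
      (∀ T : V8 →ₗ[ℝ] Phase, IsPullback θ θ' η T →
        (Function.Bijective T ↔ (fullForm θ θ' η).det ≠ 0)) ∧
      ((fullForm θ θ' η).det ≠ 0 → ∀ T T' : V8 →ₗ[ℝ] Phase,
        IsPullback θ θ' η T → IsPullback θ θ' η T' →
        ∃ S : Phase ≃ₗ[ℝ] Phase, (∀ v w, Omega (S v) (S w) = Omega v w) ∧ ∀ v, T' v = S (T v))) ∧
    -- the elementary modules, their connections, and nondegeneracy of `σ`
    (∀ (θ θ' : Matrix (Fin 4) (Fin 4) ℝ) (η : Matrix (Fin 4 ⊕ Fin 4) (Fin 4 ⊕ Fin 4) ℤ)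
      (T : V8 →ₗ[ℝ] Phase),
      θᵀ = -θ → θ'ᵀ = -θ' → ηᵀ = -η → IsPullback θ θ' η T → (fullForm θ θ' η).det ≠ 0 →
      (∃! V₁, IsV₁ T V₁) ∧ (∃! V₂, IsV₂ T V₂) ∧ (∃! ρ, IsElementaryAction θ θ' T ρ) ∧
      (∃ V₁ V₂ ρ ρ₁ ρ₂ ip, IsElementaryModule θ θ' T V₁ V₂ ρ ρ₁ ρ₂ ip) ∧
      (∀ V₁ V₂, IsV₁ T V₁ → IsV₂ T V₂ →
        (SigmaNondegenerate V₁ V₂ ↔ η.toBlocks₁₂.det ≠ 0))) ∧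
    -- genericity in `θ`, `θ'` for fixed `η`
    (∀ η : Matrix (Fin 4 ⊕ Fin 4) (Fin 4 ⊕ Fin 4) ℤ, ηᵀ = -η → η.toBlocks₁₂.det ≠ 0 →
      GenericPair fun θ θ' => θ.det ≠ 0 ∧ θ'.det ≠ 0 ∧ (fullForm θ θ' η).det ≠ 0 ∧
        ∀ T V₁ V₂, IsPullback θ θ' η T → IsV₁ T V₁ → IsV₂ T V₂ → SigmaNondegenerate V₁ V₂) ∧
    -- genericity in `η` for fixed `θ`, `θ'`
    (∀ θ θ' : Matrix (Fin 4) (Fin 4) ℝ, θᵀ = -θ → θ'ᵀ = -θ' →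
      GenericIntegral fun η => (fullForm θ θ' η).det ≠ 0 ∧
        ∀ T V₁ V₂, IsPullback θ θ' η T → IsV₁ T V₁ → IsV₂ T V₂ → SigmaNondegenerate V₁ V₂) ∧
    -- the commutative Poincaré module is an elementary module
    (IsPullback 0 0 poincareEta poincareT ∧ (fullForm 0 0 poincareEta).det ≠ 0 ∧
      ∀ V₁ V₂ ρ ρ₁ ρ₂ ip, IsElementaryModule 0 0 poincareT V₁ V₂ ρ ρ₁ ρ₂ ip →
      SigmaNondegenerate V₁ V₂ ∧
      (∀ (μ : Fin 4 → ℤ) (φ : 𝓢(V4, ℂ)) (z : V4),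
        ρ (SmoothTorus.U _ (Sum.elim μ 0)) φ z = φ (z - latticeVec μ) ∧
        ρ (SmoothTorus.U _ (Sum.elim 0 μ)) φ z
          = Complex.exp (linPhase (latticeVec μ) z) * φ z) ∧
      (∀ (α : V4) (φ : 𝓢(V4, ℂ)) (z : V4),
        nablaOf V₁ α φ z = linPhase α z * φ z ∧
        nablaOf V₂ α φ z = deriv (fun t : ℝ => φ (z + t • α)) 0) ∧
      ∃ Φ : 𝓢(V4, ℂ) ≃ₗ[ℂ] PoincareModule,
        (∀ (φ : 𝓢(V4, ℂ)) (x y : V4),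
          HasSum (fun μ : Fin 4 → ℤ =>
            Complex.exp (linPhase (latticeVec μ) x) * φ (y + latticeVec μ)) ((Φ φ).1 (x, y))) ∧
        (∀ (f : PoincareModule) (y : V4), Φ.symm f y = ∫ x in Set.Icc (0 : V4) 1, f.1 (x, y)) ∧
        (∀ a φ p, (Φ (ρ a φ)).1 p = torusFun a p * (Φ φ).1 p) ∧
        (∀ γ φ p, (Φ (nablaSum V₁ V₂ γ φ)).1 p = poincareNabla γ (Φ φ).1 p) ∧
        (∀ φ ψ p, torusFun (ip φ ψ) p = (Φ φ).1 p * starRingEnd ℂ ((Φ ψ).1 p)) ∧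
        (∀ φ ψ, ∫ p in Set.Icc (0 : Phase) 1, (Φ φ).1 p * starRingEnd ℂ ((Φ ψ).1 p)
          = ∫ z, φ z * starRingEnd ℂ (ψ z))) ∧
    -- the conditions on `A`, `B`, `C`, `D` in the explicit form of the deformation
    (∀ θ θ' A B C D : Matrix (Fin 4) (Fin 4) ℝ, ∀ E : Matrix (Fin 4) (Fin 4) ℤ,
      IsPullback θ θ' (mixedForm E) (blockMap A B C D) ↔
        Bᵀ * D - Dᵀ * B = θ ∧ Cᵀ * A - Aᵀ * C = -θ' ∧
        Bᵀ * A - Dᵀ * C = E.map fun k : ℤ => (k : ℝ)) ∧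
    -- the deformation of the Poincaré module
    (∃ ε : ℝ, 0 < ε ∧
      ∃ A B C D : Matrix (Fin 4) (Fin 4) ℝ × Matrix (Fin 4) (Fin 4) ℝ → Matrix (Fin 4) (Fin 4) ℝ,
      ContinuousOn A (smallPairs ε) ∧ ContinuousOn B (smallPairs ε) ∧
      ContinuousOn C (smallPairs ε) ∧ ContinuousOn D (smallPairs ε) ∧
      A 0 = 0 ∧ B 0 = 0 ∧ C 0 = 1 ∧ D 0 = 1 ∧
      ∀ q ∈ smallPairs ε,
        IsPullback q.1 q.2 poincareEta (blockMap (A q) (B q) (C q) (D q)) ∧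
        (fullForm q.1 q.2 poincareEta).det ≠ 0 ∧
        ∃ V₁ V₂ ρ ρ₁ ρ₂ ip,
          IsElementaryModule q.1 q.2 (blockMap (A q) (B q) (C q) (D q)) V₁ V₂ ρ ρ₁ ρ₂ ip ∧
          SigmaNondegenerate V₁ V₂) := by
  refine ⟨fun v w f => ⟨Qop_heis v w f, Qop_Qop v w f⟩, fun θ θ' η hθ hθ' hη => ⟨?_, ?_, ?_⟩,
    fun θ θ' η T hθ hθ' hη hT hdet => ⟨existsUnique_V₁ hdet hT, existsUnique_V₂ hdet hT,
      existsUnique_elementaryAction hθ hθ' hη hT, exists_elementaryModule hθ hθ' hη hT hdet,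
      fun V₁ V₂ h₁ h₂ => hT.sigmaNondegenerate_iff hθ hθ' hη hdet h₁ h₂⟩,
    fun η hη h12 => ?_, fun θ θ' hθ hθ' => ?_,
    ⟨isPullback_poincareT, det_fullForm_poincare, fun V₁ V₂ ρ ρ₁ ρ₂ ip h => h.poincare⟩,
    isPullback_blockMap_iff, ?_⟩
  · exact exists_pullback (fullForm_transpose hθ hθ' hη)
  · exact fun T hT => bijective_iff_det_ne_zero hT
  · exact fun hdet T T' hT hT' => exists_symplectic hdet hT hT'
  · obtain ⟨p, hp, h⟩ := genericPair_nondegenerate η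
    refine ⟨p, hp, fun θ θ' hθ hθ' hne => ?_⟩
    obtain ⟨h1, h2, h3⟩ := h θ θ' hθ hθ' hne
    exact ⟨h1, h2, h3, fun T V₁ V₂ hT h₁ h₂ =>
      (hT.sigmaNondegenerate_iff hθ hθ' hη h3 h₁ h₂).mpr h12⟩
  · obtain ⟨p, hp, h⟩ := genericIntegral_nondegenerate θ θ'
    refine ⟨p, hp, fun η hη hne => ?_⟩
    obtain ⟨h1, h2⟩ := h η hη hne
    exact ⟨h1, fun T V₁ V₂ hT h₁ h₂ => (hT.sigmaNondegenerate_iff hθ hθ' hη h1 h₁ h₂).mpr h2⟩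
  · obtain ⟨ε, hε, hsub⟩ := exists_smallPairs_subset deformDomain_mem_nhds
    have hA : ContinuousOn deformA (smallPairs ε) := fun q hq =>
      (continuousAt_deformA (hsub hq).1 (hsub hq).2.1).continuousWithinAt
    have hmul : ContinuousOn (fun q => q.1 * deformA q) (smallPairs ε) :=
      (continuous_fst.matrix_mul continuous_snd).comp_continuousOn
        (continuous_fst.continuousOn.prodMk hA)
    have hC : ContinuousOn (fun q => 1 + (1 / 2 : ℝ) • (q.1 * deformA q)) (smallPairs ε) :=
      (by fun_prop : Continuous fun M : Matrix (Fin 4) (Fin 4) ℝ =>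
        1 + (1 / 2 : ℝ) • M).comp_continuousOn hmul
    refine ⟨ε, hε, deformA, fun q => -(1 / 2 : ℝ) • q.1,
      fun q => 1 + (1 / 2 : ℝ) • (q.1 * deformA q), fun _ => 1, hA,
      Continuous.continuousOn (by fun_prop), hC,
      continuousOn_const, deformA_zero, by simp, by simp, rfl, fun q hq => ?_⟩
    obtain ⟨hU, hW, hdet⟩ := hsub hq
    have hT := isPullback_deform hq.1 hq.2.1 hU hW
    obtain ⟨V₁, V₂, ρ, ρ₁, ρ₂, ip, h⟩ :=
      exists_elementaryModule hq.1 hq.2.1 poincareEta_transpose hT hdet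
    exact ⟨hT, hdet, V₁, V₂, ρ, ρ₁, ρ₂, ip, h, (hT.sigmaNondegenerate_iff hq.1 hq.2.1
      poincareEta_transpose hdet h.isV₁ h.isV₂).mpr det_poincareEta_toBlocks₁₂⟩
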